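/- Let $d\ge 1$, $\hbar>0$, $\alpha>0$. Let $\varepsilon:\mathbb R^d\to[0,\infty[$ be smooth and such that, for some constants $p_0,c_1,c_2,c_3,\gamma_1,\gamma_2,\gamma_3\in\,]0,\infty[$ with $\gamma_1\le\gamma_2$ and all $|p|>p_0$, one has $c_1|p|^{\gamma_1}\le\varepsilon(p)\le c_2|p|^{\gamma_2}$ and $|\nabla^n\varepsilon(p)|\le c_3|p|^{\gamma_3}$ for $n\in\{0,1,\dots,[(d+1)/\alpha]+1\}$, where $[x]$ is the integer part of $x$. Let $\Omega\subset\mathbb R^d$ be a bounded Lipschitz domain (open, not necessarily connected, and locally near each boundary point the region above a Lipschitz graph; for $d=1$ a finite union of bounded open intervals with disjoint closures). Let $\mu\in\mathbb R$. For $t\in[0,1]$ put $h_\alpha(t):=(1-\alpha)^{-1}\ln[t^\alpha+(1-t)^\alpha]$ if $\alpha\ne1$ and $h_1(t):=-t\ln t-(1-t)\ln(1-t)$ (with $0\ln0:=0$). Put $$U_\alpha(r,t):=\int_0^1 \frac{h_\alpha((1-\lambda)r+\lambda t)-(1-\lambda)h_\alpha(r)-\lambda h_\alpha(t)}{\lambda(1-\lambda)}\,d\lambda,\qquad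 \mathcal U_\alpha[g]:=\frac1{8\pi^2}\int_{\mathbb R\times\mathbb R}\frac{U_\alpha(g(u),g(v))}{(u-v)^2}\,du\,dv .$$ Let $f_T(E):=[1+\exp(E/T)]^{-1}$ and, for $T>0$, $$\eta_\alpha(T,\partial\Omega):=(2\pi\hbar)^{1-d}\int_{\partial\Omega}d\tau(q)\int_{n(q)^\perp}dp\;\mathcal U_\alpha\big[v\mapsto f_T(\varepsilon(p+v\,n(q))-\mu)\big],$$ where $\tau$ is the $(d-1)$-dimensional area measure on $\partial\Omega$ (counting measure if $d=1$) and $n(q)$ is the exterior unit normal of $\Omega$, which exists for $\tau$-almost every $q$. Let $\partial\Gamma_\mu:=\{p:\varepsilon(p)=\mu\}$, with area measure $\sigma$ and exterior unit normal $m(p)$ of $\Gamma_\mu:=\{p:\varepsilon(p)\le\mu\}$, and $$J(\partial\Gamma_\mu,\partial\Omega):=(2\pi\hbar)^{1-d}\int_{\partial\Gamma_\mu\times\partial\Omega}|m(p)\cdot n(q)|\,d\sigma(p)\,d\tau(q).$$ Then: 1. For every $T>0$ the integrals that define $\eta_\alpha(T,\partial\Omega)$ converge absolutely. 2. If $\mu>0$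 and $\nabla\varepsilon(p)\ne0$ for all $p\in\partial\Gamma_\mu$, then the integral that defines $J(\partial\Gamma_\mu,\partial\Omega)$ converges and $$\eta_\alpha(T,\partial\Omega)=\frac{1+\alpha}{2\alpha}\cdot\frac1{12}\,J(\partial\Gamma_\mu,\partial\Omega)\,\ln(\mu/T)+O(1)\qquad(T\downarrow0);$$ in particular, for $\alpha=1$ the coefficient $\eta=\eta_1$ satisfies $\eta(T,\partial\Omega)=\frac1{12}J(\partial\Gamma_\mu,\partial\Omega)\ln(\mu/T)+O(1)$. 3. If $\mu<0$, then $\eta_\alpha(T,\partial\Omega)\to0$ as $T\downarrow0$. -/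

import Mathlib

open MeasureTheory Filter Topology Asymptotics
open scoped ContDiff InnerProductSpace

namespace FermiGas

noncomputable section

/-! ### Entropy functions and the Fermi function -/

/-- The Fermi function `f_T(E) = [1 + exp(E/T)]⁻¹`. -/
def fermi (T E : ℝ) : ℝ := (1 + Real.exp (E / T))⁻¹

/-- The Rényi entropy function `h_α` on `[0,1]`; for `α = 1` it is the von Neumann entropy function
(whose values at `0` and `1` are `0`, because `0 * log 0 = 0`). -/
def renyi (α t : ℝ) : ℝ :=
  if α = 1 then -(t * Real.log t) - (1 - t) * Real.log (1 - t)
  else (1 - α)⁻¹ * Real.log (t ^ α + (1 - t) ^ α)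

/-- The function `U_α(r,t)` on `[0,1] × [0,1]`. -/
def kernelU (α r t : ℝ) : ℝ :=
  ∫ l in (0 : ℝ)..1,
    (renyi α ((1 - l) * r + l * t) - (1 - l) * renyi α r - l * renyi α t) / (l * (1 - l))

/-- The integrand `U_α(g(u), g(v)) / (u - v)²` of the functional `𝒰_α[g]`. -/
def pairIntegrand (α : ℝ) (g : ℝ → ℝ) (x : ℝ × ℝ) : ℝ :=
  kernelU α (g x.1) (g x.2) / (x.1 - x.2) ^ 2

/-- The functional `𝒰_α[g] = (8π²)⁻¹ ∫_{ℝ×ℝ} U_α(g(u), g(v)) / (u - v)² du dv`. -/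
def functionalU (α : ℝ) (g : ℝ → ℝ) : ℝ :=
  1 / (8 * Real.pi ^ 2) * ∫ x : ℝ × ℝ, pairIntegrand α g x

/-! ### Regions and exterior normals -/

/-- `n` is the exterior unit normal of the set `S` at `q`: near `q`, every closed cone around `n`
inside the open half-space `{⟪x - q, n⟫ > 0}` lies outside `S`, and every such cone around `-n`
lies inside `S`. -/
def IsExteriorUnitNormal {d : ℕ} (S : Set (EuclideanSpace ℝ (Fin d)))
    (q n : EuclideanSpace ℝ (Fin d)) : Prop :=
  ‖n‖ = 1 ∧ ∀ c : ℝ, 0 < c → ∀ᶠ x in 𝓝[≠] q,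
    (c * ‖x - q‖ ≤ ⟪x - q, n⟫_ℝ → x ∉ S) ∧ (⟪x - q, n⟫_ℝ ≤ -(c * ‖x - q‖) → x ∈ S)

/-- There is at most one exterior unit normal at a point. -/
theorem IsExteriorUnitNormal.unique {d : ℕ} {S : Set (EuclideanSpace ℝ (Fin d))}
    {q n n' : EuclideanSpace ℝ (Fin d)} (h : IsExteriorUnitNormal S q n)
    (h' : IsExteriorUnitNormal S q n') : n = n' := by
  by_contra hne
  have hw : 0 < ‖n - n'‖ := norm_pos_iff.2 (sub_ne_zero.2 hne)
  have hsq : ‖n - n'‖ ^ 2 = 2 * (1 - ⟪n, n'⟫_ℝ) := by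
    rw [norm_sub_sq_real, h.1, h'.1]; ring
  have ha : 0 < 1 - ⟪n, n'⟫_ℝ := by nlinarith [pow_pos hw 2]
  have h1 : ⟪n - n', n⟫_ℝ = 1 - ⟪n, n'⟫_ℝ := by
    rw [inner_sub_left, real_inner_self_eq_norm_sq, h.1, real_inner_comm]; ring
  have h2 : ⟪n - n', n'⟫_ℝ = -(1 - ⟪n, n'⟫_ℝ) := by
    rw [inner_sub_left, real_inner_self_eq_norm_sq, h'.1]; ring
  have hc : 0 < (1 - ⟪n, n'⟫_ℝ) / ‖n - n'‖ := div_pos ha hw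
  have hev := (h.2 _ hc).and (h'.2 _ hc)
  have ht : Tendsto (fun t : ℝ => q + t • (n - n')) (𝓝[>] 0) (𝓝[≠] q) := by
    refine tendsto_nhdsWithin_iff.2 ⟨?_, ?_⟩
    · have : Continuous fun t : ℝ => q + t • (n - n') := by fun_prop
      have h0 := this.tendsto 0
      simp only [zero_smul, add_zero] at h0
      exact h0.mono_left nhdsWithin_le_nhds
    · filter_upwards [self_mem_nhdsWithin] with t ht
      have ht : 0 < t := ht
      simpa [ht.ne', sub_eq_zero] using hne
  obtain ⟨t, ⟨⟨hA, -⟩, ⟨-, hB⟩⟩, ht0⟩ := ((ht.eventually hev).and self_mem_nhdsWithin).exists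
  have ht0 : 0 < t := ht0
  have hn : (1 - ⟪n, n'⟫_ℝ) / ‖n - n'‖ * ‖q + t • (n - n') - q‖ = t * (1 - ⟪n, n'⟫_ℝ) := by
    rw [add_sub_cancel_left, norm_smul, Real.norm_of_nonneg ht0.le]
    field_simp
  rw [hn, add_sub_cancel_left, inner_smul_left] at hA hB
  rw [h1] at hA
  rw [h2] at hB
  exact hA (by simp) (hB (by simp only [conj_trivial]; linarith))

open Classical in
/-- The exterior unit normal of `S` at `q`, and the zero vector at the exceptional points `q` at
which there is none. -/
def exteriorNormal {d : ℕ} (S : Set (EuclideanSpace ℝ (Fin d)))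
    (q : EuclideanSpace ℝ (Fin d)) : EuclideanSpace ℝ (Fin d) :=
  if h : ∃ n, IsExteriorUnitNormal S q n then h.choose else 0

/-- A Lipschitz domain (possibly disconnected): an open set that near each of its boundary points
agrees with the region `{x | Φ(x') < x_e}` strictly above the graph of a Lipschitz function `Φ`, in
Cartesian coordinates in which `x_e` is the component of `x` along a unit vector `e` and `x'` is
the component of `x` orthogonal to `e`. For `d = 1` these regions are open half-lines. -/
def IsLipschitzDomain {d : ℕ} (Ω : Set (EuclideanSpace ℝ (Fin d))) : Prop :=
  IsOpen Ω ∧ ∀ z ∈ frontier Ω, ∃ (e : EuclideanSpace ℝ (Fin d)) (K : NNReal)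
    (Φ : (ℝ ∙ e)ᗮ → ℝ) (r : ℝ), ‖e‖ = 1 ∧ LipschitzWith K Φ ∧ 0 < r ∧
      ∀ x ∈ Metric.ball z r, x ∈ Ω ↔ Φ ((ℝ ∙ e)ᗮ.orthogonalProjectionOnto x) < ⟪e, x⟫_ℝ

/-! ### The dispersion relation and the Fermi surface -/

/-- The assumptions on the energy-momentum relation `ε`: it is nonnegative and smooth, and outside
a ball around the origin `c₁|p|^γ₁ ≤ ε(p) ≤ c₂|p|^γ₂` and `|∇ⁿε(p)| ≤ c₃|p|^γ₃` for all
`n ≤ [(d+1)/α] + 1`. -/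
structure IsDispersion {d : ℕ} (α : ℝ) (ε : EuclideanSpace ℝ (Fin d) → ℝ) : Prop where
  nonneg : ∀ p, 0 ≤ ε p
  smooth : ContDiff ℝ ∞ ε
  growth : ∃ p₀ c₁ c₂ c₃ γ₁ γ₂ γ₃ : ℝ,
    0 < p₀ ∧ 0 < c₁ ∧ 0 < c₂ ∧ 0 < c₃ ∧ 0 < γ₁ ∧ 0 < γ₂ ∧ 0 < γ₃ ∧ γ₁ ≤ γ₂ ∧
    ∀ p : EuclideanSpace ℝ (Fin d), p₀ < ‖p‖ →
      c₁ * ‖p‖ ^ γ₁ ≤ ε p ∧ ε p ≤ c₂ * ‖p‖ ^ γ₂ ∧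
      ∀ n : ℕ, n ≤ ⌊((d : ℝ) + 1) / α⌋₊ + 1 → ‖iteratedFDeriv ℝ n ε p‖ ≤ c₃ * ‖p‖ ^ γ₃

/-- The Fermi sea `Γ_μ = {ε ≤ μ}`. -/
def fermiSea {d : ℕ} (ε : EuclideanSpace ℝ (Fin d) → ℝ) (μ : ℝ) :
    Set (EuclideanSpace ℝ (Fin d)) := {p | ε p ≤ μ}

/-- The Fermi surface `∂Γ_μ = {ε = μ}`. -/
def fermiSurface {d : ℕ} (ε : EuclideanSpace ℝ (Fin d) → ℝ) (μ : ℝ) :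
    Set (EuclideanSpace ℝ (Fin d)) := {p | ε p = μ}

/-- The canonical `(d-1)`-dimensional area measure on a hypersurface `S` of `ℝᵈ`: the
`(d-1)`-dimensional Hausdorff measure, normalized to agree with Lebesgue measure on `ℝᵈ⁻¹`
(for `d = 1` the counting measure). -/
def areaMeasure {d : ℕ} (S : Set (EuclideanSpace ℝ (Fin d))) :
    Measure (EuclideanSpace ℝ (Fin d)) := (μHE[d - 1]).restrict S

/-- The product of the area measures of the Fermi surface and of `∂Ω`. -/
def doubleSurfaceMeasure {d : ℕ} (ε : EuclideanSpace ℝ (Fin d) → ℝ) (μ : ℝ)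
    (Ω : Set (EuclideanSpace ℝ (Fin d))) :
    Measure (EuclideanSpace ℝ (Fin d) × EuclideanSpace ℝ (Fin d)) :=
  (areaMeasure (fermiSurface ε μ)).prod (areaMeasure (frontier Ω))

/-- `|m(p) · n(q)|`, for the exterior unit normals of the Fermi sea at `p` and of `Ω` at `q`. -/
def normalProduct {d : ℕ} (ε : EuclideanSpace ℝ (Fin d) → ℝ) (μ : ℝ)
    (Ω : Set (EuclideanSpace ℝ (Fin d)))
    (x : EuclideanSpace ℝ (Fin d) × EuclideanSpace ℝ (Fin d)) : ℝ :=
  |⟪exteriorNormal (fermiSea ε μ) x.1, exteriorNormal Ω x.2⟫_ℝ|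

/-- The double surface integral `J(∂Γ_μ, ∂Ω)`; for `d = 1` it is the product of the numbers of
points of `∂Γ_μ` and `∂Ω`. -/
def doubleSurfaceIntegral {d : ℕ} (hbar : ℝ) (ε : EuclideanSpace ℝ (Fin d) → ℝ) (μ : ℝ)
    (Ω : Set (EuclideanSpace ℝ (Fin d))) : ℝ :=
  (2 * Real.pi * hbar) ^ (1 - (d : ℤ)) * ∫ x, normalProduct ε μ Ω x ∂(doubleSurfaceMeasure ε μ Ω)

/-! ### The coefficient `η_α(T, ∂Ω)` -/

/-- The function `f_{T;(p,q)}(v) = f_T(ε(p + v n) - μ)`, with `n = n(q)`. -/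
def lineProfile {d : ℕ} (ε : EuclideanSpace ℝ (Fin d) → ℝ) (μ T : ℝ)
    (n p : EuclideanSpace ℝ (Fin d)) (v : ℝ) : ℝ := fermi T (ε (p + v • n) - μ)

/-- The inner integral `∫ 𝒰_α[f_{T;(p,q)}] dp` over the (co)tangent space of `∂Ω` at `q`, that is,
over the orthogonal complement of `n = n(q)` with its Lebesgue measure. -/
def tangentIntegral {d : ℕ} (α : ℝ) (ε : EuclideanSpace ℝ (Fin d) → ℝ) (μ T : ℝ)
    (n : EuclideanSpace ℝ (Fin d)) : ℝ :=
  ∫ p : (ℝ ∙ n)ᗮ, functionalU α (lineProfile ε μ T n p)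

/-- The coefficient `η_α(T, ∂Ω)`. -/
def eta {d : ℕ} (hbar α : ℝ) (ε : EuclideanSpace ℝ (Fin d) → ℝ) (μ : ℝ)
    (Ω : Set (EuclideanSpace ℝ (Fin d))) (T : ℝ) : ℝ :=
  (2 * Real.pi * hbar) ^ (1 - (d : ℤ)) *
    ∫ q, tangentIntegral α ε μ T (exteriorNormal Ω q) ∂(areaMeasure (frontier Ω))

/-- The integrals that define `η_α(T, ∂Ω)` converge absolutely: for almost every `q ∈ ∂Ω` the
integral over `p`, `u`, `v`, and then the integral over `q`. -/
def EtaConverges {d : ℕ} (α : ℝ) (ε : EuclideanSpace ℝ (Fin d) → ℝ) (μ : ℝ)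
    (Ω : Set (EuclideanSpace ℝ (Fin d))) (T : ℝ) : Prop :=
  (∀ᵐ q ∂(areaMeasure (frontier Ω)),
    Integrable (fun y : (ℝ ∙ exteriorNormal Ω q)ᗮ × (ℝ × ℝ) =>
      pairIntegrand α (lineProfile ε μ T (exteriorNormal Ω q) y.1) y.2) volume) ∧
  Integrable (fun q => tangentIntegral α ε μ T (exteriorNormal Ω q)) (areaMeasure (frontier Ω))

end

end FermiGas

/-! At a boundary point with unit normal n, the substitution x = p + u n, s = v - u turns the triple
integral into ∫ g(s) s⁻² ds. Here g(s) = ∫ U_α(f(x), f(x + s n)) dx over momentum space, and f is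
the Fermi occupation at temperature T. The size of g on three ranges of |s| decides everything.

For |s| ≤ T the two occupations are close and U_α vanishes quadratically. The second derivative of
the entropy function blows up at the occupations 0 and 1, but the slope of the Fermi function is
exponentially small there, and a weight exp(-κ|ε - μ|/T) survives (`abs_kernelU_fermi_le`). Around a
regular Fermi surface this weight has mass O(T) (`HasGrowth.exists_weight_le`), so g(s) = O(s²/T).
For T < |s| ≤ 1 the Hölder continuity of U_α allows f to be replaced by the indicator of Γ_μ at cost
O(T). Then g(s) is U_α(0,1) times the volume of the symmetric difference of Γ_μ and its translate,
which is |s| ∫ |m·n| dσ + O(s²). For |s| > 1, g is bounded. Against s⁻² each sign of s therefore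
contributes U_α(0,1) ∫ |m·n| dσ ln(1/T) + O(1) (`abs_setIntegral_sub_log_le`). Since U_α(0,1) =
π²(1+α)/(6α), the two signs and the prefactor 1/(8π²) give (1+α)/(24α). All bounds are uniform in n
and ∂Ω has finite area, so integration over ∂Ω yields J.

The geometric core is the expansion of the shift volume V with a uniform error. Its leading term
comes from charts that flatten the level set and distort distances by at most 1 + δ, so that δ → 0
replaces an area formula (`tendsto_shiftVolume_div`). The rate comes from doubling: V(2h) and 2V(h)
differ by at most a multiple of the volume of a shell of energy width O(|h|²), and the dyadic
telescope converges (`exists_shiftVolume_rate`).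

Convergence at fixed T > 0 needs only the quadratic bound for small s, the uniform bound for large s
and the finiteness of the weights. For μ < 0 the Fermi sea is empty and every weight carries a
factor exp(-κ|μ|/T), which beats the factor T⁻² of the quadratic bound. -/

namespace FermiGas

open Set

set_option linter.unusedSectionVars false

/-! ### Regularity of the entropy functions -/

/-- Regularity of an entropy function: continuity on `[0,1]`, zeros at the end points, symmetry, and
bounds on the first two derivatives by powers of `x (1 - x)`. -/
structure IsEntropyLike (h : ℝ → ℝ) (κ C : ℝ) : Prop where
  pos : 0 < κ
  lt_one : κ < 1
  nonneg : 0 ≤ C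
  zero : h 0 = 0
  symm : ∀ x, h (1 - x) = h x
  measurable : Measurable h
  continuousOn : ContinuousOn h (Icc 0 1)
  deriv : ∃ h' h'' : ℝ → ℝ, ∀ x ∈ Ioo (0 : ℝ) 1, HasDerivAt h (h' x) x ∧ HasDerivAt h' (h'' x) x ∧
    |h' x| ≤ C * (x * (1 - x)) ^ (κ - 1) ∧ |h'' x| ≤ C * (x * (1 - x)) ^ (κ - 2)

theorem rpow_le_rpow_mul_one_sub {x p q : ℝ} (hx : x ∈ Ioo (0 : ℝ) 1) (hqp : q ≤ p) (hq : q ≤ 0) :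
    x ^ p ≤ (x * (1 - x)) ^ q := by
  calc x ^ p ≤ x ^ q := Real.rpow_le_rpow_of_exponent_ge hx.1 hx.2.le hqp
    _ ≤ (x * (1 - x)) ^ q :=
      Real.rpow_le_rpow_of_nonpos (mul_pos hx.1 (sub_pos.2 hx.2))
        (by nlinarith [hx.1, hx.2]) hq

theorem rpow_add_rpow_pos {α t : ℝ} (ht : t ∈ Icc (0 : ℝ) 1) :
    0 < t ^ α + (1 - t) ^ α := by
  rcases ht.1.eq_or_lt with h | h
  · subst h
    have : (0 : ℝ) ≤ 0 ^ α := Real.rpow_nonneg le_rfl α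
    simp only [sub_zero, Real.one_rpow]
    linarith
  · have := Real.rpow_pos_of_pos h α
    have := Real.rpow_nonneg (sub_nonneg.2 ht.2) α
    linarith

theorem exists_rpow_add_rpow_lower (α : ℝ) (hα : 0 < α) :
    ∃ c : ℝ, 0 < c ∧ ∀ t ∈ Icc (0 : ℝ) 1, c ≤ t ^ α + (1 - t) ^ α := by
  have hc : ContinuousOn (fun t : ℝ => t ^ α + (1 - t) ^ α) (Icc 0 1) :=
    ((continuous_id.rpow_const fun _ => Or.inr hα.le).add
      ((continuous_const.sub continuous_id).rpow_const fun _ => Or.inr hα.le)).continuousOn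
  obtain ⟨t, ht, hmin⟩ := isCompact_Icc.exists_isMinOn (nonempty_Icc.2 zero_le_one) hc
  exact ⟨_, rpow_add_rpow_pos ht, fun s hs => hmin hs⟩

/-- The argument g of the logarithm stays away from 0, so only the powers of t and 1 - t in g' and
g'' are singular. The cap 1/2 on κ keeps κ < 1 when α is large. The term (g'/g)² in the second
derivative is of order (x(1-x))^(2κ-2), which is milder than the allowed power κ - 2. -/
theorem isEntropyLike_renyi_of_ne {α : ℝ} (hα : 0 < α) (h1 : α ≠ 1) :
    ∃ κ C, IsEntropyLike (renyi α) κ C := by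
  obtain ⟨c, hc, hcle⟩ := exists_rpow_add_rpow_lower α hα
  set κ := min α (1 / 2) with hκ
  have hκα : κ ≤ α := min_le_left _ _
  have hκ2 : κ ≤ 1 / 2 := min_le_right _ _
  have hκ0 : 0 < κ := lt_min hα (by norm_num)
  set b : ℝ := |(1 - α)⁻¹| with hb
  have hr : ∀ t, renyi α t = (1 - α)⁻¹ * Real.log (t ^ α + (1 - t) ^ α) := fun t => by
    simp [renyi, h1]
  let g : ℝ → ℝ := fun t => t ^ α + (1 - t) ^ α
  let g1 : ℝ → ℝ := fun t => α * t ^ (α - 1) - α * (1 - t) ^ (α - 1)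
  let g2 : ℝ → ℝ := fun t => α * (α - 1) * t ^ (α - 2) + α * (α - 1) * (1 - t) ^ (α - 2)
  have hg1 : ∀ x ∈ Ioo (0 : ℝ) 1, HasDerivAt g (g1 x) x := fun x hx => by
    have ha := Real.hasDerivAt_rpow_const (x := x) (p := α) (Or.inl hx.1.ne')
    have hb' := ((hasDerivAt_id x).const_sub 1).rpow_const (p := α) (Or.inl (sub_pos.2 hx.2).ne')
    refine (ha.add hb').congr_deriv ?_
    simp only [g1, id]; ring
  have hg2 : ∀ x ∈ Ioo (0 : ℝ) 1, HasDerivAt g1 (g2 x) x := fun x hx => by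
    have ha := (Real.hasDerivAt_rpow_const (x := x) (p := α - 1) (Or.inl hx.1.ne')).const_mul α
    have hb' := (((hasDerivAt_id x).const_sub 1).rpow_const (p := α - 1)
      (Or.inl (sub_pos.2 hx.2).ne')).const_mul α
    refine (ha.sub hb').congr_deriv ?_
    have : α - 1 - 1 = α - 2 := by ring
    simp only [g2, id, this]; ring
  have hw : ∀ x ∈ Ioo (0 : ℝ) 1, 0 < x * (1 - x) := fun x hx => mul_pos hx.1 (sub_pos.2 hx.2)
  have hx' : ∀ x ∈ Ioo (0 : ℝ) 1, 1 - x ∈ Ioo (0 : ℝ) 1 := fun x hx =>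
    ⟨by linarith [hx.2], by linarith [hx.1]⟩
  have bd : ∀ x ∈ Ioo (0 : ℝ) 1, ∀ p q : ℝ, q ≤ p → q ≤ 0 →
      x ^ p + (1 - x) ^ p ≤ 2 * (x * (1 - x)) ^ q := fun x hx p q h h0 => by
    have e1 := rpow_le_rpow_mul_one_sub hx h h0
    have e2 := rpow_le_rpow_mul_one_sub (hx' x hx) h h0
    rw [sub_sub_cancel, mul_comm (1 - x)] at e2
    linarith
  have b1 : ∀ x ∈ Ioo (0 : ℝ) 1, |g1 x| ≤ 2 * α * (x * (1 - x)) ^ (κ - 1) := fun x hx => by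
    have e := bd x hx (α - 1) (κ - 1) (by linarith) (by linarith)
    have p1 := Real.rpow_nonneg hx.1.le (α - 1)
    have p2 := Real.rpow_nonneg (hx' x hx).1.le (α - 1)
    calc |g1 x| = α * |x ^ (α - 1) - (1 - x) ^ (α - 1)| := by
          rw [← abs_of_pos hα, ← abs_mul, abs_of_pos hα]; simp only [g1]; ring_nf
      _ ≤ α * (x ^ (α - 1) + (1 - x) ^ (α - 1)) := by
          gcongr; rw [abs_le]; constructor <;> linarith
      _ ≤ α * (2 * (x * (1 - x)) ^ (κ - 1)) := by gcongr
      _ = _ := by ring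
  have b2 : ∀ x ∈ Ioo (0 : ℝ) 1, |g2 x| ≤ 2 * α * |α - 1| * (x * (1 - x)) ^ (κ - 2) :=
    fun x hx => by
    have e := bd x hx (α - 2) (κ - 2) (by linarith) (by linarith)
    have p1 := Real.rpow_nonneg hx.1.le (α - 2)
    have p2 := Real.rpow_nonneg (hx' x hx).1.le (α - 2)
    calc |g2 x| = α * |α - 1| * (x ^ (α - 2) + (1 - x) ^ (α - 2)) := by
          have : g2 x = α * (α - 1) * (x ^ (α - 2) + (1 - x) ^ (α - 2)) := by
            simp only [g2]; ring
          rw [this, abs_mul, abs_mul, abs_of_pos hα, abs_of_nonneg (add_nonneg p1 p2)]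
      _ ≤ α * |α - 1| * (2 * (x * (1 - x)) ^ (κ - 2)) := by gcongr
      _ = _ := by ring
  have hgc : ∀ x ∈ Ioo (0 : ℝ) 1, c ≤ g x := fun x hx => hcle x ⟨hx.1.le, hx.2.le⟩
  set C₁ : ℝ := b * (2 * α / c) with hC₁
  set C₂ : ℝ := b * (2 * α * |α - 1| / c + (2 * α / c) ^ 2) with hC₂
  have q1 : ∀ x ∈ Ioo (0 : ℝ) 1, |g1 x / g x| ≤ 2 * α / c * (x * (1 - x)) ^ (κ - 1) :=
    fun x hx => by
    have hp := Real.rpow_nonneg (hw x hx).le (κ - 1)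
    rw [abs_div, abs_of_pos (hc.trans_le (hgc x hx)), div_mul_eq_mul_div]
    exact div_le_div₀ (by positivity) (b1 x hx) hc (hgc x hx)
  refine ⟨κ, C₁ + C₂, hκ0, by linarith, by positivity, ?_, ?_, ?_, ?_,
    fun t => (1 - α)⁻¹ * (g1 t / g t),
    fun t => (1 - α)⁻¹ * ((g2 t * g t - g1 t * g1 t) / g t ^ 2), fun x hx => ⟨?_, ?_, ?_, ?_⟩⟩
  · rw [hr]; simp [hα.ne']
  · intro x; rw [hr, hr, sub_sub_cancel, add_comm]
  · have : renyi α = fun t => (1 - α)⁻¹ * Real.log (t ^ α + (1 - t) ^ α) := funext hr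
    rw [this]; fun_prop
  · have : renyi α = fun t => (1 - α)⁻¹ * Real.log (t ^ α + (1 - t) ^ α) := funext hr
    rw [this]
    refine continuousOn_const.mul (ContinuousOn.log ?_ fun t ht => (rpow_add_rpow_pos ht).ne')
    exact ((continuous_id.rpow_const fun _ => Or.inr hα.le).add
      ((continuous_const.sub continuous_id).rpow_const fun _ => Or.inr hα.le)).continuousOn
  · have : renyi α = fun t => (1 - α)⁻¹ * Real.log (g t) := funext hr
    rw [this]
    exact ((hg1 x hx).log (hc.trans_le (hgc x hx)).ne').const_mul _
  · exact ((hg2 x hx).div (hg1 x hx) (hc.trans_le (hgc x hx)).ne').const_mul _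
  · have hp := Real.rpow_nonneg (hw x hx).le (κ - 1)
    rw [abs_mul, add_mul]
    have : b * |g1 x / g x| ≤ b * (2 * α / c * (x * (1 - x)) ^ (κ - 1)) := by
      gcongr; exact q1 x hx
    have h3 : 0 ≤ C₂ * (x * (1 - x)) ^ (κ - 1) := by positivity
    rw [hC₁]; linarith
  · have hp := Real.rpow_nonneg (hw x hx).le (κ - 2)
    have hgx := hc.trans_le (hgc x hx)
    have e : (g2 x * g x - g1 x * g1 x) / g x ^ 2 = g2 x / g x - (g1 x / g x) ^ 2 := by
      field_simp
    have h2 : |g2 x / g x| ≤ 2 * α * |α - 1| / c * (x * (1 - x)) ^ (κ - 2) := by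
      rw [abs_div, abs_of_pos hgx, div_mul_eq_mul_div]
      exact div_le_div₀ (by positivity) (b2 x hx) hc (hgc x hx)
    have h3 : (g1 x / g x) ^ 2 ≤ (2 * α / c) ^ 2 * (x * (1 - x)) ^ (κ - 2) := by
      rw [← sq_abs]
      calc |g1 x / g x| ^ 2 ≤ (2 * α / c * (x * (1 - x)) ^ (κ - 1)) ^ 2 :=
            pow_le_pow_left₀ (abs_nonneg _) (q1 x hx) 2
        _ = (2 * α / c) ^ 2 * (x * (1 - x)) ^ (2 * κ - 2) := by
            rw [mul_pow, ← Real.rpow_mul_natCast (hw x hx).le]; congr 2; push_cast; ring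
        _ ≤ _ := by
            gcongr ?_ * ?_
            exact Real.rpow_le_rpow_of_exponent_ge (hw x hx) (by nlinarith [hx.1, hx.2])
              (by linarith)
    beta_reduce
    rw [e, abs_mul, add_mul]
    have h4 : |g2 x / g x - (g1 x / g x) ^ 2| ≤
        (2 * α * |α - 1| / c + (2 * α / c) ^ 2) * (x * (1 - x)) ^ (κ - 2) := by
      refine (abs_sub _ _).trans ?_
      rw [abs_of_nonneg (sq_nonneg (g1 x / g x)), add_mul]
      exact add_le_add h2 h3
    have h5 := mul_le_mul_of_nonneg_left h4 (abs_nonneg (1 - α)⁻¹)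
    have h6 : 0 ≤ C₁ * (x * (1 - x)) ^ (κ - 2) := by positivity
    rw [hC₂]; linarith

/-- The logarithms in the first derivative are absorbed into a power -1/2; the second derivative is
exactly -1/(x(1-x)), well within the power -3/2. -/
theorem isEntropyLike_renyi_one : IsEntropyLike (renyi 1) (1 / 2) 4 := by
  have hr : renyi 1 = fun t => Real.negMulLog t + Real.negMulLog (1 - t) := by
    funext t; simp only [renyi, if_true, Real.negMulLog]; ring
  refine ⟨by norm_num, by norm_num, by norm_num, ?_, ?_, ?_, ?_,
    fun t => -Real.log t + Real.log (1 - t), fun t => -t⁻¹ - (1 - t)⁻¹, fun x hx => ?_⟩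
  · simp [hr]
  · intro x; simp only [hr, sub_sub_cancel]; ring
  · rw [hr]; simp only [Real.negMulLog]; fun_prop
  · rw [hr]
    exact (Real.continuous_negMulLog.add
      (Real.continuous_negMulLog.comp (continuous_const.sub continuous_id))).continuousOn
  · have hx0 := hx.1
    have hx1 : 0 < 1 - x := sub_pos.2 hx.2
    have hw : 0 < x * (1 - x) := mul_pos hx0 hx1
    have hw1 : x * (1 - x) ≤ 1 := by nlinarith
    refine ⟨?_, ?_, ?_, ?_⟩
    · rw [hr]
      have e1 := Real.hasDerivAt_negMulLog hx0.ne'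
      have e2 := (Real.hasDerivAt_negMulLog hx1.ne').comp x ((hasDerivAt_id x).const_sub 1)
      refine (e1.add e2).congr_deriv ?_
      ring
    · have e1 := (Real.hasDerivAt_log hx0.ne').neg
      have e2 := ((hasDerivAt_id x).const_sub 1).log hx1.ne'
      refine (e1.add e2).congr_deriv ?_
      simp only [id]; ring
    · have l1 : ∀ y : ℝ, 0 < y → y < 1 → |Real.log y| ≤ 2 * y ^ (-(1 / 2) : ℝ) := fun y h0 h1 => by
        rw [abs_of_nonpos (Real.log_nonpos h0.le h1.le)]
        have e := Real.log_le_rpow_div (x := y⁻¹) (inv_nonneg.2 h0.le)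
          (show (0 : ℝ) < 1 / 2 by norm_num)
        rw [Real.log_inv, Real.inv_rpow h0.le, ← Real.rpow_neg h0.le] at e
        linarith
      have a1 := l1 x hx0 hx.2
      have a2 := l1 (1 - x) hx1 (by linarith)
      have c1 := rpow_le_rpow_mul_one_sub hx (p := -(1 / 2)) (q := -(1 / 2)) le_rfl (by norm_num)
      have c2 := rpow_le_rpow_mul_one_sub (x := 1 - x) ⟨hx1, by linarith⟩ (p := -(1 / 2))
        (q := -(1 / 2)) le_rfl (by norm_num)
      rw [sub_sub_cancel, mul_comm (1 - x)] at c2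
      rw [show (1 / 2 - 1 : ℝ) = -(1 / 2) by norm_num]
      have := abs_add_le (-Real.log x) (Real.log (1 - x))
      rw [abs_neg] at this
      linarith
    · have e : -x⁻¹ - (1 - x)⁻¹ = -(x * (1 - x)) ^ (-1 : ℝ) := by
        rw [Real.rpow_neg_one]; field_simp; ring
      beta_reduce
      rw [e, abs_neg, abs_of_pos (Real.rpow_pos_of_pos hw _)]
      have := Real.rpow_le_rpow_of_exponent_ge hw hw1 (show (1 / 2 - 2 : ℝ) ≤ -1 by norm_num)
      have := Real.rpow_pos_of_pos hw (1 / 2 - 2)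
      linarith

theorem exists_isEntropyLike_renyi {α : ℝ} (hα : 0 < α) : ∃ κ C, IsEntropyLike (renyi α) κ C := by
  by_cases h : α = 1
  · subst h; exact ⟨_, _, isEntropyLike_renyi_one⟩
  · exact isEntropyLike_renyi_of_ne hα h

/-! ### Bounds on the function `U_α` -/

namespace IsEntropyLike

variable {h : ℝ → ℝ} {κ C : ℝ}

theorem one (H : IsEntropyLike h κ C) : h 1 = 0 := by
  have := H.symm 1
  rw [sub_self, H.zero] at this
  exact this.symm

/-- The function σh - (2C/κ)(t^κ - (1-t)^κ) is antitone, because the derivative of the comparison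
function dominates |h'|. Subadditivity of t ↦ t^κ then gives the Hölder bound. The sign σ yields
both directions at once. -/
theorem sub_le_of_le (H : IsEntropyLike h κ C) {σ : ℝ} (hσ : |σ| ≤ 1) {x y : ℝ} (hx : 0 ≤ x)
    (hxy : x ≤ y) (hy : y ≤ 1) : σ * (h y - h x) ≤ 4 * C / κ * (y - x) ^ κ := by
  have hκ := H.pos
  have hκ1 := H.lt_one
  have hC := H.nonneg
  obtain ⟨h', h'', hd⟩ := H.deriv
  let G : ℝ → ℝ := fun t => σ * h t - 2 * C / κ * (t ^ κ - (1 - t) ^ κ)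
  have hGc : ContinuousOn G (Icc 0 1) := by
    refine (continuousOn_const.mul H.continuousOn).sub (continuousOn_const.mul ?_)
    exact ((continuous_id.rpow_const fun _ => Or.inr hκ.le).sub
      ((continuous_const.sub continuous_id).rpow_const fun _ => Or.inr hκ.le)).continuousOn
  have hGd : ∀ t ∈ Ioo (0 : ℝ) 1, HasDerivAt G
      (σ * h' t - 2 * C * (t ^ (κ - 1) + (1 - t) ^ (κ - 1))) t := fun t ht => by
    have e1 := Real.hasDerivAt_rpow_const (x := t) (p := κ) (Or.inl ht.1.ne')
    have e2 := ((hasDerivAt_id t).const_sub 1).rpow_const (p := κ) (Or.inl (sub_pos.2 ht.2).ne')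
    refine (((hd t ht).1.const_mul σ).sub ((e1.sub e2).const_mul (2 * C / κ))).congr_deriv ?_
    simp only [id]; field_simp; ring
  have hanti : AntitoneOn G (Icc 0 1) := by
    refine antitoneOn_of_deriv_nonpos (convex_Icc 0 1) hGc ?_ ?_
    · rw [interior_Icc]
      exact fun t ht => (hGd t ht).differentiableAt.differentiableWithinAt
    · rw [interior_Icc]
      intro t ht
      rw [(hGd t ht).deriv]
      have hb := (hd t ht).2.2.1
      have h1t : 0 < 1 - t := sub_pos.2 ht.2
      -- One of t and 1 - t is at least 1/2, and its power κ - 1 > -1 is at most 2.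
      have key : (t * (1 - t)) ^ (κ - 1) ≤ 2 * (t ^ (κ - 1) + (1 - t) ^ (κ - 1)) := by
        have p1 := Real.rpow_pos_of_pos ht.1 (κ - 1)
        have p2 := Real.rpow_pos_of_pos h1t (κ - 1)
        have two : ∀ u : ℝ, 1 / 2 ≤ u → u ^ (κ - 1) ≤ 2 := fun u hu =>
          calc u ^ (κ - 1) ≤ (1 / 2 : ℝ) ^ (κ - 1) :=
                Real.rpow_le_rpow_of_nonpos (by norm_num) hu (by linarith)
            _ ≤ (1 / 2 : ℝ) ^ (-1 : ℝ) :=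
                Real.rpow_le_rpow_of_exponent_ge (by norm_num) (by norm_num) (by linarith)
            _ = 2 := by rw [Real.rpow_neg_one]; norm_num
        rw [Real.mul_rpow ht.1.le h1t.le]
        rcases le_total t (1 / 2) with hl | hl
        · nlinarith [two (1 - t) (by linarith)]
        · nlinarith [two t hl]
      have h2 : σ * h' t ≤ |h' t| := by
        calc σ * h' t ≤ |σ * h' t| := le_abs_self _
          _ = |σ| * |h' t| := abs_mul _ _
          _ ≤ 1 * |h' t| := by gcongr
          _ = _ := one_mul _
      nlinarith
  have e := hanti ⟨hx, hxy.trans hy⟩ ⟨hx.trans hxy, hy⟩ hxy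
  have sub : ∀ u v : ℝ, 0 ≤ u → u ≤ v → v ^ κ - u ^ κ ≤ (v - u) ^ κ := fun u v hu huv => by
    have := Real.rpow_add_le_add_rpow hu (sub_nonneg.2 huv) hκ.le hκ1.le
    rw [add_sub_cancel] at this
    linarith
  have s1 := sub x y hx hxy
  have s2 := sub (1 - y) (1 - x) (by linarith) (by linarith)
  rw [show 1 - x - (1 - y) = y - x by ring] at s2
  have hk : 0 ≤ 2 * C / κ := by positivity
  simp only [G] at e
  have : σ * (h y - h x) ≤
      2 * C / κ * ((y ^ κ - x ^ κ) + ((1 - x) ^ κ - (1 - y) ^ κ)) := by linarith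
  calc _ ≤ _ := this
    _ ≤ 2 * C / κ * ((y - x) ^ κ + (y - x) ^ κ) := by gcongr
    _ = _ := by ring

theorem abs_sub_le (H : IsEntropyLike h κ C) {x y : ℝ} (hx : x ∈ Icc (0 : ℝ) 1)
    (hy : y ∈ Icc (0 : ℝ) 1) : |h x - h y| ≤ 4 * C / κ * |x - y| ^ κ := by
  wlog hxy : x ≤ y generalizing x y
  · rw [abs_sub_comm, abs_sub_comm x]
    exact this hy hx (le_of_not_ge hxy)
  rw [abs_sub_comm, abs_sub_comm x, abs_of_nonneg (sub_nonneg.2 hxy), abs_le]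
  have e1 := H.sub_le_of_le (σ := 1) (by norm_num) hx.1 hxy hy.2
  have e2 := H.sub_le_of_le (σ := -1) (by norm_num) hx.1 hxy hy.2
  constructor <;> linarith

end IsEntropyLike

/-- The deviation of `h` from its linear interpolation between `r` and `t`. -/
noncomputable def defect (h : ℝ → ℝ) (r t l : ℝ) : ℝ :=
  h ((1 - l) * r + l * t) - (1 - l) * h r - l * h t

theorem segment_mem {r t l : ℝ} (hr : r ∈ Icc (0 : ℝ) 1) (ht : t ∈ Icc (0 : ℝ) 1)
    (hl : l ∈ Icc (0 : ℝ) 1) : (1 - l) * r + l * t ∈ Icc (0 : ℝ) 1 := by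
  have := convex_Icc (0 : ℝ) 1 hr ht (sub_nonneg.2 hl.2) hl.1 (by ring)
  simpa using this

theorem self_le_rpow {l κ : ℝ} (hl : l ∈ Icc (0 : ℝ) 1) (h0 : 0 < κ) (h1 : κ ≤ 1) : l ≤ l ^ κ := by
  simpa using Real.rpow_le_rpow_of_exponent_ge' hl.1 hl.2 h0.le h1

namespace IsEntropyLike

variable {h : ℝ → ℝ} {κ C : ℝ}

/-- The defect is a convex combination of two increments of h, over distances l|r-t| and (1-l)|r-t|.
The coefficients 1-l and l are weakened to their κ-th powers, so that the bound vanishes at both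
ends and is integrable against dl/(l(1-l)). -/
theorem abs_defect_le (H : IsEntropyLike h κ C) {r t l : ℝ} (hr : r ∈ Icc (0 : ℝ) 1)
    (ht : t ∈ Icc (0 : ℝ) 1) (hl : l ∈ Icc (0 : ℝ) 1) :
    |defect h r t l| ≤ 8 * C / κ * |r - t| ^ κ * (l * (1 - l)) ^ κ := by
  have hκ := H.pos
  have hC := H.nonneg
  have hm := segment_mem hr ht hl
  have hl' : 1 - l ∈ Icc (0 : ℝ) 1 := ⟨sub_nonneg.2 hl.2, by linarith [hl.1]⟩
  have e1 := H.abs_sub_le hm hr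
  have e2 := H.abs_sub_le hm ht
  rw [show (1 - l) * r + l * t - r = l * (t - r) by ring, abs_mul, abs_of_nonneg hl.1,
    Real.mul_rpow hl.1 (abs_nonneg _)] at e1
  rw [show (1 - l) * r + l * t - t = (1 - l) * (r - t) by ring, abs_mul, abs_of_nonneg hl'.1,
    Real.mul_rpow hl'.1 (abs_nonneg _)] at e2
  have d : defect h r t l = (1 - l) * (h ((1 - l) * r + l * t) - h r) +
      l * (h ((1 - l) * r + l * t) - h t) := by simp only [defect]; ring
  rw [abs_sub_comm t r] at e1
  have q1 := self_le_rpow hl hκ H.lt_one.le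
  have q2 := self_le_rpow hl' hκ H.lt_one.le
  have p1 := Real.rpow_nonneg hl.1 κ
  have p2 := Real.rpow_nonneg hl'.1 κ
  have p3 := Real.rpow_nonneg (abs_nonneg (r - t)) κ
  rw [d]
  calc |_| ≤ (1 - l) * |h ((1 - l) * r + l * t) - h r| +
        l * |h ((1 - l) * r + l * t) - h t| := by
        refine (abs_add_le _ _).trans ?_
        rw [abs_mul, abs_mul, abs_of_nonneg hl.1, abs_of_nonneg hl'.1]
    _ ≤ (1 - l) ^ κ * (4 * C / κ * (l ^ κ * |r - t| ^ κ)) +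
        l ^ κ * (4 * C / κ * ((1 - l) ^ κ * |r - t| ^ κ)) := by
        gcongr
    _ = _ := by rw [Real.mul_rpow hl.1 hl'.1]; ring

/-- Continuity in (r,t), but with no decay at l = 0 and l = 1. On its own it is not integrable
against dl/(l(1-l)); `abs_kernelU_sub_le` interpolates it with `abs_defect_le`. -/
theorem abs_defect_sub_le (H : IsEntropyLike h κ C) {r t r' t' l : ℝ} (hr : r ∈ Icc (0 : ℝ) 1)
    (ht : t ∈ Icc (0 : ℝ) 1) (hr' : r' ∈ Icc (0 : ℝ) 1) (ht' : t' ∈ Icc (0 : ℝ) 1)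
    (hl : l ∈ Icc (0 : ℝ) 1) :
    |defect h r t l - defect h r' t' l| ≤ 8 * C / κ * (|r - r'| ^ κ + |t - t'| ^ κ) := by
  have hκ := H.pos
  have hC := H.nonneg
  have hl' : 1 - l ∈ Icc (0 : ℝ) 1 := ⟨sub_nonneg.2 hl.2, by linarith [hl.1]⟩
  have e1 := H.abs_sub_le (segment_mem hr ht hl) (segment_mem hr' ht' hl)
  have e2 := H.abs_sub_le hr hr'
  have e3 := H.abs_sub_le ht ht'
  have p1 := Real.rpow_nonneg (abs_nonneg (r - r')) κ
  have p2 := Real.rpow_nonneg (abs_nonneg (t - t')) κ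
  have hm : |(1 - l) * r + l * t - ((1 - l) * r' + l * t')| ^ κ ≤
      |r - r'| ^ κ + |t - t'| ^ κ := by
    rw [show (1 - l) * r + l * t - ((1 - l) * r' + l * t') =
      (1 - l) * (r - r') + l * (t - t') by ring]
    have : |(1 - l) * (r - r') + l * (t - t')| ≤ |r - r'| + |t - t'| := by
      refine (abs_add_le _ _).trans ?_
      rw [abs_mul, abs_mul, abs_of_nonneg hl.1, abs_of_nonneg hl'.1]
      nlinarith [abs_nonneg (r - r'), abs_nonneg (t - t'), hl.1, hl.2]
    calc _ ≤ (|r - r'| + |t - t'|) ^ κ := Real.rpow_le_rpow (abs_nonneg _) this hκ.le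
      _ ≤ _ := Real.rpow_add_le_add_rpow (abs_nonneg _) (abs_nonneg _) hκ.le H.lt_one.le
  have d : defect h r t l - defect h r' t' l =
      (h ((1 - l) * r + l * t) - h ((1 - l) * r' + l * t')) - (1 - l) * (h r - h r')
        - l * (h t - h t') := by simp only [defect]; ring
  have hk : 0 ≤ 4 * C / κ := by positivity
  rw [d]
  calc |_| ≤ |h ((1 - l) * r + l * t) - h ((1 - l) * r' + l * t')| + (1 - l) * |h r - h r'|
        + l * |h t - h t'| := by
        refine (abs_sub _ _).trans (add_le_add ((abs_sub _ _).trans ?_) ?_)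
        · rw [abs_mul, abs_of_nonneg hl'.1]
        · rw [abs_mul, abs_of_nonneg hl.1]
    _ ≤ 4 * C / κ * (|r - r'| ^ κ + |t - t'| ^ κ) + 1 * (4 * C / κ * |r - r'| ^ κ)
        + 1 * (4 * C / κ * |t - t'| ^ κ) := by
        gcongr
        · exact e1.trans (by gcongr)
        · exact hl'.2
        · exact hl.2
    _ = _ := by ring

/-- For both signs σ the function σh + (M/2)x² is convex on [r,t], and the defect of x² is -(r-t)²
l(1-l). -/
theorem abs_defect_le_sq (H : IsEntropyLike h κ C) {h' h'' : ℝ → ℝ}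
    (hd : ∀ x ∈ Ioo (0 : ℝ) 1, HasDerivAt h (h' x) x ∧ HasDerivAt h' (h'' x) x) {r t l M : ℝ}
    (hr : 0 < r) (hrt : r ≤ t) (ht : t < 1) (hl : l ∈ Icc (0 : ℝ) 1)
    (hM : ∀ x ∈ Icc r t, |h'' x| ≤ M) :
    |defect h r t l| ≤ M * (r - t) ^ 2 * (l * (1 - l)) := by
  have hsub : Icc r t ⊆ Ioo 0 1 := fun x hx => ⟨hr.trans_le hx.1, hx.2.trans_lt ht⟩
  have hM0 : 0 ≤ M := (abs_nonneg _).trans (hM r ⟨le_rfl, hrt⟩)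
  have hl' : 0 ≤ 1 - l := sub_nonneg.2 hl.2
  have key : ∀ σ : ℝ, |σ| = 1 → σ * defect h r t l ≤ M * (r - t) ^ 2 * (l * (1 - l)) := by
    intro σ hσ
    have hconv : ConvexOn ℝ (Icc r t) fun x => σ * h x + M / 2 * x ^ 2 := by
      refine convexOn_of_hasDerivWithinAt2_nonneg (convex_Icc r t)
        (f' := fun x => σ * h' x + M * x) (f'' := fun x => σ * h'' x + M) ?_ ?_ ?_ ?_
      · exact (continuousOn_const.mul (H.continuousOn.mono (hsub.trans Ioo_subset_Icc_self))).add
          (by fun_prop)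
      · intro x hx
        have h2 := ((hasDerivAt_pow 2 x).const_mul (M / 2))
        refine ((((hd x (hsub (interior_subset hx))).1.const_mul σ).add h2).congr_deriv
          ?_).hasDerivWithinAt
        simp; ring
      · intro x hx
        have h2 := ((hasDerivAt_id x).const_mul M)
        refine ((((hd x (hsub (interior_subset hx))).2.const_mul σ).add h2).congr_deriv
          ?_).hasDerivWithinAt
        simp
      · intro x hx
        have := hM x (interior_subset hx)
        have h3 : |σ * h'' x| ≤ M := by rw [abs_mul, hσ, one_mul]; exact this
        linarith [(abs_le.1 h3).1]
    have e := hconv.2 (left_mem_Icc.2 hrt) (right_mem_Icc.2 hrt) hl' hl.1 (by ring)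
    simp only [smul_eq_mul] at e
    have e2 : (1 - l) * r ^ 2 + l * t ^ 2 - ((1 - l) * r + l * t) ^ 2 =
      (r - t) ^ 2 * (l * (1 - l)) := by ring
    have e3 : 0 ≤ M * (r - t) ^ 2 * (l * (1 - l)) := by
      have := hl.1; positivity
    simp only [defect]
    nlinarith
  rw [abs_le]
  have e1 := key 1 (by norm_num)
  have e2 := key (-1) (by norm_num)
  constructor <;> linarith

end IsEntropyLike

theorem rpow_mul_one_sub_intervalIntegrable {p : ℝ} (hp : -1 < p) :
    IntervalIntegrable (fun l : ℝ => (l * (1 - l)) ^ p) volume 0 1 := by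
  have half : ∀ q : ℝ, -1 < q →
      IntervalIntegrable (fun l : ℝ => (l * (1 - l)) ^ q) volume 0 (1 / 2) := by
    intro q hq
    have h1 : IntervalIntegrable (fun l : ℝ => l ^ q) volume 0 (1 / 2) :=
      intervalIntegral.intervalIntegrable_rpow' hq
    have h2 : IntervalIntegrable (fun l : ℝ => l ^ q * (1 - l) ^ q) volume 0 (1 / 2) := by
      refine h1.mul_continuousOn ?_
      intro l hl
      rw [uIcc_of_le (by norm_num)] at hl
      exact ((continuousAt_const.sub continuousAt_id).rpow_const
        (Or.inl (sub_pos.2 (lt_of_le_of_lt hl.2 (by norm_num))).ne')).continuousWithinAt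
    refine h2.congr ?_
    intro l hl
    rw [uIoc_of_le (by norm_num)] at hl
    exact (Real.mul_rpow hl.1.le (by linarith [hl.2])).symm
  have h3 := (half p hp).comp_sub_left 1
  refine (half p hp).trans ?_
  have e : (1 : ℝ) - 1 / 2 = 1 / 2 := by norm_num
  rw [e, sub_zero] at h3
  refine h3.symm.congr ?_
  intro l hl
  beta_reduce
  rw [sub_sub_cancel, mul_comm]

theorem renyi_defect {α r t l : ℝ} :
    (renyi α ((1 - l) * r + l * t) - (1 - l) * renyi α r - l * renyi α t) / (l * (1 - l)) =
      defect (renyi α) r t l / (l * (1 - l)) := rfl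

theorem measurable_defect {h : ℝ → ℝ} (hm : Measurable h) :
    Measurable fun x : (ℝ × ℝ) × ℝ => defect h x.1.1 x.1.2 x.2 / (x.2 * (1 - x.2)) := by
  simp only [defect]; fun_prop

theorem measurable_kernelU {α : ℝ} (hm : Measurable (renyi α)) :
    Measurable fun x : ℝ × ℝ => kernelU α x.1 x.2 := by
  have h1 : StronglyMeasurable fun x : ℝ × ℝ =>
      ∫ l in Ioc (0 : ℝ) 1, defect (renyi α) x.1 x.2 l / (l * (1 - l)) :=
    (measurable_defect hm).stronglyMeasurable.integral_prod_right'
  convert h1.measurable using 2 with x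
  rw [kernelU, intervalIntegral.integral_of_le zero_le_one]
  rfl

/-- An upper bound for an integral against `dl / (l (1 - l))`. -/
theorem abs_integral_div_le {f : ℝ → ℝ} {A p : ℝ} (hp : 0 < p)
    (hf : ∀ l ∈ Ioc (0 : ℝ) 1, |f l| ≤ A * (l * (1 - l)) ^ p) :
    |∫ l in (0 : ℝ)..1, f l / (l * (1 - l))| ≤
      A * ∫ l in (0 : ℝ)..1, (l * (1 - l)) ^ (p - 1) := by
  have hi := (rpow_mul_one_sub_intervalIntegrable (p := p - 1) (by linarith)).const_mul A
  rw [← intervalIntegral.integral_const_mul]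
  refine intervalIntegral.norm_integral_le_of_norm_le (E := ℝ) zero_le_one ?_ hi
  have hne : ∀ᵐ l : ℝ, l ≠ 1 := by simp [ae_iff, measure_singleton]
  filter_upwards [hne] with l hl1 hl
  have hw : 0 < l * (1 - l) := mul_pos hl.1 (sub_pos.2 (lt_of_le_of_ne hl.2 hl1))
  rw [Real.norm_eq_abs, abs_div, abs_of_pos hw, div_le_iff₀ hw]
  calc |f l| ≤ A * (l * (1 - l)) ^ p := hf l hl
    _ = A * (l * (1 - l)) ^ (p - 1) * (l * (1 - l)) := by
      rw [mul_assoc, ← Real.rpow_add_one hw.ne', sub_add_cancel]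

theorem intervalIntegrable_defect_div {h : ℝ → ℝ} {κ C : ℝ} (H : IsEntropyLike h κ C) {r t : ℝ}
    (hr : r ∈ Icc (0 : ℝ) 1) (ht : t ∈ Icc (0 : ℝ) 1) :
    IntervalIntegrable (fun l => defect h r t l / (l * (1 - l))) volume 0 1 := by
  have hi := (rpow_mul_one_sub_intervalIntegrable (p := κ - 1) (by linarith [H.pos])).const_mul
    (8 * C / κ * |r - t| ^ κ)
  rw [intervalIntegrable_iff_integrableOn_Ioc_of_le zero_le_one] at hi ⊢
  refine hi.mono' ?_ ?_
  · exact ((measurable_defect H.measurable).comp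
      (measurable_const.prodMk measurable_id : Measurable fun l : ℝ => ((r, t), l))
      ).aestronglyMeasurable
  · have hne : ∀ᵐ l : ℝ ∂volume.restrict (Ioc 0 1), l ≠ 1 :=
      ae_restrict_of_ae (by simp [ae_iff, measure_singleton])
    filter_upwards [hne, ae_restrict_mem measurableSet_Ioc] with l hl1 hl
    have hw : 0 < l * (1 - l) := mul_pos hl.1 (sub_pos.2 (lt_of_le_of_ne hl.2 hl1))
    rw [Real.norm_eq_abs, abs_div, abs_of_pos hw, div_le_iff₀ hw]
    calc |defect h r t l| ≤ _ := H.abs_defect_le hr ht ⟨hl.1.le, hl.2⟩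
      _ = 8 * C / κ * |r - t| ^ κ * (l * (1 - l)) ^ (κ - 1) * (l * (1 - l)) := by
        rw [mul_assoc _ _ (l * (1 - l)), ← Real.rpow_add_one hw.ne', sub_add_cancel]

theorem kernelU_self {α r : ℝ} : kernelU α r r = 0 := by
  have : ∀ l : ℝ, (1 - l) * r + l * r = r := fun l => by ring
  have h2 : ∀ l : ℝ, renyi α r - (1 - l) * renyi α r - l * renyi α r = 0 := fun l => by ring
  simp [kernelU, this, h2]

theorem kernelU_comm {α r t : ℝ} : kernelU α r t = kernelU α t r := by
  have h := intervalIntegral.integral_comp_sub_left (a := 0) (b := 1)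
    (fun l => (renyi α ((1 - l) * t + l * r) - (1 - l) * renyi α t - l * renyi α r) /
      (l * (1 - l))) 1
  rw [sub_self, sub_zero] at h
  rw [kernelU, kernelU, ← h]
  congr 1
  funext l
  rw [sub_sub_cancel, add_comm, mul_comm l (1 - l)]
  congr 1
  ring

/-- `U_α` is bounded by a power of the distance of its arguments. -/
theorem abs_kernelU_le {α κ C : ℝ} (H : IsEntropyLike (renyi α) κ C) :
    ∃ A, 0 ≤ A ∧ ∀ r ∈ Icc (0 : ℝ) 1, ∀ t ∈ Icc (0 : ℝ) 1, |kernelU α r t| ≤ A * |r - t| ^ κ := by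
  have hκ := H.pos
  have hC := H.nonneg
  refine ⟨8 * C / κ * |∫ l in (0 : ℝ)..1, (l * (1 - l)) ^ (κ - 1)|, by positivity,
    fun r hr t ht => ?_⟩
  have := abs_integral_div_le (f := defect (renyi α) r t) (A := 8 * C / κ * |r - t| ^ κ) hκ
    fun l hl => H.abs_defect_le hr ht ⟨hl.1.le, hl.2⟩
  calc |kernelU α r t| ≤ _ := this
    _ ≤ 8 * C / κ * |r - t| ^ κ * |∫ l in (0 : ℝ)..1, (l * (1 - l)) ^ (κ - 1)| := by
      gcongr; exact le_abs_self _
    _ = _ := by ring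

/-- `U_α` is Hölder continuous. -/
theorem abs_kernelU_sub_le {α κ C : ℝ} (H : IsEntropyLike (renyi α) κ C) :
    ∃ A, 0 ≤ A ∧ ∀ r ∈ Icc (0 : ℝ) 1, ∀ t ∈ Icc (0 : ℝ) 1, ∀ r' ∈ Icc (0 : ℝ) 1,
      ∀ t' ∈ Icc (0 : ℝ) 1, |kernelU α r t - kernelU α r' t'| ≤
        A * (|r - r'| ^ (κ / 2) + |t - t'| ^ (κ / 2)) := by
  have hκ := H.pos
  have hC := H.nonneg
  refine ⟨16 * C / κ * |∫ l in (0 : ℝ)..1, (l * (1 - l)) ^ (κ / 2 - 1)|, by positivity,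
    fun r hr t ht r' hr' t' ht' => ?_⟩
  set D := |r - r'| ^ (κ / 2) + |t - t'| ^ (κ / 2) with hD
  have hD0 : 0 ≤ D := by positivity
  have hDsq : |r - r'| ^ κ + |t - t'| ^ κ ≤ D ^ 2 := by
    have e : ∀ x : ℝ, 0 ≤ x → x ^ κ = (x ^ (κ / 2)) ^ 2 := fun x hx => by
      rw [← Real.rpow_mul_natCast hx]; congr 1; push_cast; ring
    rw [e _ (abs_nonneg _), e _ (abs_nonneg _), hD]
    have := Real.rpow_nonneg (abs_nonneg (r - r')) (κ / 2)
    have := Real.rpow_nonneg (abs_nonneg (t - t')) (κ / 2)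
    nlinarith
  have e : kernelU α r t - kernelU α r' t' = ∫ l in (0 : ℝ)..1,
      (defect (renyi α) r t l - defect (renyi α) r' t' l) / (l * (1 - l)) := by
    rw [kernelU, kernelU]
    simp only [renyi_defect]
    rw [← intervalIntegral.integral_sub (intervalIntegrable_defect_div H hr ht)
      (intervalIntegrable_defect_div H hr' ht')]
    congr 1; funext l; ring
  have one_le : ∀ x ∈ Icc (0 : ℝ) 1, ∀ y ∈ Icc (0 : ℝ) 1, |x - y| ^ κ ≤ 1 := fun x hx y hy =>
    Real.rpow_le_one (abs_nonneg _) (abs_le.2 ⟨by linarith [hx.1, hy.2], by linarith [hx.2, hy.1]⟩)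
      hκ.le
  -- Two bounds are available, one of order D² and one of order W² with W = (l(1-l))^(κ/2). Their
  -- minimum is at most of order D W, which keeps half of the continuity and half of the decay. This
  -- is the origin of the exponent κ/2.
  have := abs_integral_div_le
    (f := fun l => defect (renyi α) r t l - defect (renyi α) r' t' l)
    (A := 16 * C / κ * D) (p := κ / 2) (by linarith) fun l hl => by
      have hl' : l ∈ Icc (0 : ℝ) 1 := ⟨hl.1.le, hl.2⟩
      have hw : 0 ≤ l * (1 - l) := mul_nonneg hl.1.le (sub_nonneg.2 hl.2)
      have w2 : (l * (1 - l)) ^ κ = ((l * (1 - l)) ^ (κ / 2)) ^ 2 := by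
        rw [← Real.rpow_mul_natCast hw]; congr 1; push_cast; ring
      have hwk := Real.rpow_nonneg hw (κ / 2)
      have b1 := (H.abs_defect_sub_le hr ht hr' ht' hl').trans
        (mul_le_mul_of_nonneg_left hDsq (by positivity))
      have b2 : |defect (renyi α) r t l - defect (renyi α) r' t' l| ≤
          16 * C / κ * ((l * (1 - l)) ^ (κ / 2)) ^ 2 := by
        rw [← w2]
        refine (abs_sub _ _).trans ?_
        have d1 := H.abs_defect_le hr ht hl'
        have d2 := H.abs_defect_le hr' ht' hl'
        have o1 := one_le r hr t ht
        have o2 := one_le r' hr' t' ht'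
        have hk : 0 ≤ 8 * C / κ * (l * (1 - l)) ^ κ := by positivity
        have := mul_le_mul_of_nonneg_left o1 hk
        have := mul_le_mul_of_nonneg_left o2 hk
        have e3 : 16 * C / κ * (l * (1 - l)) ^ κ = 2 * (8 * C / κ * (l * (1 - l)) ^ κ * 1) := by
          ring
        rw [e3]
        linarith
      have hk : 0 ≤ C / κ := by positivity
      rcases le_total D ((l * (1 - l)) ^ (κ / 2)) with hc | hc
      · have := mul_le_mul_of_nonneg_left hc (mul_nonneg hk hD0)
        have : 0 ≤ C / κ * D ^ 2 := by positivity
        calc _ ≤ _ := b1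
          _ = 8 * (C / κ * D ^ 2) := by ring
          _ ≤ 16 * (C / κ * D * (l * (1 - l)) ^ (κ / 2)) := by nlinarith
          _ = _ := by ring
      · have := mul_le_mul_of_nonneg_left hc (mul_nonneg hk hwk)
        calc _ ≤ _ := b2
          _ = 16 * (C / κ * (l * (1 - l)) ^ (κ / 2) * (l * (1 - l)) ^ (κ / 2)) := by ring
          _ ≤ 16 * (C / κ * (l * (1 - l)) ^ (κ / 2) * D) := by gcongr
          _ = _ := by ring
  rw [e]
  calc _ ≤ _ := this
    _ ≤ 16 * C / κ * D * |∫ l in (0 : ℝ)..1, (l * (1 - l)) ^ (κ / 2 - 1)| := by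
      gcongr; exact le_abs_self _
    _ = _ := by ring

/-! ### The kernel along the Fermi function -/

theorem fermi_pos (T E : ℝ) : 0 < fermi T E := by
  have := Real.exp_pos (E / T); simp only [fermi]; positivity

theorem fermi_lt_one (T E : ℝ) : fermi T E < 1 := by
  have := Real.exp_pos (E / T)
  exact inv_lt_one_of_one_lt₀ (by linarith)

theorem fermi_mem (T E : ℝ) : fermi T E ∈ Icc (0 : ℝ) 1 :=
  ⟨(fermi_pos T E).le, (fermi_lt_one T E).le⟩

theorem fermi_eq (T E : ℝ) : fermi T E = fermi 1 (E / T) := by simp [fermi]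

theorem fermi_neg (T E : ℝ) : fermi T (-E) = 1 - fermi T E := by
  have := Real.exp_pos (E / T)
  simp only [fermi, neg_div, Real.exp_neg]
  field_simp
  ring

theorem fermi_le_exp (a : ℝ) : fermi 1 a ≤ Real.exp (-a) := by
  have := Real.exp_pos a
  rw [Real.exp_neg, fermi, div_one]
  gcongr; linarith

theorem hasDerivAt_fermi (a : ℝ) :
    HasDerivAt (fermi 1) (-(fermi 1 a * (1 - fermi 1 a))) a := by
  have h1 : HasDerivAt (fun a : ℝ => 1 + Real.exp (a / 1)) (Real.exp a) a := by
    simpa using (Real.hasDerivAt_exp a).const_add 1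
  have hp := Real.exp_pos a
  have h2 := h1.inv (by simp only [div_one]; positivity)
  refine h2.congr_deriv ?_
  simp only [fermi, div_one]
  field_simp
  ring

theorem antitone_fermi : Antitone (fermi 1) :=
  antitone_of_hasDerivAt_nonpos hasDerivAt_fermi fun a => by
    have := fermi_pos 1 a; have := fermi_lt_one 1 a
    rw [Pi.zero_apply]
    nlinarith

theorem fermi_mul_le (a : ℝ) : fermi 1 a * (1 - fermi 1 a) ≤ Real.exp (-|a|) := by
  have h0 := fermi_pos 1 a
  have h1 := fermi_lt_one 1 a
  rcases le_total 0 a with h | h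
  · rw [abs_of_nonneg h]
    nlinarith [fermi_le_exp a]
  · rw [abs_of_nonpos h, neg_neg]
    have := fermi_le_exp (-a)
    rw [fermi_neg, neg_neg] at this
    nlinarith

theorem le_fermi_mul (a : ℝ) : Real.exp (-|a|) / 4 ≤ fermi 1 a * (1 - fermi 1 a) := by
  have key : ∀ a : ℝ, 0 ≤ a → Real.exp (-a) / 4 ≤ fermi 1 a * (1 - fermi 1 a) := fun a h => by
    have he := Real.one_le_exp h
    have e : fermi 1 a * (1 - fermi 1 a) = Real.exp a / (1 + Real.exp a) ^ 2 := by
      have := Real.exp_pos a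
      simp only [fermi, div_one]; field_simp; ring
    rw [e, Real.exp_neg, div_eq_mul_inv, ← mul_inv, ← one_div, div_le_div_iff₀ (by positivity)
      (by positivity)]
    nlinarith
  rcases le_total 0 a with h | h
  · rw [abs_of_nonneg h]; exact key a h
  · have := key (-a) (by linarith)
    rw [fermi_neg] at this
    rw [abs_of_nonpos h]; linarith

theorem exp_neg_mul_abs_continuous (κ : ℝ) : Continuous fun c : ℝ => Real.exp (-(κ * |c|)) := by
  fun_prop

theorem exp_abs_compare {κ a c : ℝ} (hκ : 0 ≤ κ) (hac : |a - c| ≤ 1) :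
    Real.exp (-(κ * |a|)) ≤ Real.exp κ * Real.exp (-(κ * |c|)) := by
  rw [← Real.exp_add]
  apply Real.exp_le_exp.2
  have := abs_sub_abs_le_abs_sub c a
  rw [abs_sub_comm] at this
  nlinarith

theorem le_integral_of_length {κ a b x : ℝ} (hκ : 0 < κ) (hx : x ∈ Icc a b) (hl : b - a ≤ 1) :
    (b - a) * Real.exp (-(κ * |x|)) ≤ Real.exp κ * ∫ c in a..b, Real.exp (-(κ * |c|)) := by
  have hab : a ≤ b := hx.1.trans hx.2
  have hc := exp_neg_mul_abs_continuous κ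
  rw [← intervalIntegral.integral_const_mul, ← smul_eq_mul, ← intervalIntegral.integral_const]
  refine intervalIntegral.integral_mono_on hab (by simp)
    ((hc.const_mul _).intervalIntegrable _ _) fun c hc => ?_
  refine exp_abs_compare hκ.le (abs_le.2 ⟨?_, ?_⟩) <;> linarith [hc.1, hc.2, hx.1, hx.2]

theorem integral_mono_interval {κ a b a' b' : ℝ} (h1 : a ≤ a') (h2 : a' ≤ b') (h3 : b' ≤ b) :
    ∫ c in a'..b', Real.exp (-(κ * |c|)) ≤ ∫ c in a..b, Real.exp (-(κ * |c|)) := by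
  refine intervalIntegral.integral_mono_interval h1 h2 h3 (Eventually.of_forall fun c => ?_)
    ((exp_neg_mul_abs_continuous κ).intervalIntegrable _ _)
  exact (Real.exp_pos _).le

/-- The contribution of arguments of the Fermi function at a distance of at least `1`. -/
theorem fermi_sub_rpow_le {κ a b : ℝ} (hκ : 0 < κ) (hκ1 : κ < 1) (hab : 1 ≤ b - a) :
    |fermi 1 a - fermi 1 b| ^ κ ≤
      2 * Real.exp κ * ∫ c in a..b, Real.exp (-(κ * |c|)) := by
  have hnn : 0 ≤ fermi 1 a - fermi 1 b := sub_nonneg.2 (antitone_fermi (by linarith))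
  rw [abs_of_nonneg hnn]
  have fa1 := fermi_lt_one 1 a
  have fb0 := fermi_pos 1 b
  -- Here x is the point of [a,b] closest to 0. The difference of occupations is at most exp(-|x|),
  -- and the weight is comparable to its value at x on a subinterval [a',b'] around x of length
  -- between 1/2 and 1. When 0 lies inside [a,b], one of [0,1/2] and [-1/2,0] fits, because b - a ≥
  -- 1.
  have mono : ∀ x : ℝ, 0 ≤ x → x ∈ Icc a b →
      fermi 1 a - fermi 1 b ≤ Real.exp (-x) → ∀ a' b', a ≤ a' → b' ≤ b → x ∈ Icc a' b' →
      b' - a' ≤ 1 → 1 ≤ 2 * (b' - a') → (fermi 1 a - fermi 1 b) ^ κ ≤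
      2 * Real.exp κ * ∫ c in a..b, Real.exp (-(κ * |c|)) := by
    intro x hx _ hle a' b' ha hb hx' hl hl2
    have e1 := le_integral_of_length hκ hx' hl
    have e2 := integral_mono_interval (κ := κ) ha (hx'.1.trans hx'.2) hb
    have e3 : (fermi 1 a - fermi 1 b) ^ κ ≤ Real.exp (-(κ * |x|)) := by
      calc _ ≤ Real.exp (-x) ^ κ := Real.rpow_le_rpow hnn hle hκ.le
        _ = _ := by rw [← Real.exp_mul, abs_of_nonneg hx]; ring_nf
    have p := Real.exp_pos (-(κ * |x|))
    have e4 := mul_le_mul_of_nonneg_left e2 (Real.exp_pos κ).le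
    nlinarith
  rcases le_total 0 a with h | h
  · exact mono a h ⟨le_rfl, by linarith⟩ (by linarith [fermi_le_exp a]) a (a + 1) le_rfl
      (by linarith) ⟨le_rfl, by linarith⟩ (by linarith) (by linarith)
  rcases le_total b 0 with hb | hb
  · have hs : ∫ c in a..b, Real.exp (-(κ * |c|)) = ∫ c in -b..-a, Real.exp (-(κ * |c|)) := by
      rw [← intervalIntegral.integral_comp_neg]; simp
    have e1 := le_integral_of_length hκ (a := b - 1) (b := b) (x := b) ⟨by linarith, le_rfl⟩
      (by linarith)
    have e2 := integral_mono_interval (κ := κ) (a := a) (a' := b - 1) (b' := b) (b := b)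
      (by linarith) (by linarith) le_rfl
    have hle : fermi 1 a - fermi 1 b ≤ Real.exp b := by
      have := fermi_le_exp (-b); rw [fermi_neg, neg_neg] at this; linarith
    have e3 : (fermi 1 a - fermi 1 b) ^ κ ≤ Real.exp (-(κ * |b|)) := by
      calc _ ≤ Real.exp b ^ κ := Real.rpow_le_rpow hnn hle hκ.le
        _ = _ := by rw [← Real.exp_mul, abs_of_nonpos hb]; ring_nf
    have p := Real.exp_pos (-(κ * |b|))
    have e4 := mul_le_mul_of_nonneg_left e2 (Real.exp_pos κ).le
    nlinarith
  · have hle : fermi 1 a - fermi 1 b ≤ Real.exp (-0) := by simp; linarith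
    rcases le_total (-(1 / 2)) a with h2 | h2
    · exact mono 0 le_rfl ⟨h, hb⟩ hle 0 (1 / 2) h (by linarith) (by norm_num) (by norm_num)
        (by norm_num)
    · exact mono 0 le_rfl ⟨h, hb⟩ hle (-(1 / 2)) 0 h2 hb (by norm_num) (by norm_num)
        (by norm_num)

/-- The contribution of arguments of the Fermi function at a distance of at most `1`. -/
theorem abs_kernelU_fermi_le_of_close {α κ C : ℝ} (H : IsEntropyLike (renyi α) κ C) :
    ∃ A, 0 ≤ A ∧ ∀ a b : ℝ, a ≤ b → b - a ≤ 1 →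
      |kernelU α (fermi 1 a) (fermi 1 b)| ≤ A * (b - a) ^ 2 * Real.exp (-(κ * |a|)) := by
  have hκ := H.pos
  have hC := H.nonneg
  obtain ⟨h', h'', hd⟩ := H.deriv
  have hI := intervalIntegral.integral_nonneg (μ := volume) (f := fun l : ℝ => (l * (1 - l)) ^
    ((1 : ℝ) - 1)) zero_le_one fun l hl => Real.rpow_nonneg
      (mul_nonneg hl.1 (sub_nonneg.2 hl.2)) _
  refine ⟨C * 4 ^ (2 - κ) * Real.exp (2 - κ) * Real.exp 1 ^ 2 *
    ∫ l in (0 : ℝ)..1, (l * (1 - l)) ^ ((1 : ℝ) - 1), by positivity, fun a b hab hl => ?_⟩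
  -- A bound on the second derivative between the two occupations: it grows like exp((2-κ)|a|),
  -- whereas the squared difference of occupations decays like exp(-2|a|). The product leaves
  -- exp(-κ|a|).
  set M := C * (4 ^ (2 - κ) * (Real.exp (2 - κ) * Real.exp ((2 - κ) * |a|))) with hM
  have hsup : ∀ x ∈ Icc (fermi 1 b) (fermi 1 a), |h'' x| ≤ M := by
    intro x hx
    have hx' : x ∈ Ioo (0 : ℝ) 1 := ⟨(fermi_pos 1 b).trans_le hx.1,
      hx.2.trans_lt (fermi_lt_one 1 a)⟩
    obtain ⟨c, hc, rfl⟩ : ∃ c ∈ Icc a b, fermi 1 c = x := by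
      have hcont : ContinuousOn (fermi 1) (Icc a b) :=
        fun c _ => (hasDerivAt_fermi c).continuousAt.continuousWithinAt
      obtain ⟨c, hc, h⟩ := intermediate_value_Icc' hab hcont hx
      exact ⟨c, hc, h⟩
    refine (hd _ hx').2.2.2.trans ?_
    rw [hM]
    gcongr
    have e1 := le_fermi_mul c
    calc (fermi 1 c * (1 - fermi 1 c)) ^ (κ - 2) ≤ (Real.exp (-|c|) / 4) ^ (κ - 2) :=
          Real.rpow_le_rpow_of_nonpos (by positivity) e1 (by linarith [H.lt_one])
      _ = 4 ^ (2 - κ) * Real.exp ((2 - κ) * |c|) := by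
          rw [Real.div_rpow (Real.exp_pos _).le (by norm_num), ← Real.exp_mul,
            show κ - 2 = -(2 - κ) by ring, Real.rpow_neg (by norm_num), div_inv_eq_mul, mul_comm]
          congr 2; ring
      _ ≤ 4 ^ (2 - κ) * (Real.exp (2 - κ) * Real.exp ((2 - κ) * |a|)) := by
          rw [← Real.exp_add]
          gcongr
          have h1 := abs_sub_abs_le_abs_sub c a
          have h2 : |c - a| ≤ 1 := abs_le.2 ⟨by linarith [hc.1], by linarith [hc.2]⟩
          nlinarith [H.lt_one]
  have hdist : fermi 1 a - fermi 1 b ≤ (b - a) * (Real.exp 1 * Real.exp (-|a|)) := by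
    rcases hab.eq_or_lt with rfl | hlt
    · simp
    obtain ⟨c, hc, hceq⟩ := exists_hasDerivAt_eq_slope (fermi 1) _ hlt
      (fun c _ => (hasDerivAt_fermi c).continuousAt.continuousWithinAt)
      (fun c _ => hasDerivAt_fermi c)
    have hba : 0 < b - a := sub_pos.2 hlt
    rw [eq_div_iff hba.ne'] at hceq
    have e := exp_abs_compare (κ := 1) (a := c) (c := a) zero_le_one
      (abs_le.2 ⟨by linarith [hc.1], by linarith [hc.2]⟩)
    rw [one_mul, one_mul] at e
    have := (fermi_mul_le c).trans e
    nlinarith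
  have hnn : 0 ≤ fermi 1 a - fermi 1 b := sub_nonneg.2 (antitone_fermi hab)
  have hsq : (fermi 1 b - fermi 1 a) ^ 2 ≤
      (b - a) ^ 2 * (Real.exp 1 ^ 2 * Real.exp (-(2 * |a|))) := by
    have := pow_le_pow_left₀ hnn hdist 2
    calc _ = (fermi 1 a - fermi 1 b) ^ 2 := by ring
      _ ≤ _ := this
      _ = _ := by
        rw [mul_pow, mul_pow, ← Real.exp_nat_mul (-|a|)]; congr 3; push_cast; ring
  have hM0 : 0 ≤ M := by positivity
  rw [kernelU_comm]
  have := abs_integral_div_le (f := defect (renyi α) (fermi 1 b) (fermi 1 a))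
    (A := M * (fermi 1 b - fermi 1 a) ^ 2) one_pos fun l hl => by
      rw [Real.rpow_one]
      exact H.abs_defect_le_sq (fun x hx => ⟨(hd x hx).1, (hd x hx).2.1⟩) (fermi_pos 1 b)
        (antitone_fermi hab) (fermi_lt_one 1 a) ⟨hl.1.le, hl.2⟩ hsup
  calc |kernelU α (fermi 1 b) (fermi 1 a)| ≤ _ := this
    _ ≤ M * ((b - a) ^ 2 * (Real.exp 1 ^ 2 * Real.exp (-(2 * |a|)))) *
        ∫ l in (0 : ℝ)..1, (l * (1 - l)) ^ ((1 : ℝ) - 1) := by gcongr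
    _ = _ := by
      have e : Real.exp (-(κ * |a|)) = Real.exp ((2 - κ) * |a|) * Real.exp (-(2 * |a|)) := by
        rw [← Real.exp_add]; congr 1; ring
      rw [hM, e]; ring

/-- A quadratic bound for `U_α` along the Fermi function. -/
theorem abs_kernelU_fermi_le {α κ C : ℝ} (H : IsEntropyLike (renyi α) κ C) :
    ∃ A, 0 ≤ A ∧ ∀ a b : ℝ, |kernelU α (fermi 1 a) (fermi 1 b)| ≤
      A * |b - a| * |∫ c in a..b, Real.exp (-(κ * |c|))| := by
  have hκ := H.pos
  obtain ⟨A₁, hA₁, h1⟩ := abs_kernelU_fermi_le_of_close H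
  obtain ⟨A₂, hA₂, h2⟩ := abs_kernelU_le H
  refine ⟨A₁ * Real.exp κ + 2 * A₂ * Real.exp κ, by positivity, fun a b => ?_⟩
  wlog hab : a ≤ b generalizing a b
  · rw [kernelU_comm, abs_sub_comm, intervalIntegral.integral_symm, abs_neg]
    exact this b a (le_of_not_ge hab)
  have hI : 0 ≤ ∫ c in a..b, Real.exp (-(κ * |c|)) :=
    intervalIntegral.integral_nonneg hab fun c _ => (Real.exp_pos _).le
  rw [abs_of_nonneg (sub_nonneg.2 hab), abs_of_nonneg hI]
  have hba : 0 ≤ b - a := sub_nonneg.2 hab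
  have hE := Real.exp_pos κ
  set I := ∫ c in a..b, Real.exp (-(κ * |c|))
  -- The product of length and weighted length is of second order for close arguments, and for
  -- distant ones the length is at least 1 and costs nothing. The weighted factor is what becomes
  -- integrable in the momentum.
  rcases le_total (b - a) 1 with hl | hl
  · have e := le_integral_of_length hκ (left_mem_Icc.2 hab) hl
    calc _ ≤ A₁ * (b - a) ^ 2 * Real.exp (-(κ * |a|)) := h1 a b hab hl
      _ = A₁ * (b - a) * ((b - a) * Real.exp (-(κ * |a|))) := by ring
      _ ≤ A₁ * (b - a) * (Real.exp κ * I) := by gcongr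
      _ ≤ A₁ * (b - a) * (Real.exp κ * I) + 2 * A₂ * Real.exp κ * (b - a) * I :=
        le_add_of_nonneg_right (by positivity)
      _ = _ := by ring
  · calc _ ≤ A₂ * |fermi 1 a - fermi 1 b| ^ κ := h2 _ (fermi_mem 1 a) _ (fermi_mem 1 b)
      _ ≤ A₂ * (2 * Real.exp κ * I) := by
        gcongr; exact fermi_sub_rpow_le hκ H.lt_one hl
      _ ≤ A₂ * (2 * Real.exp κ * I) * (b - a) := le_mul_of_one_le_right (by positivity) hl
      _ ≤ A₂ * (2 * Real.exp κ * I) * (b - a) + A₁ * Real.exp κ * (b - a) * I :=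
        le_add_of_nonneg_right (by positivity)
      _ = _ := by ring

/-! ### The value `U_α(0,1)` -/

/-- The alternating series is ζ(2) minus twice its even part, and the even part is a quarter of
ζ(2). The term of index 0 has the value 0 and drops out in the shift of index. -/
theorem hasSum_alternating_inv_sq :
    HasSum (fun n : ℕ => (-1 : ℝ) ^ n / ((n : ℝ) + 1) ^ 2) (Real.pi ^ 2 / 12) := by
  have h0 := hasSum_zeta_two
  let b : ℕ → ℝ := fun n => if Even n then 2 * (1 / (n : ℝ) ^ 2) else 0
  have hb : HasSum b (Real.pi ^ 2 / 12) := by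
    have he : HasSum (fun k => b (2 * k)) (1 / 2 * (Real.pi ^ 2 / 6)) := by
      convert! h0.mul_left (1 / 2) using 2 with k
      simp only [b, even_two_mul, if_true]
      push_cast
      rw [mul_pow]
      ring
    have ho : HasSum (fun k => b (2 * k + 1)) 0 := by
      convert! hasSum_zero using 2 with k
      simp [b]
    convert! he.even_add_odd ho using 1
    ring
  have h1 : HasSum (fun n : ℕ => 1 / (n : ℝ) ^ 2 - b n) (Real.pi ^ 2 / 12) := by
    convert! h0.sub hb using 1
    ring
  have h2 := (hasSum_nat_add_iff' 1).2 h1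
  convert! h2 using 1
  · funext n
    simp only [b]
    rcases Nat.even_or_odd n with hn | hn
    · rw [hn.neg_one_pow, if_neg (Nat.not_even_iff_odd.2 hn.add_one)]
      push_cast; ring
    · rw [hn.neg_one_pow, if_pos hn.add_one]
      push_cast; ring
  · simp [b]

theorem log_one_add_exp_neg_hasSum {y : ℝ} (hy : 0 < y) :
    HasSum (fun n : ℕ => (-1 : ℝ) ^ n / ((n : ℝ) + 1) * Real.exp (-(((n : ℝ) + 1) * y)))
      (Real.log (1 + Real.exp (-y))) := by
  have h := Real.hasSum_pow_div_log_of_abs_lt_one (x := -Real.exp (-y)) (by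
    rw [abs_neg, abs_of_pos (Real.exp_pos _)]; exact Real.exp_lt_one_iff.2 (by linarith))
  rw [sub_neg_eq_add] at h
  convert! h.neg using 1
  · funext n
    rw [neg_pow (Real.exp (-y)), ← Real.exp_nat_mul, pow_succ]
    push_cast
    rw [show ((n : ℝ) + 1) * -y = -((n + 1) * y) by ring]
    ring
  · simp

/-- Termwise integration of the Mercator series. The integrals of the absolute values are 1/(n+1)²,
hence summable. -/
theorem integral_log_one_add_exp_neg :
    IntegrableOn (fun y : ℝ => Real.log (1 + Real.exp (-y))) (Ioi 0) ∧
      ∫ y in Ioi (0 : ℝ), Real.log (1 + Real.exp (-y)) = Real.pi ^ 2 / 12 := by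
  constructor
  · refine (integrableOn_exp_neg_Ioi 0).mono' (Measurable.aestronglyMeasurable (by fun_prop))
      (Eventually.of_forall fun y => ?_)
    have := Real.exp_pos (-y)
    rw [Real.norm_eq_abs, abs_of_nonneg (Real.log_nonneg (by linarith))]
    have := Real.log_le_sub_one_of_pos (show 0 < 1 + Real.exp (-y) by linarith)
    linarith
  have hint : ∀ n : ℕ, ∫ y in Ioi (0 : ℝ), Real.exp (-(((n : ℝ) + 1) * y)) = 1 / ((n : ℝ) + 1) := by
    intro n
    have := integral_exp_mul_Ioi (a := -((n : ℝ) + 1)) (by linarith [n.cast_nonneg (α := ℝ)]) 0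
    simp only [mul_zero, Real.exp_zero, neg_mul] at this
    rw [this, neg_div_neg_eq]
  have hion : ∀ n : ℕ, IntegrableOn (fun y : ℝ => Real.exp (-(((n : ℝ) + 1) * y))) (Ioi 0) := by
    intro n
    have := integrableOn_exp_mul_Ioi (a := -((n : ℝ) + 1)) (by linarith [n.cast_nonneg (α := ℝ)]) 0
    simpa only [neg_mul] using this
  have h := hasSum_integral_of_summable_integral_norm (μ := volume.restrict (Ioi (0 : ℝ)))
    (F := fun (n : ℕ) (y : ℝ) =>
      (-1 : ℝ) ^ n / ((n : ℝ) + 1) * Real.exp (-(((n : ℝ) + 1) * y)))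
    (fun n => (hion n).const_mul _) ?_
  · have e : ∀ y ∈ Ioi (0 : ℝ), (∑' n : ℕ, (-1 : ℝ) ^ n / ((n : ℝ) + 1) *
        Real.exp (-(((n : ℝ) + 1) * y))) = Real.log (1 + Real.exp (-y)) := fun y hy =>
      (log_one_add_exp_neg_hasSum hy).tsum_eq
    rw [setIntegral_congr_fun measurableSet_Ioi e] at h
    refine h.unique ?_
    convert! hasSum_alternating_inv_sq using 2 with n
    rw [integral_const_mul, hint, div_mul_div_comm, mul_one, sq]
  · have : ∀ n : ℕ, ∫ y in Ioi (0 : ℝ), ‖(-1 : ℝ) ^ n / ((n : ℝ) + 1) *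
        Real.exp (-(((n : ℝ) + 1) * y))‖ = 1 / ((n : ℝ) + 1) ^ 2 := fun n => by
      have hn : (0 : ℝ) < (n : ℝ) + 1 := by positivity
      simp only [norm_mul, norm_div, norm_pow, norm_neg, norm_one, one_pow, Real.norm_eq_abs,
        Real.abs_exp, abs_of_pos hn]
      rw [integral_const_mul, hint]
      field_simp
    simp only [this]
    have := (summable_nat_add_iff 1).2 hasSum_zeta_two.summable
    simpa using this

theorem image_fermi : fermi 1 '' univ = Ioo 0 1 := by
  ext x
  constructor
  · rintro ⟨a, -, rfl⟩; exact ⟨fermi_pos 1 a, fermi_lt_one 1 a⟩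
  · intro hx
    refine ⟨Real.log ((1 - x) / x), mem_univ _, ?_⟩
    have := hx.1
    have := sub_pos.2 hx.2
    simp only [fermi, div_one]
    rw [Real.exp_log (by positivity)]
    field_simp
    ring

theorem injective_fermi : Function.Injective (fermi 1) := by
  intro a b h
  simp only [fermi, div_one, inv_inj, add_right_inj] at h
  exact Real.exp_injective h

/-- The linear interpolation vanishes, since h(0) = h(1) = 0. Under l = f(y) the measure dl/(l(1-l))
becomes |dy|, because |f'| = f(1-f). The symmetry of h makes the integrand even. -/
theorem kernelU_zero_one_eq {α κ C : ℝ} (H : IsEntropyLike (renyi α) κ C) :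
    kernelU α 0 1 = 2 * ∫ y in Ioi (0 : ℝ), renyi α (fermi 1 y) := by
  have e1 : kernelU α 0 1 = ∫ l in Ioo (0 : ℝ) 1, renyi α l / (l * (1 - l)) := by
    rw [kernelU, intervalIntegral.integral_of_le zero_le_one, integral_Ioc_eq_integral_Ioo]
    simp [H.zero, H.one]
  rw [e1, ← image_fermi, integral_image_eq_integral_abs_deriv_smul MeasurableSet.univ
    (fun a _ => (hasDerivAt_fermi a).hasDerivWithinAt) injective_fermi.injOn, setIntegral_univ,
    ← integral_comp_abs]
  congr 1
  funext a
  have h0 := fermi_pos 1 a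
  have h1 := sub_pos.2 (fermi_lt_one 1 a)
  rw [abs_neg, abs_of_pos (mul_pos h0 h1), smul_eq_mul, mul_div_cancel₀ _ (mul_pos h0 h1).ne']
  rcases le_total 0 a with h | h
  · rw [abs_of_nonneg h]
  · rw [abs_of_nonpos h, fermi_neg, H.symm]

theorem one_sub_fermi_eq (y : ℝ) : 1 - fermi 1 y = (1 + Real.exp (-y))⁻¹ := by
  rw [← fermi_neg]; simp [fermi]

theorem fermi_eq_exp_mul (y : ℝ) : fermi 1 y = Real.exp (-y) * (1 + Real.exp (-y))⁻¹ := by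
  have := Real.exp_pos y
  simp only [fermi, Real.exp_neg, div_one]; field_simp
  ring

/-- At t = f(y) the sum t^α + (1-t)^α equals (1 + e^(-αy))/(1 + e^(-y))^α. The two logarithms are
the same integral up to scaling, and (1/α - α)/(1 - α) = (1 + α)/α. -/
theorem kernelU_zero_one_of_ne {α : ℝ} (hα : 0 < α) (h1 : α ≠ 1) :
    kernelU α 0 1 = Real.pi ^ 2 * (1 + α) / (6 * α) := by
  obtain ⟨κ, C, H⟩ := isEntropyLike_renyi_of_ne hα h1
  obtain ⟨hi, hv⟩ := integral_log_one_add_exp_neg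
  have e : ∀ y : ℝ, renyi α (fermi 1 y) = (1 - α)⁻¹ *
      (Real.log (1 + Real.exp (-(α * y))) - α * Real.log (1 + Real.exp (-y))) := fun y => by
    have p := Real.exp_pos (-y)
    have p2 := Real.exp_pos (-(α * y))
    have p3 : 0 < 1 + Real.exp (-y) := by positivity
    simp only [renyi, h1, if_false]
    congr 1
    rw [one_sub_fermi_eq, fermi_eq_exp_mul, Real.mul_rpow p.le (inv_pos.2 p3).le, ← Real.exp_mul,
      Real.inv_rpow p3.le, ← add_one_mul, Real.log_mul (by positivity) (by positivity),
      Real.log_inv, Real.log_rpow p3]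
    ring_nf
  have hi2 : IntegrableOn (fun y : ℝ => Real.log (1 + Real.exp (-(α * y)))) (Ioi 0) := by
    have := (integrableOn_Ioi_comp_mul_left_iff (fun y : ℝ => Real.log (1 + Real.exp (-y))) 0 hα).2
      (by simpa using hi)
    exact this
  have hv2 : ∫ y in Ioi (0 : ℝ), Real.log (1 + Real.exp (-(α * y))) =
      α⁻¹ * (Real.pi ^ 2 / 12) := by
    have := integral_comp_mul_left_Ioi (fun y : ℝ => Real.log (1 + Real.exp (-y))) 0 hα
    rw [mul_zero, hv, smul_eq_mul] at this
    exact this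
  rw [kernelU_zero_one_eq H]
  simp only [e]
  rw [integral_const_mul, integral_sub hi2 (hi.const_mul α), integral_const_mul, hv, hv2]
  have : 1 - α ≠ 0 := sub_ne_zero.2 (Ne.symm h1)
  field_simp
  ring

/-- At t = f(y) the entropy is log(1 + e^(-y)) + y f(y). The two summands have equal integrals:
their difference is the derivative of y log(1 + e^(-y)), which vanishes at 0 and at infinity. -/
theorem kernelU_one_zero_one : kernelU 1 0 1 = Real.pi ^ 2 * (1 + 1) / (6 * 1) := by
  obtain ⟨hi, hv⟩ := integral_log_one_add_exp_neg
  have e : ∀ y : ℝ, renyi 1 (fermi 1 y) =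
      Real.log (1 + Real.exp (-y)) + y * fermi 1 y := fun y => by
    have p := Real.exp_pos (-y)
    have p3 : 0 < 1 + Real.exp (-y) := by positivity
    have f1 : 1 - fermi 1 y = (1 + Real.exp (-y))⁻¹ := one_sub_fermi_eq y
    have l1 : Real.log (1 - fermi 1 y) = -Real.log (1 + Real.exp (-y)) := by
      rw [f1, Real.log_inv]
    have l2 : Real.log (fermi 1 y) = -y - Real.log (1 + Real.exp (-y)) := by
      rw [fermi_eq_exp_mul, Real.log_mul (by positivity) (by positivity), Real.log_exp,
        Real.log_inv]; ring
    simp only [renyi, if_true]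
    rw [l1, l2]
    ring
  have hi2 : IntegrableOn (fun y : ℝ => y * fermi 1 y) (Ioi 0) := by
    have hG := Real.GammaIntegral_convergent (s := 2) (by norm_num)
    refine hG.mono' ?_ ?_
    · exact (by unfold fermi; fun_prop : Measurable fun y : ℝ => y * fermi 1 y).aestronglyMeasurable
    · filter_upwards [ae_restrict_mem measurableSet_Ioi] with y hy
      have hy : 0 < y := hy
      rw [Real.norm_eq_abs, abs_of_pos (mul_pos hy (fermi_pos 1 y)), mul_comm,
        show (2 : ℝ) - 1 = 1 by norm_num, Real.rpow_one]
      exact mul_le_mul_of_nonneg_right (fermi_le_exp y) hy.le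
  have hv2 : ∫ y in Ioi (0 : ℝ), (Real.log (1 + Real.exp (-y)) - y * fermi 1 y) = 0 := by
    have hd : ∀ y ∈ Ici (0 : ℝ), HasDerivAt (fun y : ℝ => y * Real.log (1 + Real.exp (-y)))
        (Real.log (1 + Real.exp (-y)) - y * fermi 1 y) y := fun y _ => by
      have p := Real.exp_pos (-y)
      have h1 : HasDerivAt (fun y : ℝ => 1 + Real.exp (-y)) (-Real.exp (-y)) y := by
        simpa using ((hasDerivAt_neg y).exp).const_add 1
      refine ((hasDerivAt_id y).mul (h1.log (by positivity))).congr_deriv ?_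
      rw [fermi_eq_exp_mul]
      simp only [id]
      ring
    have ht : Tendsto (fun y : ℝ => y * Real.log (1 + Real.exp (-y))) atTop (𝓝 0) := by
      have hlim := Real.tendsto_pow_mul_exp_neg_atTop_nhds_zero 1
      simp only [pow_one] at hlim
      refine squeeze_zero' ?_ ?_ hlim
      · filter_upwards [eventually_ge_atTop 0] with y hy
        exact mul_nonneg hy (Real.log_nonneg (by linarith [Real.exp_pos (-y)]))
      · filter_upwards [eventually_ge_atTop 0] with y hy
        have := Real.log_le_sub_one_of_pos (show 0 < 1 + Real.exp (-y) by positivity)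
        exact mul_le_mul_of_nonneg_left (by linarith) hy
    rw [integral_Ioi_of_hasDerivAt_of_tendsto' hd (hi.sub hi2) ht]
    simp
  rw [integral_sub hi hi2] at hv2
  rw [kernelU_zero_one_eq isEntropyLike_renyi_one]
  simp only [e]
  rw [integral_add hi hi2, hv]
  linarith

/-- The value `U_α(0,1) = π² (1 + α) / (6 α)`. -/
theorem kernelU_zero_one {α : ℝ} (hα : 0 < α) :
    kernelU α 0 1 = Real.pi ^ 2 * (1 + α) / (6 * α) := by
  by_cases h : α = 1
  · subst h; exact kernelU_one_zero_one
  · exact kernelU_zero_one_of_ne hα h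

/-! ### Orthogonal coordinates and Hausdorff measures -/

section Orthogonal

variable {E : Type*} [NormedAddCommGroup E] [InnerProductSpace ℝ E] [FiniteDimensional ℝ E]
  [MeasurableSpace E] [BorelSpace E]

/-- The coordinates `(p, v) ↦ p + v n` along the hyperplane `n^⊥` and the line `ℝ n`. -/
noncomputable def orthCoord (n : E) (hn : ‖n‖ = 1) : (ℝ ∙ n)ᗮ × ℝ ≃ᵐ E :=
  (MeasurableEquiv.prodComm.trans (MeasurableEquiv.prodCongr
    (LinearIsometryEquiv.toSpanUnitSingleton n hn).toHomeomorph.toMeasurableEquiv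
    (MeasurableEquiv.refl _))).trans ((ℝ ∙ n).measurableEquivProd (0 : E)).symm

theorem orthCoord_apply (n : E) (hn : ‖n‖ = 1) (y : (ℝ ∙ n)ᗮ × ℝ) :
    orthCoord n hn y = (y.1 : E) + y.2 • n := by
  rw [orthCoord]
  simp only [MeasurableEquiv.trans_apply, Submodule.measurableEquivProd_symm_apply, vadd_eq_add,
    add_zero]
  rw [add_comm]
  rfl

theorem measurePreserving_orthCoord (n : E) (hn : ‖n‖ = 1) :
    MeasurePreserving (orthCoord n hn) volume volume := by
  have h1 := ((ℝ ∙ n).measurePreserving_measurableEquivProd (0 : E)).symm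
  rw [InnerProductSpace.euclideanHausdorffMeasure_eq_volume] at h1
  refine MeasurePreserving.trans ?_ h1
  refine MeasurePreserving.trans (μb := (volume : Measure ℝ).prod (volume : Measure (ℝ ∙ n)ᗮ)) ?_ ?_
  · exact Measure.measurePreserving_swap
  · exact (LinearIsometryEquiv.toSpanUnitSingleton n hn).measurePreserving.prod
      (MeasurePreserving.id _)

omit [FiniteDimensional ℝ E] [MeasurableSpace E] [BorelSpace E] in
theorem finrank_orthogonal_unit {k : ℕ} (hk : Module.finrank ℝ E = k + 1) {n : E} (hn : ‖n‖ = 1) :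
    Module.finrank ℝ (ℝ ∙ n)ᗮ = k := by
  have : Fact (Module.finrank ℝ E = k + 1) := ⟨hk⟩
  exact Submodule.finrank_orthogonal_span_singleton (fun h => by simp [h] at hn)

omit [FiniteDimensional ℝ E] [MeasurableSpace E] [BorelSpace E] in
theorem orthogonalProjectionOnto_add_inner_smul {e : E} (he : ‖e‖ = 1) (x : E) :
    ((ℝ ∙ e)ᗮ.orthogonalProjectionOnto x : E) + ⟪e, x⟫_ℝ • e = x := by
  have h := Submodule.starProjection_orthogonal_val (K := ℝ ∙ e) x
  rw [Submodule.starProjection_unit_singleton ℝ he] at h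
  change (ℝ ∙ e)ᗮ.starProjection x + _ = _
  rw [h, sub_add_cancel]

end Orthogonal

theorem euclideanHausdorffMeasure_image_le {X Y : Type*} [EMetricSpace X] [EMetricSpace Y]
    [MeasurableSpace X] [BorelSpace X] [MeasurableSpace Y] [BorelSpace Y] {f : X → Y} {s : Set X}
    {K : NNReal} (h : LipschitzOnWith K f s) (k : ℕ) :
    μHE[k] (f '' s) ≤ (K : ENNReal) ^ k * μHE[k] s := by
  rw [Measure.euclideanHausdorffMeasure_def, Measure.euclideanHausdorffMeasure_def,
    Measure.smul_apply, Measure.smul_apply, ENNReal.smul_def, ENNReal.smul_def, smul_eq_mul,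
    smul_eq_mul, ← mul_assoc, mul_comm ((K : ENNReal) ^ k), mul_assoc]
  gcongr
  have := h.hausdorffMeasure_image_le (d := (k : ℝ)) k.cast_nonneg
  rwa [ENNReal.rpow_natCast] at this

/-! ### The boundary of a bounded Lipschitz domain has finite area -/

theorem frontier_inter_subset_graph {d : ℕ} {Ω : Set (EuclideanSpace ℝ (Fin d))}
    {z e : EuclideanSpace ℝ (Fin d)} {Φ : (ℝ ∙ e)ᗮ → ℝ} {r : ℝ} (hΦ : Continuous Φ)
    (h : ∀ x ∈ Metric.ball z r, x ∈ Ω ↔ Φ ((ℝ ∙ e)ᗮ.orthogonalProjectionOnto x) < ⟪e, x⟫_ℝ)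
    {x : EuclideanSpace ℝ (Fin d)} (hx : x ∈ frontier Ω) (hxz : x ∈ Metric.ball z r)
    (hΩ : IsOpen Ω) : Φ ((ℝ ∙ e)ᗮ.orthogonalProjectionOnto x) = ⟪e, x⟫_ℝ := by
  rw [hΩ.frontier_eq] at hx
  have hc1 : Continuous fun x => Φ ((ℝ ∙ e)ᗮ.orthogonalProjectionOnto x) := by fun_prop
  have hc2 : Continuous fun x : EuclideanSpace ℝ (Fin d) => ⟪e, x⟫_ℝ := by fun_prop
  refine le_antisymm ?_ (not_lt.1 fun hlt => hx.2 ((h x hxz).2 hlt))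
  by_contra hlt
  have hnhds : ∀ᶠ y in 𝓝 x, ⟪e, y⟫_ℝ < Φ ((ℝ ∙ e)ᗮ.orthogonalProjectionOnto y) ∧
      y ∈ Metric.ball z r :=
    (hc2.continuousAt.eventually_lt hc1.continuousAt (not_le.1 hlt)).and
      (Metric.isOpen_ball.mem_nhds hxz)
  obtain ⟨y, hy, hyΩ⟩ := mem_closure_iff_nhds.1 hx.1 _ hnhds
  exact absurd ((h y hy.2).1 hyΩ) (not_lt.2 hy.1.le)

/-- Near each boundary point ∂Ω lies in the image of a ball of a hyperplane under the Lipschitz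
graph map; compactness of ∂Ω does the rest. -/
theorem areaMeasure_frontier_lt_top {d : ℕ} (hd : 1 ≤ d) {Ω : Set (EuclideanSpace ℝ (Fin d))}
    (hΩ : IsLipschitzDomain Ω) (hb : Bornology.IsBounded Ω) : μHE[d - 1] (frontier Ω) < ⊤ := by
  have hK : IsCompact (frontier Ω) :=
    Metric.isCompact_of_isClosed_isBounded isClosed_frontier
      (hb.closure.subset frontier_subset_closure)
  refine hK.measure_lt_top_of_nhdsWithin fun z hz => ?_
  obtain ⟨e, K, Φ, r, he, hΦ, hr, h⟩ := hΩ.2 z hz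
  refine ⟨frontier Ω ∩ Metric.ball z r, ?_, ?_⟩
  · exact inter_mem_nhdsWithin _ (Metric.ball_mem_nhds z hr)
  have hfr : Module.finrank ℝ (ℝ ∙ e)ᗮ = d - 1 :=
    finrank_orthogonal_unit (by simp; omega) he
  have hG : LipschitzWith (1 + K) fun y : (ℝ ∙ e)ᗮ =>
      (y : EuclideanSpace ℝ (Fin d)) + Φ y • e := by
    refine LipschitzWith.add ?_ ?_
    · exact LipschitzWith.subtype_val _
    · refine LipschitzWith.of_dist_le_mul fun x y => ?_
      rw [dist_eq_norm, ← sub_smul, norm_smul, he, mul_one, ← dist_eq_norm]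
      exact hΦ.dist_le_mul x y
  let P := (ℝ ∙ e)ᗮ.orthogonalProjectionOnto
  have hsub : frontier Ω ∩ Metric.ball z r ⊆
      (fun y : (ℝ ∙ e)ᗮ => (y : EuclideanSpace ℝ (Fin d)) + Φ y • e) '' Metric.ball (P z) r := by
    rintro x ⟨hx, hxz⟩
    refine ⟨P x, ?_, ?_⟩
    · rw [Metric.mem_ball] at hxz ⊢
      refine lt_of_le_of_lt ?_ hxz
      rw [dist_eq_norm, dist_eq_norm, ← map_sub]
      exact Submodule.norm_orthogonalProjectionOnto_apply_le _ _
    · beta_reduce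
      rw [frontier_inter_subset_graph hΦ.continuous h hx hxz hΩ.1]
      exact orthogonalProjectionOnto_add_inner_smul he x
  refine (measure_mono hsub).trans_lt ((euclideanHausdorffMeasure_image_le
    hG.lipschitzOnWith (d - 1)).trans_lt ?_)
  rw [← hfr, InnerProductSpace.euclideanHausdorffMeasure_eq_volume]
  exact ENNReal.mul_lt_top (ENNReal.pow_lt_top ENNReal.coe_lt_top)
    Metric.isBounded_ball.measure_lt_top

/-! ### Exterior normals -/

theorem IsExteriorUnitNormal.exteriorNormal_eq {d : ℕ} {S : Set (EuclideanSpace ℝ (Fin d))}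
    {q n : EuclideanSpace ℝ (Fin d)} (h : IsExteriorUnitNormal S q n) : exteriorNormal S q = n := by
  have hex : ∃ n, IsExteriorUnitNormal S q n := ⟨n, h⟩
  rw [exteriorNormal, dif_pos hex]
  exact hex.choose_spec.unique h

theorem exteriorNormal_eq_zero_or {d : ℕ} (S : Set (EuclideanSpace ℝ (Fin d)))
    (q : EuclideanSpace ℝ (Fin d)) : exteriorNormal S q = 0 ∨ ‖exteriorNormal S q‖ = 1 := by
  by_cases h : ∃ n, IsExteriorUnitNormal S q n
  · right
    obtain ⟨n, hn⟩ := h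
    rw [hn.exteriorNormal_eq]; exact hn.1
  · left; rw [exteriorNormal, dif_neg h]

theorem norm_exteriorNormal_le {d : ℕ} (S : Set (EuclideanSpace ℝ (Fin d)))
    (q : EuclideanSpace ℝ (Fin d)) : ‖exteriorNormal S q‖ ≤ 1 := by
  rcases exteriorNormal_eq_zero_or S q with h | h
  · simp [h]
  · exact h.le

/-- The exterior unit normal is characterized by countably many closed conditions. -/
theorem isExteriorUnitNormal_iff {d : ℕ} {S : Set (EuclideanSpace ℝ (Fin d))}
    {q n : EuclideanSpace ℝ (Fin d)} : IsExteriorUnitNormal S q n ↔ ‖n‖ = 1 ∧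
      ∀ k : ℕ, ∃ m : ℕ, ∀ x, ‖x - q‖ < 1 / ((m : ℝ) + 1) →
        (1 / ((k : ℝ) + 1) * ‖x - q‖ < ⟪x - q, n⟫_ℝ → x ∉ S) ∧
        (⟪x - q, n⟫_ℝ < -(1 / ((k : ℝ) + 1) * ‖x - q‖) → x ∈ S) := by
  refine and_congr_right fun _ => ⟨fun h k => ?_, fun h c hc => ?_⟩
  · have h1 := h (1 / ((k : ℝ) + 1)) (by positivity)
    rw [eventually_nhdsWithin_iff, Metric.eventually_nhds_iff] at h1
    obtain ⟨δ, hδ, h1⟩ := h1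
    obtain ⟨m, hm⟩ := exists_nat_one_div_lt hδ
    refine ⟨m, fun x hx => ?_⟩
    by_cases hxq : x = q
    · subst hxq; simp
    · have := h1 (y := x) (by rw [dist_eq_norm]; exact hx.trans hm) hxq
      exact ⟨fun h => this.1 h.le, fun h => this.2 h.le⟩
  · obtain ⟨k, hk⟩ := exists_nat_one_div_lt hc
    obtain ⟨m, hm⟩ := h k
    rw [eventually_nhdsWithin_iff, Metric.eventually_nhds_iff]
    refine ⟨1 / ((m : ℝ) + 1), by positivity, fun x hx hxq => ?_⟩
    rw [dist_eq_norm] at hx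
    have hpos : 0 < ‖x - q‖ := norm_pos_iff.2 (sub_ne_zero.2 hxq)
    have := mul_lt_mul_of_pos_right hk hpos
    exact ⟨fun h => (hm x hx).1 (by linarith), fun h => (hm x hx).2 (by linarith)⟩

/-- Nothing is assumed about S. Because the inequalities in `isExteriorUnitNormal_iff` are strict,
each condition attached to a fixed x is closed in (q,n), so the uncountable intersection over x is
still closed; only k and m give countable operations. -/
theorem measurableSet_isExteriorUnitNormal {d : ℕ} (S : Set (EuclideanSpace ℝ (Fin d))) :
    MeasurableSet {y : EuclideanSpace ℝ (Fin d) × EuclideanSpace ℝ (Fin d) |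
      IsExteriorUnitNormal S y.1 y.2} := by
  let F : ℕ → ℕ → EuclideanSpace ℝ (Fin d) →
      Set (EuclideanSpace ℝ (Fin d) × EuclideanSpace ℝ (Fin d)) := fun k m x =>
    {y | ‖x - y.1‖ < 1 / ((m : ℝ) + 1) →
      (1 / ((k : ℝ) + 1) * ‖x - y.1‖ < ⟪x - y.1, y.2⟫_ℝ → x ∉ S) ∧
      (⟪x - y.1, y.2⟫_ℝ < -(1 / ((k : ℝ) + 1) * ‖x - y.1‖) → x ∈ S)}
  have hF : ∀ k m x, IsClosed (F k m x) := by
    intro k m x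
    rw [← isOpen_compl_iff]
    have e : (F k m x)ᶜ = {y | ‖x - y.1‖ < 1 / ((m : ℝ) + 1)} ∩
        (({y | 1 / ((k : ℝ) + 1) * ‖x - y.1‖ < ⟪x - y.1, y.2⟫_ℝ} ∩ {_y | x ∈ S}) ∪
        ({y | ⟪x - y.1, y.2⟫_ℝ < -(1 / ((k : ℝ) + 1) * ‖x - y.1‖)} ∩ {_y | x ∉ S})) := by
      ext y
      simp only [F, mem_compl_iff, mem_ofPred_eq, mem_inter_iff, mem_union]
      tauto
    rw [e]
    exact (isOpen_lt (by fun_prop) (by fun_prop)).inter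
      (((isOpen_lt (by fun_prop) (by fun_prop)).inter isOpen_const).union
      ((isOpen_lt (by fun_prop) (by fun_prop)).inter isOpen_const))
  have e : {y : EuclideanSpace ℝ (Fin d) × EuclideanSpace ℝ (Fin d) |
      IsExteriorUnitNormal S y.1 y.2} = {y | ‖y.2‖ = 1} ∩ ⋂ k, ⋃ m, ⋂ x, F k m x := by
    ext y
    simp only [F, mem_ofPred_eq, isExteriorUnitNormal_iff, mem_inter_iff, mem_iInter, mem_iUnion]
  rw [e]
  exact (isClosed_eq (by fun_prop) continuous_const).measurableSet.inter
    (MeasurableSet.iInter fun k => MeasurableSet.iUnion fun m =>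
      (isClosed_iInter fun x => hF k m x).measurableSet)

/-- The graph of the normal is Borel, and the projection to q is injective on it by uniqueness. By
the Lusin–Souslin theorem the projections of its Borel subsets are Borel. -/
theorem measurable_exteriorNormal {d : ℕ} (S : Set (EuclideanSpace ℝ (Fin d))) :
    Measurable (exteriorNormal S) := by
  set G := {y : EuclideanSpace ℝ (Fin d) × EuclideanSpace ℝ (Fin d) |
      IsExteriorUnitNormal S y.1 y.2} with hG
  have hGm : MeasurableSet G := measurableSet_isExteriorUnitNormal S
  have hinj : InjOn (Prod.fst : EuclideanSpace ℝ (Fin d) × EuclideanSpace ℝ (Fin d) → _) G := by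
    rintro ⟨q, n⟩ h ⟨q', n'⟩ h' heq
    simp only at heq
    subst heq
    exact Prod.ext rfl (IsExteriorUnitNormal.unique h h')
  have himg : ∀ B : Set (EuclideanSpace ℝ (Fin d)), MeasurableSet B →
      MeasurableSet (Prod.fst '' (G ∩ Prod.snd ⁻¹' B)) := fun B hB =>
    (hGm.inter (measurable_snd hB)).image_of_measurable_injOn measurable_fst
      (hinj.mono inter_subset_left)
  intro B hB
  -- Points without a normal have the default value 0. If 0 ∈ B they belong to the preimage, and the
  -- complement is the set that is a projection of part of the graph.
  by_cases h0 : (0 : EuclideanSpace ℝ (Fin d)) ∈ B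
  · have e : exteriorNormal S ⁻¹' B = (Prod.fst '' (G ∩ Prod.snd ⁻¹' Bᶜ))ᶜ := by
      ext q
      simp only [mem_preimage, mem_compl_iff, mem_image, mem_inter_iff, Prod.exists,
        exists_and_right, exists_eq_right, not_exists, not_and, not_not]
      constructor
      · intro h n hn
        have e : exteriorNormal S q = n := IsExteriorUnitNormal.exteriorNormal_eq hn
        rw [← e]; exact h
      · intro h
        by_cases hex : ∃ n, IsExteriorUnitNormal S q n
        · obtain ⟨n, hn⟩ := hex
          rw [hn.exteriorNormal_eq]; exact h n hn
        · rw [exteriorNormal, dif_neg hex]; exact h0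
    rw [e]
    exact (himg _ hB.compl).compl
  · have e : exteriorNormal S ⁻¹' B = Prod.fst '' (G ∩ Prod.snd ⁻¹' B) := by
      ext q
      simp only [mem_preimage, mem_image, mem_inter_iff, Prod.exists,
        exists_and_right, exists_eq_right]
      constructor
      · intro h
        by_cases hex : ∃ n, IsExteriorUnitNormal S q n
        · obtain ⟨n, hn⟩ := hex
          rw [hn.exteriorNormal_eq] at h; exact ⟨n, hn, h⟩
        · rw [exteriorNormal, dif_neg hex] at h; exact absurd h h0
      · rintro ⟨n, hn, h⟩
        have e : exteriorNormal S q = n := IsExteriorUnitNormal.exteriorNormal_eq hn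
        rw [e]; exact h
    rw [e]
    exact himg _ hB

/-- At a regular point the exterior normal of a sublevel set is the normalized gradient. -/
theorem isExteriorUnitNormal_fermiSea {d : ℕ} {ε : EuclideanSpace ℝ (Fin d) → ℝ} {μ : ℝ}
    {p : EuclideanSpace ℝ (Fin d)} (hp : ε p = μ) (hε : DifferentiableAt ℝ ε p)
    (hne : gradient ε p ≠ 0) :
    IsExteriorUnitNormal (fermiSea ε μ) p (‖gradient ε p‖⁻¹ • gradient ε p) := by
  set g := gradient ε p with hg
  have hgp : 0 < ‖g‖ := norm_pos_iff.2 hne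
  refine ⟨by rw [norm_smul, norm_inv, norm_norm, inv_mul_cancel₀ hgp.ne'], fun c hc => ?_⟩
  have hd := (hε.hasGradientAt.hasFDerivAt.isLittleO).def
    (show 0 < c * ‖g‖ / 2 by positivity)
  filter_upwards [hd.filter_mono nhdsWithin_le_nhds, self_mem_nhdsWithin] with x hx hxp
  have hpos : 0 < ‖x - p‖ := norm_pos_iff.2 (sub_ne_zero.2 hxp)
  rw [InnerProductSpace.toDual_apply_apply, Real.norm_eq_abs, abs_le, hp, ← hg] at hx
  rw [inner_smul_right, real_inner_comm]
  have key : 0 < c * ‖g‖ * ‖x - p‖ := by positivity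
  constructor
  · intro h hx'
    have hx' : ε x ≤ μ := hx'
    have := mul_le_mul_of_nonneg_left h hgp.le
    rw [mul_inv_cancel_left₀ hgp.ne'] at this
    nlinarith [hx.1]
  · intro h
    have := mul_le_mul_of_nonneg_left h hgp.le
    rw [mul_inv_cancel_left₀ hgp.ne'] at this
    change ε x ≤ μ
    nlinarith [hx.2]

/-! ### Charts that flatten a regular level set -/

section Chart

variable {E : Type*} [NormedAddCommGroup E] [InnerProductSpace ℝ E] [FiniteDimensional ℝ E]
  [MeasurableSpace E] [BorelSpace E]

/-- A chart `Ψ` near a point `p₀` of the level set `{ε = μ}`, with inverse `Θ`, that is close to a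
translation and maps the level set into the hyperplane orthogonal to the unit vector `m`. -/
structure LevelChart (ε : E → ℝ) (μ : ℝ) (p₀ m : E) (G δ : ℝ) (Ψ Θ : E → E) (ρ r : ℝ) :
    Prop where
  rho_pos : 0 < ρ
  r_pos : 0 < r
  G_pos : 0 < G
  norm_m : ‖m‖ = 1
  continuous : Continuous Ψ
  measurable_inv : Measurable Θ
  right_inv : ∀ z ∈ Metric.ball (0 : E) r, Ψ (Θ z) = z
  maps : ∀ x ∈ Metric.ball p₀ ρ, Ψ x ∈ Metric.ball (0 : E) (r / 2)
  left_inv : ∀ x ∈ Metric.ball p₀ ρ, Θ (Ψ x) = x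
  level : ∀ x, G * ⟪m, Ψ x⟫_ℝ = ε x - μ
  lip_inv : ∀ z ∈ Metric.ball (0 : E) r, ∀ z' ∈ Metric.ball (0 : E) r,
    dist (Θ z) (Θ z') ≤ (1 + δ) * dist z z'
  lip : ∀ z ∈ Metric.ball (0 : E) r, ∀ z' ∈ Metric.ball (0 : E) r,
    dist z z' ≤ (1 + δ) * dist (Θ z) (Θ z')
  approx : ∀ x ∈ Metric.ball p₀ (2 * ρ), ∀ x' ∈ Metric.ball p₀ (2 * ρ),
    ‖Ψ x - Ψ x' - (x - x')‖ ≤ δ * ‖x - x'‖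
  normal : ∀ x ∈ Metric.ball p₀ ρ, ‖‖gradient ε x‖⁻¹ • gradient ε x - m‖ ≤ δ

omit [FiniteDimensional ℝ E] [MeasurableSpace E] [BorelSpace E] in
theorem continuous_gradient [CompleteSpace E] {ε : E → ℝ} (hε : ContDiff ℝ ∞ ε) :
    Continuous (gradient ε) := by
  have h := hε.continuous_fderiv (by simp)
  exact (InnerProductSpace.toDual ℝ E).symm.continuous.comp h

/-- The map Ψ is the translation x - p₀ with its component along m replaced by (ε - μ)/‖g‖. It
straightens all level sets of ε and has strict derivative the identity at p₀, so near p₀ it differs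
from a translation by a map of small Lipschitz constant. -/
theorem exists_levelChart {ε : E → ℝ} (hε : ContDiff ℝ ∞ ε) {μ : ℝ} {p₀ : E} (hp : ε p₀ = μ)
    (hg : gradient ε p₀ ≠ 0) {δ : ℝ} (hδ : 0 < δ) (hδ1 : δ ≤ 1) :
    ∃ Ψ Θ ρ r, LevelChart ε μ p₀ (‖gradient ε p₀‖⁻¹ • gradient ε p₀) ‖gradient ε p₀‖ δ Ψ Θ ρ r := by
  set g := gradient ε p₀ with hgdef
  have hG : 0 < ‖g‖ := norm_pos_iff.2 hg
  set m := ‖g‖⁻¹ • g with hm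
  have hm1 : ‖m‖ = 1 := by rw [hm, norm_smul, norm_inv, norm_norm, inv_mul_cancel₀ hG.ne']
  have hgm : g = ‖g‖ • m := by rw [hm, smul_smul, mul_inv_cancel₀ hG.ne', one_smul]
  let Ψ : E → E := fun x => (x - p₀) + ((ε x - μ) / ‖g‖ - ⟪m, x - p₀⟫_ℝ) • m
  have hΨc : Continuous Ψ := by
    have := hε.continuous
    fun_prop
  have hΨ0 : Ψ p₀ = 0 := by simp [Ψ, hp]
  have hstrict : HasStrictFDerivAt Ψ ((ContinuousLinearEquiv.refl ℝ E : E ≃L[ℝ] E) : E →L[ℝ] E)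
      p₀ := by
    have h1 : HasStrictFDerivAt ε (fderiv ℝ ε p₀) p₀ :=
      (hε.contDiffAt).hasStrictFDerivAt (by simp)
    have h2 : HasStrictFDerivAt (fun x : E => x - p₀) (ContinuousLinearMap.id ℝ E) p₀ :=
      (hasStrictFDerivAt_id p₀).sub_const p₀
    have h3 : HasStrictFDerivAt (fun x : E => ⟪m, x - p₀⟫_ℝ) (innerSL ℝ m) p₀ :=
      ((innerSL ℝ m).hasStrictFDerivAt).comp p₀ h2
    have h4 : HasStrictFDerivAt (fun x => (ε x - μ) / ‖g‖) (‖g‖⁻¹ • fderiv ℝ ε p₀) p₀ := by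
      simp only [div_eq_inv_mul]
      exact (h1.sub_const μ).const_mul ‖g‖⁻¹
    refine (h2.add ((h4.sub h3).smul_const m)).congr_fderiv ?_
    ext v
    have e : fderiv ℝ ε p₀ v = ⟪g, v⟫_ℝ := by
      rw [hgdef, gradient, InnerProductSpace.toDual_symm_apply]
    simp only [add_apply, ContinuousLinearMap.coe_id', id_eq,
      ContinuousLinearMap.smulRight_apply, sub_apply,
      smul_apply, innerSL_apply_apply, smul_eq_mul,
      ContinuousLinearEquiv.coe_refl, e]
    rw [hm, inner_smul_left]
    simp
  -- The margin δ/4 is enough for both Lipschitz constants: (1 + δ)(1 - δ/4) ≥ 1 for δ ≤ 1.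
  obtain ⟨s, hs, happ⟩ := hstrict.approximates_deriv_on_nhds (c := (δ / 4).toNNReal)
    (Or.inr (Real.toNNReal_pos.2 (by positivity)))
  obtain ⟨R, hR, hRs⟩ := Metric.mem_nhds_iff.1 hs
  have happ' : ∀ x ∈ Metric.ball p₀ R, ∀ x' ∈ Metric.ball p₀ R,
      ‖Ψ x - Ψ x' - (x - x')‖ ≤ δ / 4 * ‖x - x'‖ := fun x hx x' hx' => by
    have := happ x (hRs hx) x' (hRs hx')
    rw [Real.coe_toNNReal _ (by positivity)] at this
    simpa using this
  have himg : Ψ '' Metric.ball p₀ R ∈ 𝓝 (0 : E) := by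
    rw [← hΨ0, ← hstrict.map_nhds_eq_of_equiv]
    exact image_mem_map (Metric.ball_mem_nhds _ hR)
  obtain ⟨r, hr, hrs⟩ := Metric.mem_nhds_iff.1 himg
  have hinv : ∀ z ∈ Metric.ball (0 : E) r, ∃ x ∈ Metric.ball p₀ R, Ψ x = z := fun z hz => hrs hz
  choose! Θ₀ hΘ₀ hΨΘ using hinv
  have lip : ∀ x ∈ Metric.ball p₀ R, ∀ x' ∈ Metric.ball p₀ R,
      ‖Ψ x - Ψ x'‖ ≤ (1 + δ) * ‖x - x'‖ ∧ ‖x - x'‖ ≤ (1 + δ) * ‖Ψ x - Ψ x'‖ := by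
    intro x hx x' hx'
    have h := happ' x hx x' hx'
    have h1 := norm_sub_norm_le (Ψ x - Ψ x') (x - x')
    have h2 := norm_sub_norm_le (x - x') (Ψ x - Ψ x')
    rw [norm_sub_rev (x - x') (Ψ x - Ψ x')] at h2
    have p1 := norm_nonneg (x - x')
    have h3 : (1 - δ / 4) * ‖x - x'‖ ≤ ‖Ψ x - Ψ x'‖ := by linarith
    constructor
    · nlinarith
    · have h4 := mul_le_mul_of_nonneg_left h3 (show 0 ≤ 1 + δ by linarith)
      have h5 : 0 ≤ (δ * (1 - δ) + 2 * δ) * ‖x - x'‖ :=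
        mul_nonneg (by nlinarith) p1
      nlinarith
  have hinj : ∀ x ∈ Metric.ball p₀ R, ∀ x' ∈ Metric.ball p₀ R, Ψ x = Ψ x' → x = x' := by
    intro x hx x' hx' h
    have := (lip x hx x' hx').2
    rw [h, sub_self, norm_zero, mul_zero] at this
    exact sub_eq_zero.1 (norm_le_zero_iff.1 this)
  have hnc : ContinuousAt (fun x => ‖gradient ε x‖⁻¹ • gradient ε x) p₀ := by
    have hgc := (continuous_gradient hε).continuousAt (x := p₀)
    exact (hgc.norm.inv₀ hG.ne').smul hgc
  have hn1 : ∀ᶠ x in 𝓝 p₀, ‖‖gradient ε x‖⁻¹ • gradient ε x - m‖ ≤ δ := by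
    have := Metric.tendsto_nhds.1 hnc δ hδ
    filter_upwards [this] with x hx
    rw [dist_eq_norm] at hx
    exact hx.le
  have hn3 : ∀ᶠ x in 𝓝 p₀, Ψ x ∈ Metric.ball (0 : E) (r / 2) := by
    refine hΨc.continuousAt.eventually_mem ?_
    rw [hΨ0]; exact Metric.ball_mem_nhds _ (by positivity)
  obtain ⟨ρ₀, hρ₀, hball⟩ := Metric.eventually_nhds_iff.1 (hn1.and hn3)
  have hsub : Metric.ball (0 : E) (r / 2) ⊆ Metric.ball 0 r :=
    Metric.ball_subset_ball (by linarith)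
  classical
  -- The local inverse is continued by a constant, which makes it measurable everywhere. The radius
  -- is at most R/2, so that the ball of radius 2ρ in `approx` stays where Ψ is controlled.
  refine ⟨Ψ, (Metric.ball (0 : E) r).piecewise Θ₀ fun _ => p₀, min ρ₀ (R / 2), r,
    lt_min hρ₀ (by positivity), hr, hG, hm1, hΨc, ?_, ?_, ?_, ?_, ?_, ?_, ?_, ?_, ?_⟩
  · have : LipschitzOnWith (1 + δ).toNNReal Θ₀ (Metric.ball (0 : E) r) := by
      refine LipschitzOnWith.of_dist_le_mul fun z hz z' hz' => ?_
      have := (lip _ (hΘ₀ z hz) _ (hΘ₀ z' hz')).2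
      rw [hΨΘ z hz, hΨΘ z' hz'] at this
      rw [dist_eq_norm, dist_eq_norm, Real.coe_toNNReal _ (by positivity)]
      exact this
    exact this.continuousOn.measurable_piecewise continuousOn_const Metric.isOpen_ball.measurableSet
  · intro z hz
    rw [piecewise_eq_of_mem _ _ _ hz]; exact hΨΘ z hz
  · intro x hx
    exact (hball (lt_of_lt_of_le hx (min_le_left _ _))).2
  · intro x hx
    have hz := hsub (hball (lt_of_lt_of_le hx (min_le_left _ _))).2
    rw [piecewise_eq_of_mem _ _ _ hz]
    refine hinj _ (hΘ₀ _ hz) _ ?_ (hΨΘ _ hz)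
    exact Metric.ball_subset_ball ((min_le_right _ _).trans (by linarith)) hx
  · intro x
    simp only [Ψ]
    rw [inner_add_right, inner_smul_right, real_inner_self_eq_norm_sq, hm1]
    field_simp
    ring
  · intro z hz z' hz'
    rw [piecewise_eq_of_mem _ _ _ hz, piecewise_eq_of_mem _ _ _ hz', dist_eq_norm, dist_eq_norm]
    have := (lip _ (hΘ₀ z hz) _ (hΘ₀ z' hz')).2
    rwa [hΨΘ z hz, hΨΘ z' hz'] at this
  · intro z hz z' hz'
    rw [piecewise_eq_of_mem _ _ _ hz, piecewise_eq_of_mem _ _ _ hz', dist_eq_norm, dist_eq_norm]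
    have := (lip _ (hΘ₀ z hz) _ (hΘ₀ z' hz')).1
    rwa [hΨΘ z hz, hΨΘ z' hz'] at this
  · intro x hx x' hx'
    have h2 : Metric.ball p₀ (2 * min ρ₀ (R / 2)) ⊆ Metric.ball p₀ R :=
      Metric.ball_subset_ball (by linarith [min_le_right ρ₀ (R / 2)])
    refine (happ' x (h2 hx) x' (h2 hx')).trans ?_
    gcongr; linarith
  · intro x hx
    exact (hball (lt_of_lt_of_le hx (min_le_left _ _))).1

/-- Integrals over Lipschitz images. -/
theorem lintegral_image_le {X Y : Type*} [MetricSpace X] [MetricSpace Y] [MeasurableSpace X]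
    [BorelSpace X] [MeasurableSpace Y] [BorelSpace Y] {T : X → Y} {A : Set X} {K : NNReal} {k : ℕ}
    (hT : LipschitzOnWith K T A) (hTm : Measurable T) {f : Y → ENNReal} (hf : Measurable f) :
    ∫⁻ y in T '' A, f y ∂μHE[k] ≤ (K : ENNReal) ^ k * ∫⁻ x in A, f (T x) ∂μHE[k] := by
  have hle : (μHE[k] : Measure Y).restrict (T '' A) ≤
      ((K : ENNReal) ^ k) • ((μHE[k] : Measure X).restrict A).map T := by
    refine Measure.le_iff.2 fun B hB => ?_
    rw [Measure.restrict_apply hB, Measure.smul_apply, Measure.map_apply hTm hB, smul_eq_mul]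
    rw [← image_preimage_inter]
    refine (euclideanHausdorffMeasure_image_le (hT.mono inter_subset_right) k).trans ?_
    exact mul_le_mul' le_rfl (Measure.le_restrict_apply _ _)
  calc _ ≤ ∫⁻ y, f y ∂(((K : ENNReal) ^ k) • ((μHE[k] : Measure X).restrict A).map T) :=
        lintegral_mono' hle le_rfl
    _ = _ := by rw [lintegral_smul_measure, lintegral_map hf hTm, smul_eq_mul]

namespace LevelChart

variable {ε : E → ℝ} {μ : ℝ} {p₀ m : E} {G δ : ℝ} {Ψ Θ : E → E} {ρ r : ℝ}

/-- Together with `lintegral_le_image` this replaces the area formula: Θ and its inverse are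
(1+δ)-Lipschitz, so k-dimensional integrals change by at most a factor (1+δ)^k in either direction.
-/
theorem lintegral_image_le (H : LevelChart ε μ p₀ m G δ Ψ Θ ρ r) (hδ : 0 ≤ δ) {A : Set E}
    (hA : A ⊆ Metric.ball 0 r) (k : ℕ) {f : E → ENNReal} (hf : Measurable f) :
    ∫⁻ x in Θ '' A, f x ∂μHE[k] ≤ ENNReal.ofReal (1 + δ) ^ k * ∫⁻ z in A, f (Θ z) ∂μHE[k] := by
  have hL : LipschitzOnWith (1 + δ).toNNReal Θ A := LipschitzOnWith.of_dist_le_mul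
    fun z hz z' hz' => by
      rw [Real.coe_toNNReal _ (by positivity)]
      exact H.lip_inv z (hA hz) z' (hA hz')
  exact FermiGas.lintegral_image_le hL H.measurable_inv hf

theorem lintegral_le_image (H : LevelChart ε μ p₀ m G δ Ψ Θ ρ r) (hδ : 0 ≤ δ) {A : Set E}
    (hA : A ⊆ Metric.ball 0 r) (hAm : MeasurableSet A) (k : ℕ) {f : E → ENNReal}
    (hf : Measurable f) :
    ∫⁻ z in A, f (Θ z) ∂μHE[k] ≤ ENNReal.ofReal (1 + δ) ^ k * ∫⁻ x in Θ '' A, f x ∂μHE[k] := by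
  have hL : LipschitzOnWith (1 + δ).toNNReal Ψ (Θ '' A) := LipschitzOnWith.of_dist_le_mul (by
    rintro _ ⟨z, hz, rfl⟩ _ ⟨z', hz', rfl⟩
    rw [Real.coe_toNNReal _ (by positivity), H.right_inv z (hA hz), H.right_inv z' (hA hz')]
    exact H.lip z (hA hz) z' (hA hz'))
  have himg : Ψ '' (Θ '' A) = A := by
    rw [image_image]
    exact (image_congr fun z hz => H.right_inv z (hA hz)).trans (image_id' A)
  have h := FermiGas.lintegral_image_le (k := k) hL H.continuous.measurable
    (hf.comp H.measurable_inv)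
  rw [himg] at h
  refine h.trans_eq ?_
  congr 1
  have hm : MeasurableSet (Θ '' A) := hAm.image_of_measurable_injOn H.measurable_inv
    fun z hz z' hz' heq => by
      rw [← H.right_inv z (hA hz), ← H.right_inv z' (hA hz'), heq]
  refine setLIntegral_congr_fun hm ?_
  rintro _ ⟨z, hz, rfl⟩
  simp only [Function.comp, H.right_inv z (hA hz)]

end LevelChart

end Chart

/-! ### Integrals over thin slabs and over hyperplanes -/

section Slab

variable {E : Type*} [NormedAddCommGroup E] [InnerProductSpace ℝ E] [FiniteDimensional ℝ E]
  [MeasurableSpace E] [BorelSpace E]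

theorem setLIntegral_le_of_support {X : Type*} [MeasurableSpace X] {ν : Measure X}
    {f : X → ENNReal} (hf : Measurable f) {s t : Set X} (h : ∀ x ∈ s, f x ≠ 0 → x ∈ t) :
    ∫⁻ x in s, f x ∂ν ≤ ∫⁻ x in t, f x ∂ν := by
  have hm : MeasurableSet {x | f x ≠ 0} := hf (measurableSet_singleton 0).compl
  have e : {x | f x ≠ 0}.indicator f = f := by
    rw [indicator_eq_self]; exact fun x hx => hx
  calc ∫⁻ x in s, f x ∂ν = ∫⁻ x in s, {x | f x ≠ 0}.indicator f x ∂ν := by rw [e]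
    _ = ∫⁻ x in {x | f x ≠ 0} ∩ s, f x ∂ν := setLIntegral_indicator hm _
    _ ≤ ∫⁻ x in t, f x ∂ν := lintegral_mono_set fun x hx => h x hx.2 hx.1

theorem lintegral_orthCoord {n : E} (hn : ‖n‖ = 1) {f : E → ENNReal} (hf : Measurable f) :
    ∫⁻ x, f x = ∫⁻ y : (ℝ ∙ n)ᗮ, ∫⁻ t : ℝ, f (y + t • n) := by
  rw [← (measurePreserving_orthCoord n hn).lintegral_comp hf, Measure.volume_eq_prod,
    lintegral_prod (fun y => f (orthCoord n hn y))
      (hf.comp (orthCoord n hn).measurable).aemeasurable]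
  simp only [orthCoord_apply]

theorem lintegral_hyperplane {k : ℕ} (hk : Module.finrank ℝ E = k + 1) {m : E} (hm : ‖m‖ = 1)
    {A : Set E} (hA : MeasurableSet A) {f : E → ENNReal} (hf : Measurable f) :
    ∫⁻ z in {z | z ∈ A ∧ ⟪m, z⟫_ℝ = 0}, f z ∂μHE[k] =
      ∫⁻ y : (ℝ ∙ m)ᗮ, A.indicator f (y : E) := by
  have hfr := finrank_orthogonal_unit hk hm
  have hiso : Isometry ((↑) : (ℝ ∙ m)ᗮ → E) := isometry_subtype_coe
  have h := hiso.map_euclideanHausdorffMeasure (d := k)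
  have hv : (volume : Measure (ℝ ∙ m)ᗮ) = μHE[k] := by
    rw [← hfr]; exact InnerProductSpace.euclideanHausdorffMeasure_eq_volume.symm
  rw [hv, ← lintegral_map (hf.indicator hA) measurable_subtype_coe, h, setLIntegral_indicator hA]
  congr 2
  ext z
  rw [Subtype.range_coe]
  exact and_congr_right fun _ => (Submodule.mem_orthogonal_singleton_iff_inner_right).symm

theorem inner_coe_add_smul {m : E} (hm : ‖m‖ = 1) (y : (ℝ ∙ m)ᗮ) (t : ℝ) :
    ⟪m, (y : E) + t • m⟫_ℝ = t := by
  rw [inner_add_right, inner_smul_right, real_inner_self_eq_norm_sq, hm,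
    Submodule.mem_orthogonal_singleton_iff_inner_right.1 y.2]
  ring

theorem norm_coe_le_norm_add_smul {m : E} (y : (ℝ ∙ m)ᗮ) (t : ℝ) :
    ‖(y : E)‖ ≤ ‖(y : E) + t • m‖ := by
  have h : ⟪(y : E), t • m⟫_ℝ = 0 := by
    rw [inner_smul_right, real_inner_comm,
      Submodule.mem_orthogonal_singleton_iff_inner_right.1 y.2, mul_zero]
  have := norm_add_sq_eq_norm_sq_add_norm_sq_of_inner_eq_zero _ _ h
  nlinarith [norm_nonneg (y : E), norm_nonneg ((y : E) + t • m), norm_nonneg (t • m)]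

/-- Symmetric difference of a set and its translate by `-h`. -/
def shiftDiff (Γ : Set E) (h : E) : Set E := {x | ¬(x ∈ Γ ↔ x + h ∈ Γ)}

namespace LevelChart

variable {ε : E → ℝ} {μ : ℝ} {p₀ m : E} {G δ : ℝ} {Ψ Θ : E → E} {ρ r : ℝ}

theorem level_le_iff (H : LevelChart ε μ p₀ m G δ Ψ Θ ρ r) (x : E) :
    ε x ≤ μ ↔ ⟪m, Ψ x⟫_ℝ ≤ 0 := by
  have h := H.level x
  have := H.G_pos
  constructor
  · intro h1; by_contra h2; nlinarith [mul_pos this (not_le.1 h2)]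
  · intro h1; nlinarith

theorem level_eq_iff (H : LevelChart ε μ p₀ m G δ Ψ Θ ρ r) (x : E) :
    ε x = μ ↔ ⟪m, Ψ x⟫_ℝ = 0 := by
  have h := H.level x
  have := H.G_pos
  constructor
  · intro h1; rw [h1, sub_self] at h; exact (mul_eq_zero.1 h).resolve_left this.ne'
  · intro h1; rw [h1, mul_zero] at h; linarith

/-- In the chart the height ⟪m, Ψ x⟫ measures ε - μ, and a shift by s n moves it by s⟪m,n⟫ up to δs.
The bound s < ρ keeps the shifted point in the ball of radius 2ρ. -/
theorem abs_inner_shift_le (H : LevelChart ε μ p₀ m G δ Ψ Θ ρ r) (hδ : 0 ≤ δ) {x n : E} {s : ℝ}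
    (hx : x ∈ Metric.ball p₀ ρ) (hn : ‖n‖ ≤ 1) (hs : 0 < s) (hsρ : s < ρ) :
    |⟪m, Ψ (x + s • n)⟫_ℝ - ⟪m, Ψ x⟫_ℝ - s * ⟪m, n⟫_ℝ| ≤ δ * s := by
  have hsn : ‖s • n‖ ≤ s := by
    rw [norm_smul, Real.norm_of_nonneg hs.le]; nlinarith
  rw [Metric.mem_ball, dist_eq_norm] at hx
  have h1 : x + s • n ∈ Metric.ball p₀ (2 * ρ) := by
    rw [Metric.mem_ball, dist_eq_norm, add_sub_right_comm]
    have := norm_add_le (x - p₀) (s • n)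
    linarith
  have h2 : x ∈ Metric.ball p₀ (2 * ρ) := by
    rw [Metric.mem_ball, dist_eq_norm]; linarith [H.rho_pos]
  have h := H.approx _ h1 _ h2
  rw [add_sub_cancel_left] at h
  have e : ⟪m, Ψ (x + s • n)⟫_ℝ - ⟪m, Ψ x⟫_ℝ - s * ⟪m, n⟫_ℝ =
      ⟪m, Ψ (x + s • n) - Ψ x - s • n⟫_ℝ := by
    rw [inner_sub_right, inner_sub_right, inner_smul_right]
  rw [e]
  calc _ ≤ ‖m‖ * ‖Ψ (x + s • n) - Ψ x - s • n‖ := abs_real_inner_le_norm _ _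
    _ ≤ 1 * (δ * ‖s • n‖) := by rw [H.norm_m]; gcongr
    _ ≤ _ := by rw [one_mul]; gcongr

theorem measurableSet_slab (r : ℝ) (m : E) {I : Set ℝ} (hI : MeasurableSet I) :
    MeasurableSet {z : E | z ∈ Metric.ball (0 : E) r ∧ ⟪m, z⟫_ℝ ∈ I} := by
  have : Measurable fun z : E => ⟪m, z⟫_ℝ := (by fun_prop : Continuous _).measurable
  exact Metric.isOpen_ball.measurableSet.inter (this hI)

/-- Integrals over thin slabs are bounded above by integrals over the hyperplane. -/
theorem slab_le {r : ℝ} (hm : ‖m‖ = 1) {I : Set ℝ} (hI : MeasurableSet I) {f : E → ENNReal}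
    (hf : Measurable f) {w : ENNReal}
    (hw : ∀ z ∈ Metric.ball (0 : E) r, ∀ z' ∈ Metric.ball (0 : E) r, ‖z - z'‖ = |⟪m, z⟫_ℝ| →
      ⟪m, z⟫_ℝ ∈ I → f z ≤ f z' + w) :
    ∫⁻ z in {z | z ∈ Metric.ball (0 : E) r ∧ ⟪m, z⟫_ℝ ∈ I}, f z ≤
      volume I * ((∫⁻ y : (ℝ ∙ m)ᗮ, (Metric.ball (0 : E) r).indicator f (y : E)) +
        w * volume (Metric.ball (0 : (ℝ ∙ m)ᗮ) r)) := by
  have hb : MeasurableSet (Metric.ball (0 : E) r) := Metric.isOpen_ball.measurableSet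
  rw [← lintegral_indicator (measurableSet_slab r m hI), lintegral_orthCoord hm
    (hf.indicator (measurableSet_slab r m hI))]
  have h1 : ∀ y : (ℝ ∙ m)ᗮ, ∫⁻ t : ℝ, {z | z ∈ Metric.ball (0 : E) r ∧ ⟪m, z⟫_ℝ ∈ I}.indicator f
      (y + t • m) ≤ volume I * ((Metric.ball (0 : E) r).indicator f (y : E) +
        (Metric.ball (0 : (ℝ ∙ m)ᗮ) r).indicator (fun _ => w) y) := by
    intro y
    rw [mul_comm, ← setLIntegral_const, ← lintegral_indicator hI]
    refine lintegral_mono fun t => ?_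
    by_cases hz : (y : E) + t • m ∈ {z | z ∈ Metric.ball (0 : E) r ∧ ⟪m, z⟫_ℝ ∈ I}
    · rw [indicator_of_mem hz]
      have hin := hz.2
      rw [inner_coe_add_smul hm] at hin
      have hy : (y : E) ∈ Metric.ball (0 : E) r :=
        mem_ball_zero_iff.2 ((norm_coe_le_norm_add_smul y t).trans_lt (mem_ball_zero_iff.1 hz.1))
      have hy' : y ∈ Metric.ball (0 : (ℝ ∙ m)ᗮ) r := by
        rw [mem_ball_zero_iff]; exact mem_ball_zero_iff.1 hy
      rw [indicator_of_mem hin, indicator_of_mem hy, indicator_of_mem hy']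
      refine hw _ hz.1 _ hy ?_ hz.2
      rw [add_sub_cancel_left, norm_smul, hm, mul_one, inner_coe_add_smul hm, Real.norm_eq_abs]
    · rw [indicator_of_notMem hz]; exact zero_le
  refine (lintegral_mono h1).trans_eq ?_
  have hmeas : Measurable fun y : (ℝ ∙ m)ᗮ => (Metric.ball (0 : E) r).indicator f (y : E) :=
    (hf.indicator hb).comp measurable_subtype_coe
  have hmeas' : Measurable fun y : (ℝ ∙ m)ᗮ => (Metric.ball (0 : E) r).indicator f (y : E) +
      (Metric.ball (0 : (ℝ ∙ m)ᗮ) r).indicator (fun _ => w) y :=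
    hmeas.add (measurable_const.indicator Metric.isOpen_ball.measurableSet)
  rw [lintegral_const_mul _ hmeas', lintegral_add_left hmeas,
    lintegral_indicator_const Metric.isOpen_ball.measurableSet]

/-- Integrals over thin slabs are bounded below by integrals over the hyperplane. -/
theorem le_slab {r : ℝ} (hm : ‖m‖ = 1) {I : Set ℝ} (hI : MeasurableSet I)
    (hIr : ∀ t ∈ I, |t| < r / 2) {f : E → ENNReal} (hf : Measurable f) {w : ENNReal}
    (hw : ∀ z ∈ Metric.ball (0 : E) r, ∀ z' ∈ Metric.ball (0 : E) r, ‖z - z'‖ = |⟪m, z⟫_ℝ| →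
      ⟪m, z⟫_ℝ ∈ I → f z' ≤ f z + w) :
    volume I * ∫⁻ y : (ℝ ∙ m)ᗮ, (Metric.ball (0 : E) (r / 2)).indicator f (y : E) ≤
      (∫⁻ z in {z | z ∈ Metric.ball (0 : E) r ∧ ⟪m, z⟫_ℝ ∈ I}, f z) +
        volume I * (w * volume (Metric.ball (0 : (ℝ ∙ m)ᗮ) r)) := by
  have hb : MeasurableSet (Metric.ball (0 : E) (r / 2)) := Metric.isOpen_ball.measurableSet
  have hmeas : Measurable fun y : (ℝ ∙ m)ᗮ => (Metric.ball (0 : E) (r / 2)).indicator f (y : E) :=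
    (hf.indicator hb).comp measurable_subtype_coe
  have hsl := measurableSet_slab r m hI
  rw [← lintegral_indicator hsl, lintegral_orthCoord hm (hf.indicator hsl),
    ← lintegral_indicator_const Metric.isOpen_ball.measurableSet,
    ← lintegral_const_mul _ hmeas, ← lintegral_const_mul _
      (measurable_const.indicator Metric.isOpen_ball.measurableSet),
    ← lintegral_add_right _ ((measurable_const.indicator
      Metric.isOpen_ball.measurableSet).const_mul _)]
  refine lintegral_mono fun y => ?_
  beta_reduce
  rw [mul_comm, ← setLIntegral_const, mul_comm, ← setLIntegral_const,
    ← lintegral_indicator hI, ← lintegral_indicator hI,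
    ← lintegral_add_right _ (measurable_const.indicator hI)]
  refine lintegral_mono fun t => ?_
  by_cases ht : t ∈ I
  · beta_reduce
    rw [indicator_of_mem ht, indicator_of_mem ht]
    by_cases hy : (y : E) ∈ Metric.ball (0 : E) (r / 2)
    · have hyn := mem_ball_zero_iff.1 hy
      have htr := hIr t ht
      have hyr : (y : E) ∈ Metric.ball (0 : E) r := mem_ball_zero_iff.2 (by linarith [abs_nonneg t])
      have hy' : y ∈ Metric.ball (0 : (ℝ ∙ m)ᗮ) r := by
        rw [mem_ball_zero_iff]; exact mem_ball_zero_iff.1 hyr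
      have hz1 : (y : E) + t • m ∈ Metric.ball (0 : E) r := by
        refine mem_ball_zero_iff.2 ((norm_add_le _ _).trans_lt ?_)
        rw [norm_smul, hm, mul_one, Real.norm_eq_abs]; linarith
      have hz2 : ⟪m, (y : E) + t • m⟫_ℝ ∈ I := by rw [inner_coe_add_smul hm]; exact ht
      have hz : (y : E) + t • m ∈ {z | z ∈ Metric.ball (0 : E) r ∧ ⟪m, z⟫_ℝ ∈ I} := ⟨hz1, hz2⟩
      rw [indicator_of_mem hy, indicator_of_mem hy', indicator_of_mem hz]
      refine hw _ hz1 _ hyr ?_ hz2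
      rw [add_sub_cancel_left, norm_smul, hm, mul_one, inner_coe_add_smul hm, Real.norm_eq_abs]
    · rw [indicator_of_notMem hy]; exact zero_le
  · beta_reduce
    rw [indicator_of_notMem ht]; exact zero_le

end LevelChart

end Slab

/-! ### Shifted sublevel sets, surface area and energy shells in a single chart -/

section Shift

variable {E : Type*} [NormedAddCommGroup E] [InnerProductSpace ℝ E] [FiniteDimensional ℝ E]
  [MeasurableSpace E] [BorelSpace E]

theorem measurableSet_shiftDiff {Γ : Set E} (hΓ : MeasurableSet Γ) (h : E) :
    MeasurableSet (shiftDiff Γ h) := by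
  have h1 : MeasurableSet {x | x + h ∈ Γ} := (measurable_add_const h) hΓ
  have e : shiftDiff Γ h = (Γ \ {x | x + h ∈ Γ}) ∪ ({x | x + h ∈ Γ} \ Γ) := by
    ext x
    simp only [shiftDiff, mem_ofPred_eq, mem_union, Set.mem_sdiff]
    tauto
  rw [e]
  exact (hΓ.diff h1).union (h1.diff hΓ)

namespace LevelChart

variable {ε : E → ℝ} {μ : ℝ} {p₀ m : E} {G δ : ℝ} {Ψ Θ : E → E} {ρ r : ℝ}

theorem volume_eq_muHE {k : ℕ} (hk : Module.finrank ℝ E = k + 1) :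
    (volume : Measure E) = μHE[k + 1] := by
  rw [← hk]; exact InnerProductSpace.euclideanHausdorffMeasure_eq_volume.symm

theorem exists_osc_le (H : LevelChart ε μ p₀ m G δ Ψ Θ ρ r) (hδ : 0 ≤ δ) (hδ1 : δ ≤ 1)
    {φ : E → ℝ} (hφ : Continuous φ) (hcs : HasCompactSupport φ) {w : ℝ} (hw : 0 < w) :
    ∃ η, 0 < η ∧ ∀ z ∈ Metric.ball (0 : E) r, ∀ z' ∈ Metric.ball (0 : E) r, ‖z - z'‖ < η →
      ENNReal.ofReal (φ (Θ z)) ≤ ENNReal.ofReal (φ (Θ z')) + ENNReal.ofReal w := by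
  have huc : UniformContinuous φ := hcs.uniformContinuous_of_continuous hφ
  obtain ⟨η, hη, h⟩ := Metric.uniformContinuous_iff.1 huc w hw
  refine ⟨η / 2, by positivity, fun z hz z' hz' hzz => ?_⟩
  have h1 : dist (Θ z) (Θ z') < η := by
    refine (H.lip_inv z hz z' hz').trans_lt ?_
    rw [dist_eq_norm]
    nlinarith [norm_nonneg (z - z')]
  have h2 := h h1
  rw [Real.dist_eq] at h2
  refine (ENNReal.ofReal_le_ofReal (q := φ (Θ z') + w) ?_).trans ENNReal.ofReal_add_le
  linarith [(abs_lt.1 h2).2]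

/-- A point of the symmetric difference has a height whose sign changes under the shift. The height
moves by s⟪m,n⟫ ± δs, so it lies in an interval of length at most s(|⟪m,n⟫| + 2δ). The slab over
this interval is compared with its base hyperplane, and the latter with the level set; w accounts
for the oscillation of φ across the slab. -/
theorem shift_le (H : LevelChart ε μ p₀ m G δ Ψ Θ ρ r) {k : ℕ}
    (hk : Module.finrank ℝ E = k + 1) (hδ : 0 ≤ δ) (hδ1 : δ ≤ 1) {φ : E → ℝ} (hφ : Continuous φ)
    (hcs : HasCompactSupport φ) (hsupp : tsupport φ ⊆ Metric.ball p₀ ρ) {n : E} (hn : ‖n‖ ≤ 1)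
    {w : ℝ} (hw : 0 < w) :
    ∀ᶠ s : ℝ in 𝓝[>] 0, ∫⁻ x in shiftDiff {x | ε x ≤ μ} (s • n), ENNReal.ofReal (φ x) ≤
      ENNReal.ofReal (s * (|⟪m, n⟫_ℝ| + 2 * δ)) * (ENNReal.ofReal (1 + δ) ^ (k + 1) *
        (ENNReal.ofReal (1 + δ) ^ k * (∫⁻ x in {x | ε x = μ}, ENNReal.ofReal (φ x) ∂μHE[k]) +
          ENNReal.ofReal w * volume (Metric.ball (0 : (ℝ ∙ m)ᗮ) r))) := by
  obtain ⟨η, hη, hosc⟩ := H.exists_osc_le hδ hδ1 hφ hcs hw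
  have hρ := H.rho_pos
  have hmn : |⟪m, n⟫_ℝ| ≤ 1 := (abs_real_inner_le_norm m n).trans (by
    rw [H.norm_m, one_mul]; exact hn)
  have hφm : Measurable fun x => ENNReal.ofReal (φ x) := by fun_prop
  have hφΘ : Measurable fun z => ENNReal.ofReal (φ (Θ z)) := hφm.comp H.measurable_inv
  have hsmall : ∀ᶠ s : ℝ in 𝓝[>] 0, s < min ρ (η / 2) :=
    (eventually_lt_nhds (lt_min hρ (half_pos hη))).filter_mono nhdsWithin_le_nhds
  filter_upwards [hsmall, self_mem_nhdsWithin] with s hs hs0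
  have hs0 : 0 < s := hs0
  have hsρ := hs.trans_le (min_le_left _ _)
  have hsη := hs.trans_le (min_le_right _ _)
  -- The point lies below the level and crosses upwards if its height is in [-sa, 0], or above it
  -- and crosses downwards if its height is in [0, sb].
  set a := max (⟪m, n⟫_ℝ + δ) 0 with ha
  set b := max (δ - ⟪m, n⟫_ℝ) 0 with hb
  have hab : a + b ≤ |⟪m, n⟫_ℝ| + 2 * δ := by
    rcases max_cases (⟪m, n⟫_ℝ + δ) 0 with h1 | h1 <;>
    rcases max_cases (δ - ⟪m, n⟫_ℝ) 0 with h2 | h2 <;>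
    rcases abs_cases ⟪m, n⟫_ℝ with h3 | h3 <;> rw [ha, hb] <;> linarith
  have ha2 : a ≤ 2 := max_le (by linarith [le_abs_self ⟪m, n⟫_ℝ]) (by norm_num)
  have hb2 : b ≤ 2 := max_le (by linarith [neg_abs_le ⟪m, n⟫_ℝ]) (by norm_num)
  have ha0 : 0 ≤ a := le_max_right _ _
  have hb0 : 0 ≤ b := le_max_right _ _
  set I := Icc (-(s * a)) (s * b) with hI
  set A := {z | z ∈ Metric.ball (0 : E) r ∧ ⟪m, z⟫_ℝ ∈ I} with hA
  have hAm : MeasurableSet A := measurableSet_slab r m measurableSet_Icc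
  have hvol : volume I ≤ ENNReal.ofReal (s * (|⟪m, n⟫_ℝ| + 2 * δ)) := by
    rw [hI, Real.volume_Icc]
    apply ENNReal.ofReal_le_ofReal
    nlinarith
  have hstep1 : ∫⁻ x in shiftDiff {x | ε x ≤ μ} (s • n), ENNReal.ofReal (φ x) ≤
      ∫⁻ x in Θ '' A, ENNReal.ofReal (φ x) := by
    refine setLIntegral_le_of_support hφm fun x hx hne => ?_
    have hxb : x ∈ Metric.ball p₀ ρ := hsupp (subset_tsupport _ fun h0 => hne (by simp [h0]))
    have hz := H.maps x hxb
    refine ⟨Ψ x, ⟨Metric.ball_subset_ball (by linarith [H.r_pos]) hz, ?_⟩, H.left_inv x hxb⟩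
    have hsh := abs_le.1 (H.abs_inner_shift_le hδ hxb hn hs0 hsρ)
    have hx' : ¬(⟪m, Ψ x⟫_ℝ ≤ 0 ↔ ⟪m, Ψ (x + s • n)⟫_ℝ ≤ 0) := by
      rw [← H.level_le_iff, ← H.level_le_iff]; exact hx
    have e1 : ⟪m, n⟫_ℝ + δ ≤ a := le_max_left _ _
    have e2 : δ - ⟪m, n⟫_ℝ ≤ b := le_max_left _ _
    have f1 := mul_le_mul_of_nonneg_left e1 hs0.le
    have f2 := mul_le_mul_of_nonneg_left e2 hs0.le
    have f3 := mul_nonneg hs0.le ha0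
    have f4 := mul_nonneg hs0.le hb0
    by_cases h0 : ⟪m, Ψ x⟫_ℝ ≤ 0
    · have h1 : ¬⟪m, Ψ (x + s • n)⟫_ℝ ≤ 0 := fun h => hx' ⟨fun _ => h, fun _ => h0⟩
      constructor <;> nlinarith [hsh.1, hsh.2]
    · have h1 : ⟪m, Ψ (x + s • n)⟫_ℝ ≤ 0 := by
        by_contra h; exact hx' ⟨fun h' => absurd h' h0, fun h' => absurd h' h⟩
      constructor <;> nlinarith [hsh.1, hsh.2]
  have hstep2 := H.lintegral_image_le hδ (A := A) (fun z hz => hz.1) (k + 1) hφm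
  rw [← volume_eq_muHE hk] at hstep2
  have hstep3 := slab_le (r := r) H.norm_m (I := I) measurableSet_Icc hφΘ
    (w := ENNReal.ofReal w) fun z hz z' hz' hd hzI => by
      refine hosc z hz z' hz' ?_
      rw [hd, abs_lt]
      constructor <;> nlinarith [hzI.1, hzI.2]
  have hstep4 : ∫⁻ y : (ℝ ∙ m)ᗮ, (Metric.ball (0 : E) r).indicator
      (fun z => ENNReal.ofReal (φ (Θ z))) (y : E) ≤
      ENNReal.ofReal (1 + δ) ^ k * ∫⁻ x in {x | ε x = μ}, ENNReal.ofReal (φ x) ∂μHE[k] := by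
    rw [← lintegral_hyperplane hk H.norm_m Metric.isOpen_ball.measurableSet hφΘ]
    have hBm : MeasurableSet {z | z ∈ Metric.ball (0 : E) r ∧ ⟪m, z⟫_ℝ = 0} :=
      measurableSet_slab r m (measurableSet_singleton 0)
    refine (H.lintegral_le_image hδ (fun z hz => hz.1) hBm k hφm).trans ?_
    refine mul_le_mul' le_rfl (lintegral_mono_set ?_)
    rintro _ ⟨z, hz, rfl⟩
    change ε (Θ z) = μ
    rw [H.level_eq_iff, H.right_inv z hz.1]; exact hz.2
  calc _ ≤ _ := hstep1
    _ ≤ _ := hstep2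
    _ ≤ ENNReal.ofReal (1 + δ) ^ (k + 1) * (ENNReal.ofReal (s * (|⟪m, n⟫_ℝ| + 2 * δ)) *
        (ENNReal.ofReal (1 + δ) ^ k * (∫⁻ x in {x | ε x = μ}, ENNReal.ofReal (φ x) ∂μHE[k]) +
          ENNReal.ofReal w * volume (Metric.ball (0 : (ℝ ∙ m)ᗮ) r))) := by
        refine mul_le_mul' le_rfl (hstep3.trans (mul_le_mul' hvol (add_le_add hstep4 le_rfl)))
    _ = _ := by ring

/-- The converse estimate: heights in a one-sided interval of length s(|⟪m,n⟫| - δ) are certain to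
change sign. The half ball leaves room to move off the hyperplane inside the chart. -/
theorem le_shift (H : LevelChart ε μ p₀ m G δ Ψ Θ ρ r) {k : ℕ}
    (hk : Module.finrank ℝ E = k + 1) (hδ : 0 ≤ δ) (hδ1 : δ ≤ 1) {φ : E → ℝ} (hφ : Continuous φ)
    (hcs : HasCompactSupport φ) (hsupp : tsupport φ ⊆ Metric.ball p₀ ρ) {n : E} (hn : ‖n‖ ≤ 1)
    {w : ℝ} (hw : 0 < w) :
    ∀ᶠ s : ℝ in 𝓝[>] 0, ENNReal.ofReal (s * (|⟪m, n⟫_ℝ| - δ)) *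
        (∫⁻ x in {x | ε x = μ}, ENNReal.ofReal (φ x) ∂μHE[k]) ≤
      ENNReal.ofReal (1 + δ) ^ k * (ENNReal.ofReal (1 + δ) ^ (k + 1) *
        (∫⁻ x in shiftDiff {x | ε x ≤ μ} (s • n), ENNReal.ofReal (φ x)) +
        ENNReal.ofReal (s * (|⟪m, n⟫_ℝ| - δ)) *
          (ENNReal.ofReal w * volume (Metric.ball (0 : (ℝ ∙ m)ᗮ) r))) := by
  obtain ⟨η, hη, hosc⟩ := H.exists_osc_le hδ hδ1 hφ hcs hw
  have hρ := H.rho_pos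
  have hr := H.r_pos
  have hmn : |⟪m, n⟫_ℝ| ≤ 1 := (abs_real_inner_le_norm m n).trans (by
    rw [H.norm_m, one_mul]; exact hn)
  have hφm : Measurable fun x => ENNReal.ofReal (φ x) := by fun_prop
  have hφΘ : Measurable fun z => ENNReal.ofReal (φ (Θ z)) := hφm.comp H.measurable_inv
  have hsmall : ∀ᶠ s : ℝ in 𝓝[>] 0, s < min ρ (min η (r / 2)) :=
    (eventually_lt_nhds (lt_min hρ (lt_min hη (half_pos hr)))).filter_mono nhdsWithin_le_nhds
  filter_upwards [hsmall, self_mem_nhdsWithin] with s hs hs0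
  have hs0 : 0 < s := hs0
  have hsρ := hs.trans_le (min_le_left _ _)
  have hsη := hs.trans_le ((min_le_right _ _).trans (min_le_left _ _))
  have hsr := hs.trans_le ((min_le_right _ _).trans (min_le_right _ _))
  -- The interval lies below 0 if the shift raises the height and above 0 if it lowers it. It is
  -- empty when |⟪m,n⟫| ≤ δ, in agreement with the truncation in `ENNReal.ofReal`.
  obtain ⟨I, hIm, hIv, hIs, hIc⟩ : ∃ I : Set ℝ, MeasurableSet I ∧
      volume I = ENNReal.ofReal (s * (|⟪m, n⟫_ℝ| - δ)) ∧ (∀ t ∈ I, |t| ≤ s) ∧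
      ∀ t ∈ I, ∀ t', |t' - t - s * ⟪m, n⟫_ℝ| ≤ δ * s → ¬(t ≤ 0 ↔ t' ≤ 0) := by
    rcases le_total 0 ⟪m, n⟫_ℝ with h | h
    · refine ⟨Ioc (-(s * (⟪m, n⟫_ℝ - δ))) 0, measurableSet_Ioc, ?_, ?_, ?_⟩
      · rw [Real.volume_Ioc, abs_of_nonneg h]; congr 1; ring
      · intro t ht
        rw [abs_of_nonneg h] at hmn
        rw [abs_of_nonpos ht.2]; nlinarith [ht.1]
      · intro t ht t' ht' hiff
        have := hiff.1 ht.2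
        nlinarith [ht.1, (abs_le.1 ht').1]
    · refine ⟨Ioc 0 (s * (-⟪m, n⟫_ℝ - δ)), measurableSet_Ioc, ?_, ?_, ?_⟩
      · rw [Real.volume_Ioc, abs_of_nonpos h]; congr 1; ring
      · intro t ht
        rw [abs_of_nonpos h] at hmn
        rw [abs_of_pos ht.1]; nlinarith [ht.2]
      · intro t ht t' ht' hiff
        have := hiff.2 (by nlinarith [ht.2, (abs_le.1 ht').2])
        linarith [ht.1]
  set A := {z | z ∈ Metric.ball (0 : E) r ∧ ⟪m, z⟫_ℝ ∈ I} with hA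
  have hAm : MeasurableSet A := measurableSet_slab r m hIm
  have hBm : MeasurableSet {z | z ∈ Metric.ball (0 : E) (r / 2) ∧ ⟪m, z⟫_ℝ = 0} :=
    measurableSet_slab (r / 2) m (measurableSet_singleton 0)
  have hsub : Metric.ball (0 : E) (r / 2) ⊆ Metric.ball 0 r :=
    Metric.ball_subset_ball (by linarith)
  have hstep1 : ∫⁻ x in {x | ε x = μ}, ENNReal.ofReal (φ x) ∂μHE[k] ≤ ENNReal.ofReal (1 + δ) ^ k *
      ∫⁻ y : (ℝ ∙ m)ᗮ, (Metric.ball (0 : E) (r / 2)).indicator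
      (fun z => ENNReal.ofReal (φ (Θ z))) (y : E) := by
    rw [← lintegral_hyperplane hk H.norm_m Metric.isOpen_ball.measurableSet hφΘ]
    refine le_trans ?_ (H.lintegral_image_le hδ (fun z hz => hsub hz.1) k hφm)
    refine setLIntegral_le_of_support hφm fun x hx hne => ?_
    have hxb : x ∈ Metric.ball p₀ ρ := hsupp (subset_tsupport _ fun h0 => hne (by simp [h0]))
    exact ⟨Ψ x, ⟨H.maps x hxb, (H.level_eq_iff x).1 hx⟩, H.left_inv x hxb⟩
  have hstep2 := le_slab (r := r) H.norm_m hIm (fun t ht => (hIs t ht).trans_lt hsr) hφΘ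
    (w := ENNReal.ofReal w) fun z hz z' hz' hd hzI => by
      refine hosc z' hz' z hz ?_
      rw [norm_sub_rev, hd]
      exact (hIs _ hzI).trans_lt hsη
  have hstep3 : ∫⁻ z in A, ENNReal.ofReal (φ (Θ z)) ≤ ENNReal.ofReal (1 + δ) ^ (k + 1) *
        ∫⁻ x in shiftDiff {x | ε x ≤ μ} (s • n), ENNReal.ofReal (φ x) := by
    have h := H.lintegral_le_image hδ (A := A) (fun z hz => hz.1) hAm (k + 1) hφm
    rw [← volume_eq_muHE hk] at h
    refine h.trans (mul_le_mul' le_rfl (setLIntegral_le_of_support hφm ?_))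
    rintro _ ⟨z, hz, rfl⟩ hne
    have hxb : Θ z ∈ Metric.ball p₀ ρ := hsupp (subset_tsupport _ fun h0 => hne (by simp [h0]))
    have hsh := H.abs_inner_shift_le hδ hxb hn hs0 hsρ
    rw [H.right_inv z hz.1] at hsh
    have := hIc _ hz.2 _ hsh
    change ¬(ε (Θ z) ≤ μ ↔ ε (Θ z + s • n) ≤ μ)
    rw [H.level_le_iff, H.level_le_iff, H.right_inv z hz.1]
    exact this
  rw [hIv] at hstep2
  calc _ ≤ ENNReal.ofReal (s * (|⟪m, n⟫_ℝ| - δ)) * (ENNReal.ofReal (1 + δ) ^ k *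
      ∫⁻ y : (ℝ ∙ m)ᗮ, (Metric.ball (0 : E) (r / 2)).indicator
      (fun z => ENNReal.ofReal (φ (Θ z))) (y : E)) := mul_le_mul' le_rfl hstep1
    _ = ENNReal.ofReal (1 + δ) ^ k * (ENNReal.ofReal (s * (|⟪m, n⟫_ℝ| - δ)) *
      ∫⁻ y : (ℝ ∙ m)ᗮ, (Metric.ball (0 : E) (r / 2)).indicator
      (fun z => ENNReal.ofReal (φ (Θ z))) (y : E)) := by ring
    _ ≤ _ := mul_le_mul' le_rfl (hstep2.trans (add_le_add hstep3 le_rfl))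

/-- The level set has finite area near the base point of a chart. -/
theorem area_lt_top (H : LevelChart ε μ p₀ m G δ Ψ Θ ρ r) {k : ℕ}
    (hk : Module.finrank ℝ E = k + 1) (hδ : 0 ≤ δ) :
    μHE[k] ({x | ε x = μ} ∩ Metric.ball p₀ ρ) < ⊤ := by
  set B := {z | z ∈ Metric.ball (0 : E) r ∧ ⟪m, z⟫_ℝ = 0} with hB
  have hsub : {x | ε x = μ} ∩ Metric.ball p₀ ρ ⊆ Θ '' B := by
    rintro x ⟨hx, hxb⟩
    exact ⟨Ψ x, ⟨Metric.ball_subset_ball (by linarith [H.r_pos]) (H.maps x hxb),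
      (H.level_eq_iff x).1 hx⟩, H.left_inv x hxb⟩
  have h1 := H.lintegral_image_le hδ (A := B) (fun z hz => hz.1) k (f := fun _ => 1)
    measurable_const
  have h2 := lintegral_hyperplane hk H.norm_m (A := Metric.ball (0 : E) r)
    Metric.isOpen_ball.measurableSet (f := fun _ => 1) measurable_const
  have e : ∀ y : (ℝ ∙ m)ᗮ, (Metric.ball (0 : E) r).indicator (fun _ => (1 : ENNReal)) (y : E) =
      (Metric.ball (0 : (ℝ ∙ m)ᗮ) r).indicator (fun _ => (1 : ENNReal)) y := fun y => by
    by_cases hy : y ∈ Metric.ball (0 : (ℝ ∙ m)ᗮ) r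
    · rw [indicator_of_mem hy, indicator_of_mem]
      rw [mem_ball_zero_iff] at hy ⊢; exact hy
    · rw [indicator_of_notMem hy, indicator_of_notMem]
      rw [mem_ball_zero_iff] at hy ⊢; exact hy
  simp only [e] at h2
  rw [lintegral_indicator_const Metric.isOpen_ball.measurableSet] at h2
  rw [h2, lintegral_const, Measure.restrict_apply_univ, one_mul, one_mul] at h1
  refine (measure_mono hsub).trans_lt (h1.trans_lt (ENNReal.mul_lt_top
    (ENNReal.pow_lt_top ENNReal.ofReal_lt_top) Metric.isBounded_ball.measure_lt_top))

/-- Thin shells around the level set have a volume proportional to their thickness. -/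
theorem shell_le (H : LevelChart ε μ p₀ m G δ Ψ Θ ρ r) {k : ℕ}
    (hk : Module.finrank ℝ E = k + 1) (hδ : 0 ≤ δ) :
    ∃ C : ℝ, 0 ≤ C ∧ ∀ t : ℝ, 0 ≤ t →
      volume ({x | |ε x - μ| ≤ t} ∩ Metric.ball p₀ ρ) ≤ ENNReal.ofReal (C * t) := by
  have hG := H.G_pos
  have hfin : (volume (Metric.ball (0 : (ℝ ∙ m)ᗮ) r)) ≠ ⊤ :=
    Metric.isBounded_ball.measure_lt_top.ne
  refine ⟨(1 + δ) ^ (k + 1) * (2 / G) * (volume (Metric.ball (0 : (ℝ ∙ m)ᗮ) r)).toReal,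
    by positivity, fun t ht => ?_⟩
  set I := Icc (-(t / G)) (t / G) with hI
  set A := {z | z ∈ Metric.ball (0 : E) r ∧ ⟪m, z⟫_ℝ ∈ I} with hA
  have hsub : {x | |ε x - μ| ≤ t} ∩ Metric.ball p₀ ρ ⊆ Θ '' A := by
    rintro x ⟨hx, hxb⟩
    refine ⟨Ψ x, ⟨Metric.ball_subset_ball (by linarith [H.r_pos]) (H.maps x hxb), ?_⟩,
      H.left_inv x hxb⟩
    have hx : |ε x - μ| ≤ t := hx
    rw [← H.level x, abs_mul, abs_of_pos hG, ← le_div_iff₀' hG, abs_le] at hx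
    exact hx
  have h1 := H.lintegral_image_le hδ (A := A) (fun z hz => hz.1) (k + 1) (f := fun _ => 1)
    measurable_const
  rw [← volume_eq_muHE hk, lintegral_const, Measure.restrict_apply_univ, one_mul] at h1
  have h2 : ∫⁻ z in A, (1 : ENNReal) ≤ volume I * volume (Metric.ball (0 : (ℝ ∙ m)ᗮ) r) := by
    have := slab_le (r := r) H.norm_m (I := I) measurableSet_Icc
      (f := fun _ => (1 : ENNReal)) (w := 0) measurable_const fun z _ z' _ _ _ => by simp
    refine this.trans ?_
    rw [zero_mul, add_zero]
    refine mul_le_mul' le_rfl ?_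
    rw [← lintegral_indicator_one Metric.isOpen_ball.measurableSet]
    refine lintegral_mono fun y => ?_
    by_cases hy : (y : E) ∈ Metric.ball (0 : E) r
    · rw [indicator_of_mem hy, indicator_of_mem, Pi.one_apply]
      rw [mem_ball_zero_iff] at hy ⊢; exact hy
    · rw [indicator_of_notMem hy]; exact zero_le
  calc _ ≤ _ := measure_mono hsub
    _ ≤ _ := h1
    _ ≤ ENNReal.ofReal (1 + δ) ^ (k + 1) * (ENNReal.ofReal (2 * (t / G)) *
        ENNReal.ofReal (volume (Metric.ball (0 : (ℝ ∙ m)ᗮ) r)).toReal) := by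
      rw [ENNReal.ofReal_toReal hfin]
      refine mul_le_mul' le_rfl (h2.trans_eq ?_)
      rw [hI, Real.volume_Icc]; congr 2; ring
    _ = _ := by
      rw [← ENNReal.ofReal_pow (by positivity), ← ENNReal.ofReal_mul (by positivity),
        ← ENNReal.ofReal_mul (by positivity)]
      congr 1; ring

end LevelChart

end Shift

/-! ### Global properties of a regular compact level set -/

section Surface

variable {E : Type*} [NormedAddCommGroup E] [InnerProductSpace ℝ E] [FiniteDimensional ℝ E]
  [MeasurableSpace E] [BorelSpace E] {ε : E → ℝ} {μ : ℝ}

/-- The exterior unit normal of a sublevel set of `ε`. -/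
noncomputable def unitGradient (ε : E → ℝ) (x : E) : E := ‖gradient ε x‖⁻¹ • gradient ε x

theorem measurable_unitGradient (hε : ContDiff ℝ ∞ ε) : Measurable (unitGradient ε) := by
  have := (continuous_gradient hε).measurable
  exact this.norm.inv.smul this

theorem isCompact_level (hε : Continuous ε) (hc : IsCompact {x | ε x ≤ μ}) :
    IsCompact {x | ε x = μ} :=
  hc.of_isClosed_subset (isClosed_eq hε continuous_const) fun x (hx : ε x = μ) => hx.le

theorem level_area_lt_top (hε : ContDiff ℝ ∞ ε) (hc : IsCompact {x | ε x ≤ μ})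
    (hreg : ∀ x, ε x = μ → gradient ε x ≠ 0) {k : ℕ} (hk : Module.finrank ℝ E = k + 1) :
    μHE[k] {x | ε x = μ} < ⊤ := by
  refine (isCompact_level hε.continuous hc).measure_lt_top_of_nhdsWithin fun p hp => ?_
  obtain ⟨Ψ, Θ, ρ, r, H⟩ := exists_levelChart hε hp (hreg p hp) zero_lt_one le_rfl
  exact ⟨_, inter_mem_nhdsWithin _ (Metric.ball_mem_nhds p H.rho_pos),
    H.area_lt_top hk zero_le_one⟩

/-- Each chart gives a linear bound near its base point, and compactness extends it to an open
neighbourhood U of the level set. -/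
theorem volume_shell_le (hε : ContDiff ℝ ∞ ε) (hc : ∀ c, IsCompact {x | ε x ≤ c})
    (hreg : ∀ x, ε x = μ → gradient ε x ≠ 0) {k : ℕ} (hk : Module.finrank ℝ E = k + 1) :
    ∃ C : ℝ, 0 ≤ C ∧ ∀ t : ℝ, 0 ≤ t → t ≤ 1 →
      volume {x | |ε x - μ| ≤ t} ≤ ENNReal.ofReal (C * t) := by
  have key : ∃ U : Set E, IsOpen U ∧ {x | ε x = μ} ⊆ U ∧ ∃ C : ℝ, 0 ≤ C ∧ ∀ t : ℝ, 0 ≤ t →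
      volume ({x | |ε x - μ| ≤ t} ∩ U) ≤ ENNReal.ofReal (C * t) := by
    refine (isCompact_level hε.continuous (hc μ)).induction_on (p := fun A => ∃ U : Set E,
      IsOpen U ∧ A ⊆ U ∧ ∃ C : ℝ, 0 ≤ C ∧ ∀ t : ℝ, 0 ≤ t →
      volume ({x | |ε x - μ| ≤ t} ∩ U) ≤ ENNReal.ofReal (C * t)) ?_ ?_ ?_ ?_
    · exact ⟨∅, isOpen_empty, le_rfl, 0, le_rfl, fun t _ => by simp⟩
    · rintro A B hAB ⟨U, hU, hBU, h⟩
      exact ⟨U, hU, hAB.trans hBU, h⟩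
    · rintro A B ⟨U, hU, hAU, C, hC, h⟩ ⟨U', hU', hBU, C', hC', h'⟩
      refine ⟨U ∪ U', hU.union hU', union_subset_union hAU hBU, C + C', by positivity,
        fun t ht => ?_⟩
      rw [inter_union_distrib_left, add_mul, ENNReal.ofReal_add (by positivity) (by positivity)]
      exact (measure_union_le _ _).trans (add_le_add (h t ht) (h' t ht))
    · intro p hp
      obtain ⟨Ψ, Θ, ρ, r, H⟩ := exists_levelChart hε hp (hreg p hp) zero_lt_one le_rfl
      exact ⟨_, mem_nhdsWithin_of_mem_nhds (Metric.ball_mem_nhds p H.rho_pos), _,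
        Metric.isOpen_ball, le_rfl, H.shell_le hk zero_le_one⟩
  obtain ⟨U, hU, hSU, C, hC, h⟩ := key
  -- Off U, but still in {ε ≤ μ + 1}, |ε - μ| is bounded below by compactness, so shells thinner
  -- than t₀ lie in U. Thicker ones are bounded by the total volume v ≤ (v/t₀)t.
  obtain ⟨t₀, ht₀, hsub⟩ : ∃ t₀ : ℝ, 0 < t₀ ∧ t₀ ≤ 1 ∧
      ∀ t, t < t₀ → {x | |ε x - μ| ≤ t} ⊆ U := by
    have hK : IsCompact ({x | ε x ≤ μ + 1} \ U) := (hc _).diff hU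
    rcases ({x | ε x ≤ μ + 1} \ U).eq_empty_or_nonempty with he | hne
    · refine ⟨1, one_pos, le_rfl, fun t ht x hx => ?_⟩
      by_contra hxU
      have : x ∈ {x | ε x ≤ μ + 1} \ U := ⟨by
        have := (abs_le.1 (show |ε x - μ| ≤ t from hx)).2
        change ε x ≤ μ + 1; linarith, hxU⟩
      rw [he] at this; exact this
    · obtain ⟨x₀, hx₀, hmin⟩ := hK.exists_isMinOn hne (f := fun x => |ε x - μ|)
        (by have := hε.continuous; fun_prop)
      have hpos : 0 < |ε x₀ - μ| := abs_pos.2 fun h0 => hx₀.2 (hSU (sub_eq_zero.1 h0))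
      refine ⟨min 1 |ε x₀ - μ|, lt_min one_pos hpos, min_le_left _ _, fun t ht x hx => ?_⟩
      by_contra hxU
      have hx : |ε x - μ| ≤ t := hx
      have : x ∈ {x | ε x ≤ μ + 1} \ U := ⟨by
        have := (abs_le.1 hx).2
        have := ht.trans_le (min_le_left _ _)
        change ε x ≤ μ + 1; linarith, hxU⟩
      have h1 : |ε x₀ - μ| ≤ |ε x - μ| := hmin this
      linarith [ht.trans_le (min_le_right _ _)]
  obtain ⟨ht₁, hsub⟩ := hsub
  have hfin : volume {x | ε x ≤ μ + 1} ≠ ⊤ := (hc _).measure_lt_top.ne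
  set v := (volume {x | ε x ≤ μ + 1}).toReal with hv
  refine ⟨C + v / t₀, by positivity, fun t ht ht1 => ?_⟩
  rcases lt_or_ge t t₀ with hlt | hge
  · have := h t ht
    rw [inter_eq_left.2 (hsub t hlt)] at this
    refine this.trans (ENNReal.ofReal_le_ofReal ?_)
    have : 0 ≤ v / t₀ := by positivity
    nlinarith
  · calc volume {x | |ε x - μ| ≤ t} ≤ volume {x | ε x ≤ μ + 1} := by
          refine measure_mono fun x hx => ?_
          have := (abs_le.1 (show |ε x - μ| ≤ t from hx)).2
          change ε x ≤ μ + 1; linarith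
      _ = ENNReal.ofReal v := (ENNReal.ofReal_toReal hfin).symm
      _ ≤ _ := by
        refine ENNReal.ofReal_le_ofReal ?_
        have h1 : v = v / t₀ * t₀ := by field_simp
        have h2 : 0 ≤ v / t₀ := by positivity
        nlinarith [mul_nonneg hC ht]

/-- By the intermediate value theorem the segment from x to x + h meets the level set. -/
theorem shiftDiff_subset_cthickening (hε : Continuous ε) {h : E} {η : ℝ} (hh : ‖h‖ ≤ η) :
    shiftDiff {x | ε x ≤ μ} h ⊆ Metric.cthickening η {x | ε x = μ} := by
  intro x hx
  have hcont : Continuous fun t : ℝ => ε (x + t • h) := by fun_prop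
  have hx : ¬(ε x ≤ μ ↔ ε (x + h) ≤ μ) := hx
  have hmem : μ ∈ uIcc (ε (x + (0 : ℝ) • h)) (ε (x + (1 : ℝ) • h)) := by
    rw [zero_smul, add_zero, one_smul, mem_uIcc]
    by_cases h0 : ε x ≤ μ
    · left; exact ⟨h0, le_of_not_ge fun h1 => hx ⟨fun _ => h1, fun _ => h0⟩⟩
    · right
      refine ⟨?_, (not_le.1 h0).le⟩
      by_contra h1
      exact hx ⟨fun h => absurd h h0, fun h => absurd h h1⟩
  obtain ⟨t, ht, he⟩ := intermediate_value_uIcc hcont.continuousOn hmem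
  rw [uIcc_of_le zero_le_one] at ht
  refine Metric.mem_cthickening_of_dist_le x (x + t • h) _ _ he ?_
  rw [dist_eq_norm, sub_add_cancel_left, norm_neg, norm_smul, Real.norm_of_nonneg ht.1]
  exact (mul_le_of_le_one_left (norm_nonneg _) ht.2).trans hh

theorem exists_finite_charts (hε : ContDiff ℝ ∞ ε) (hc : IsCompact {x | ε x ≤ μ})
    (hreg : ∀ x, ε x = μ → gradient ε x ≠ 0) {δ : ℝ} (hδ : 0 < δ) (hδ1 : δ ≤ 1) :
    ∃ (N : ℕ) (p m : Fin N → E) (G ρ r : Fin N → ℝ) (Ψ Θ : Fin N → E → E),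
      (∀ i, LevelChart ε μ (p i) (m i) (G i) δ (Ψ i) (Θ i) (ρ i) (r i)) ∧
      {x | ε x = μ} ⊆ ⋃ i, Metric.ball (p i) (ρ i) := by
  have hch := fun p : {x // ε x = μ} => exists_levelChart hε p.2 (hreg p p.2) hδ hδ1
  choose Ψ Θ ρ r H using hch
  obtain ⟨t, ht⟩ := (isCompact_level hε.continuous hc).elim_finite_subcover
    (fun p : {x // ε x = μ} => Metric.ball (p : E) (ρ p)) (fun _ => Metric.isOpen_ball)
    fun x hx => mem_iUnion.2 ⟨⟨x, hx⟩, Metric.mem_ball_self (H ⟨x, hx⟩).rho_pos⟩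
  let e := t.equivFin.symm
  refine ⟨t.card, fun i => (e i).1, fun i => _, fun i => _, fun i => ρ (e i).1,
    fun i => r (e i).1, fun i => Ψ (e i).1, fun i => Θ (e i).1, fun i => H (e i).1, ?_⟩
  intro x hx
  obtain ⟨p, hp, hxp⟩ := mem_iUnion₂.1 (ht hx)
  refine mem_iUnion.2 ⟨e.symm ⟨p, hp⟩, ?_⟩
  simpa using hxp

/-- The functions sum to 1 on a whole neighbourhood of the level set, not just on it, so that they
also resolve the symmetric differences of small shifts. -/
theorem exists_chart_partition (hε : ContDiff ℝ ∞ ε) (hc : IsCompact {x | ε x ≤ μ})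
    (hreg : ∀ x, ε x = μ → gradient ε x ≠ 0) {δ : ℝ} (hδ : 0 < δ) (hδ1 : δ ≤ 1) :
    ∃ (N : ℕ) (p m : Fin N → E) (G ρ r : Fin N → ℝ) (Ψ Θ : Fin N → E → E)
      (φ : Fin N → C(E, ℝ)) (η : ℝ),
      (∀ i, LevelChart ε μ (p i) (m i) (G i) δ (Ψ i) (Θ i) (ρ i) (r i)) ∧
      (∀ i, tsupport (φ i) ⊆ Metric.ball (p i) (ρ i)) ∧ (∀ i, HasCompactSupport (φ i)) ∧
      0 < η ∧ ∀ x ∈ Metric.cthickening η {x | ε x = μ}, ∑ i, ENNReal.ofReal (φ i x) = 1 := by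
  obtain ⟨N, p, m, G, ρ, r, Ψ, Θ, H, hcov⟩ := exists_finite_charts hε hc hreg hδ hδ1
  have hS := isCompact_level hε.continuous hc
  obtain ⟨η, hη, hsub⟩ := hS.exists_cthickening_subset_open
    (isOpen_iUnion fun i => Metric.isOpen_ball) hcov
  obtain ⟨φ, h1, h2, h3, h4⟩ := exists_continuous_sum_one_of_isOpen_isCompact
    (fun i => Metric.isOpen_ball) hS.cthickening hsub
  refine ⟨N, p, m, G, ρ, r, Ψ, Θ, φ, η, H, h1, h4, hη, fun x hx => ?_⟩
  rw [← ENNReal.ofReal_sum_of_nonneg fun i _ => (h3 i x).1]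
  have := h2 hx
  simp only [Finset.sum_apply, Pi.one_apply] at this
  simp [this]

end Surface

/-! ### First-order asymptotics of the shift volume -/

section Limit

variable {E : Type*} [NormedAddCommGroup E] [InnerProductSpace ℝ E] [FiniteDimensional ℝ E]
  [MeasurableSpace E] [BorelSpace E] {ε : E → ℝ} {μ : ℝ}

/-- The flux `∫ |m(x) · n| dσ(x)` through the level set `{ε = μ}` in the direction `n`. -/
noncomputable def flux (k : ℕ) (ε : E → ℝ) (μ : ℝ) (n : E) : ENNReal :=
  ∫⁻ x in {x | ε x = μ}, ENNReal.ofReal |⟪unitGradient ε x, n⟫_ℝ| ∂μHE[k]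

/-- The chart estimates are summed over the partition of unity. On the support of each partition
function the chart normal m i is within δ of the true normal, which turns |⟪m i, n⟫| times local
area into local flux with an error of order δ times area. -/
theorem shift_bounds (hε : ContDiff ℝ ∞ ε) (hc : IsCompact {x | ε x ≤ μ})
    (hreg : ∀ x, ε x = μ → gradient ε x ≠ 0) {k : ℕ} (hk : Module.finrank ℝ E = k + 1)
    {n : E} (hn : ‖n‖ ≤ 1) {δ : ℝ} (hδ : 0 < δ) (hδ1 : δ ≤ 1) :
    ∀ᶠ s : ℝ in 𝓝[>] 0,
      volume (shiftDiff {x | ε x ≤ μ} (s • n)) ≤ ENNReal.ofReal s *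
        (ENNReal.ofReal (1 + δ) ^ (k + 1) * (ENNReal.ofReal (1 + δ) ^ k * (flux k ε μ n + ENNReal.ofReal (3 * δ) *
          μHE[k] {x | ε x = μ}) + 3 * ENNReal.ofReal δ)) ∧
      ENNReal.ofReal s * flux k ε μ n ≤ ENNReal.ofReal (1 + δ) ^ k *
        (ENNReal.ofReal (1 + δ) ^ (k + 1) * volume (shiftDiff {x | ε x ≤ μ} (s • n)) + ENNReal.ofReal s * ENNReal.ofReal δ) +
        ENNReal.ofReal s * (ENNReal.ofReal (2 * δ) * μHE[k] {x | ε x = μ}) := by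
  obtain ⟨N, p, m, G, ρ, r, Ψ, Θ, φ, η, H, hsupp, hcs, hη, hsum⟩ :=
    exists_chart_partition hε hc hreg hδ hδ1
  set c := ENNReal.ofReal (1 + δ) with hcdef
  -- The oscillation terms of all charts together are to stay below δ. The summand 1 in both
  -- denominators covers an empty family of charts and a ball of volume 0.
  have hw : ∀ i, ∃ w : ℝ, 0 < w ∧ ENNReal.ofReal w * volume (Metric.ball (0 : (ℝ ∙ m i)ᗮ) (r i)) ≤
      ENNReal.ofReal (δ / (N + 1)) := fun i => by
    have hfin : volume (Metric.ball (0 : (ℝ ∙ m i)ᗮ) (r i)) ≠ ⊤ :=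
      Metric.isBounded_ball.measure_lt_top.ne
    set v := (volume (Metric.ball (0 : (ℝ ∙ m i)ᗮ) (r i))).toReal with hv
    have hv0 : 0 ≤ v := ENNReal.toReal_nonneg
    refine ⟨δ / (N + 1) / (v + 1), by positivity, ?_⟩
    rw [← ENNReal.ofReal_toReal hfin, ← hv, ← ENNReal.ofReal_mul (by positivity)]
    apply ENNReal.ofReal_le_ofReal
    rw [div_mul_eq_mul_div]
    apply div_le_of_le_mul₀ (by positivity) (by positivity)
    have : 0 ≤ δ / (N + 1) := by positivity
    nlinarith
  choose w hw0 hwle using hw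
  have hNδ : ∑ _i : Fin N, ENNReal.ofReal (δ / (N + 1)) ≤ ENNReal.ofReal δ := by
    rw [← ENNReal.ofReal_sum_of_nonneg fun i _ => by positivity]
    apply ENNReal.ofReal_le_ofReal
    rw [Finset.sum_const, Finset.card_univ, Fintype.card_fin, nsmul_eq_mul, mul_div_assoc']
    apply div_le_of_le_mul₀ (by positivity) hδ.le
    nlinarith
  set S := {x | ε x = μ} with hS
  have hSm : MeasurableSet S := (isClosed_eq hε.continuous continuous_const).measurableSet
  have hSsum : ∀ x ∈ S, ∑ i, ENNReal.ofReal (φ i x) = 1 := fun x hx =>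
    hsum x (Metric.self_subset_cthickening S hx)
  have hgm : Measurable fun x => ENNReal.ofReal |⟪unitGradient ε x, n⟫_ℝ| := by
    have := measurable_unitGradient hε
    have : Measurable fun x => ⟪unitGradient ε x, n⟫_ℝ := this.inner measurable_const
    exact (continuous_abs.measurable.comp this).ennreal_ofReal
  have hφm : ∀ i, Measurable fun x => ENNReal.ofReal (φ i x) := fun i =>
    (φ i).continuous.measurable.ennreal_ofReal
  have hpart : ∀ {ν : Measure E} {A : Set E} {f : E → ENNReal}, MeasurableSet A →
      (∀ x ∈ A, ∑ i, ENNReal.ofReal (φ i x) = 1) → Measurable f →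
      ∑ i, ∫⁻ x in A, f x * ENNReal.ofReal (φ i x) ∂ν = ∫⁻ x in A, f x ∂ν := by
    intro ν A f hA hs hf
    have hm : ∀ i ∈ Finset.univ, Measurable fun x => f x * ENNReal.ofReal (φ i x) :=
      fun i _ => hf.mul (hφm i)
    rw [← lintegral_finsetSum _ hm]
    refine setLIntegral_congr_fun hA fun x hx => ?_
    simp only [← Finset.mul_sum, hs x hx, mul_one]
  have hclose : ∀ i x, ENNReal.ofReal (φ i x) ≠ 0 →
      |⟪m i, n⟫_ℝ| ≤ |⟪unitGradient ε x, n⟫_ℝ| + δ ∧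
      |⟪unitGradient ε x, n⟫_ℝ| ≤ |⟪m i, n⟫_ℝ| + δ := by
    intro i x hx
    have hxb : x ∈ Metric.ball (p i) (ρ i) :=
      hsupp i (subset_tsupport _ fun h0 => hx (by simp [h0]))
    have h1 : |⟪unitGradient ε x - m i, n⟫_ℝ| ≤ δ :=
      (abs_real_inner_le_norm _ _).trans
        ((mul_le_of_le_one_right (norm_nonneg _) hn).trans ((H i).normal x hxb))
    rw [inner_sub_left] at h1
    have h2 := abs_sub_abs_le_abs_sub ⟪unitGradient ε x, n⟫_ℝ ⟪m i, n⟫_ℝ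
    have h3 := abs_sub_abs_le_abs_sub ⟪m i, n⟫_ℝ ⟪unitGradient ε x, n⟫_ℝ
    rw [abs_sub_comm] at h3
    constructor <;> linarith
  set I : Fin N → ENNReal := fun i => ∫⁻ x in S, ENNReal.ofReal (φ i x) ∂μHE[k] with hI
  set F : Fin N → ENNReal := fun i => ∫⁻ x in S, ENNReal.ofReal |⟪unitGradient ε x, n⟫_ℝ| *
    ENNReal.ofReal (φ i x) ∂μHE[k] with hF
  have hFsum : ∑ i, F i = flux k ε μ n := hpart hSm hSsum hgm
  have hIsum : ∑ i, I i = μHE[k] S := by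
    have := hpart (ν := μHE[k]) (f := fun _ => 1) hSm hSsum measurable_const
    simpa using this
  have hIF : ∀ i, ENNReal.ofReal (|⟪m i, n⟫_ℝ| + 2 * δ) * I i ≤
      F i + ENNReal.ofReal (3 * δ) * I i := fun i => by
    have hm : Measurable fun x => ENNReal.ofReal |⟪unitGradient ε x, n⟫_ℝ| *
      ENNReal.ofReal (φ i x) := hgm.mul (hφm i)
    simp only [hI, hF]
    rw [← lintegral_const_mul _ (hφm i), ← lintegral_const_mul _ (hφm i),
      ← lintegral_add_left hm]
    refine lintegral_mono fun x => ?_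
    by_cases h0 : ENNReal.ofReal (φ i x) = 0
    · simp [h0]
    · rw [← add_mul, ← ENNReal.ofReal_add (abs_nonneg _) (by positivity)]
      exact mul_le_mul' (ENNReal.ofReal_le_ofReal (by linarith [(hclose i x h0).1])) le_rfl
  have hFI : ∀ i, F i ≤ ENNReal.ofReal (|⟪m i, n⟫_ℝ| - δ) * I i + ENNReal.ofReal (2 * δ) * I i :=
    fun i => by
      simp only [hI, hF]
      rw [← add_mul, ← lintegral_const_mul _ (hφm i)]
      refine lintegral_mono fun x => ?_
      by_cases h0 : ENNReal.ofReal (φ i x) = 0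
      · simp [h0]
      · refine mul_le_mul' ?_ le_rfl
        refine (ENNReal.ofReal_le_ofReal ?_).trans ENNReal.ofReal_add_le
        linarith [(hclose i x h0).2]
  have hmn : ∀ i, |⟪m i, n⟫_ℝ| ≤ 1 := fun i => (abs_real_inner_le_norm _ n).trans (by
    rw [(H i).norm_m, one_mul]; exact hn)
  have hup : ∀ᶠ s : ℝ in 𝓝[>] 0, ∀ i, _ := eventually_all.2 fun i =>
    (H i).shift_le hk hδ.le hδ1 (φ i).continuous (hcs i) (hsupp i) hn (hw0 i)
  have hlo : ∀ᶠ s : ℝ in 𝓝[>] 0, ∀ i, _ := eventually_all.2 fun i =>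
    (H i).le_shift hk hδ.le hδ1 (φ i).continuous (hcs i) (hsupp i) hn (hw0 i)
  have hsη : ∀ᶠ s : ℝ in 𝓝[>] 0, s < η := (eventually_lt_nhds hη).filter_mono nhdsWithin_le_nhds
  filter_upwards [hup, hlo, hsη, self_mem_nhdsWithin] with s hup hlo hsη hs0
  have hs0 : 0 < s := hs0
  have hΓ : MeasurableSet {x | ε x ≤ μ} := hc.measurableSet
  have hD := measurableSet_shiftDiff hΓ (s • n)
  have hDsum : ∀ x ∈ shiftDiff {x | ε x ≤ μ} (s • n), ∑ i, ENNReal.ofReal (φ i x) = 1 :=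
    fun x hx => hsum x (shiftDiff_subset_cthickening hε.continuous (by
      rw [norm_smul, Real.norm_of_nonneg hs0.le]; nlinarith) hx)
  have hV : ∑ i, ∫⁻ x in shiftDiff {x | ε x ≤ μ} (s • n), ENNReal.ofReal (φ i x) =
      volume (shiftDiff {x | ε x ≤ μ} (s • n)) := by
    have := hpart (ν := volume) (f := fun _ => 1) hD hDsum measurable_const
    simpa using this
  have hsmul : ∀ a : ℝ, ENNReal.ofReal (s * a) = ENNReal.ofReal s * ENNReal.ofReal a := fun a =>
    ENNReal.ofReal_mul hs0.le
  constructor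
  · calc volume (shiftDiff {x | ε x ≤ μ} (s • n))
        = ∑ i, ∫⁻ x in shiftDiff {x | ε x ≤ μ} (s • n), ENNReal.ofReal (φ i x) := hV.symm
      _ ≤ ∑ i, ENNReal.ofReal s * (c ^ (k + 1) * (c ^ k * (F i + ENNReal.ofReal (3 * δ) * I i) +
          3 * ENNReal.ofReal (δ / (N + 1)))) := by
        refine Finset.sum_le_sum fun i _ => (hup i).trans ?_
        rw [hsmul, mul_assoc]
        refine mul_le_mul' le_rfl ?_
        calc _ = c ^ (k + 1) * (c ^ k * (ENNReal.ofReal (|⟪m i, n⟫_ℝ| + 2 * δ) * I i) +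
            ENNReal.ofReal (|⟪m i, n⟫_ℝ| + 2 * δ) * (ENNReal.ofReal (w i) *
              volume (Metric.ball (0 : (ℝ ∙ m i)ᗮ) (r i)))) := by ring
          _ ≤ _ := by
            refine mul_le_mul' le_rfl (add_le_add (mul_le_mul' le_rfl (hIF i))
              (mul_le_mul' ?_ (hwle i)))
            rw [show (3 : ENNReal) = ENNReal.ofReal 3 by norm_num]
            exact ENNReal.ofReal_le_ofReal (by linarith [hmn i])
      _ = ENNReal.ofReal s * (c ^ (k + 1) * (c ^ k *
          (∑ i, F i + ENNReal.ofReal (3 * δ) * ∑ i, I i) + 3 * ∑ _i : Fin N, ENNReal.ofReal (δ / (N + 1)))) := by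
        simp only [← Finset.mul_sum, Finset.sum_add_distrib]
      _ ≤ _ := by
        rw [hFsum, hIsum]
        gcongr
  · calc ENNReal.ofReal s * flux k ε μ n = ∑ i, ENNReal.ofReal s * F i := by
          rw [← hFsum, Finset.mul_sum]
      _ ≤ ∑ i, (c ^ k * (c ^ (k + 1) * (∫⁻ x in shiftDiff {x | ε x ≤ μ} (s • n),
            ENNReal.ofReal (φ i x)) + ENNReal.ofReal s * ENNReal.ofReal (δ / (N + 1))) +
          ENNReal.ofReal s * (ENNReal.ofReal (2 * δ) * I i)) := by
        refine Finset.sum_le_sum fun i _ => ?_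
        refine (mul_le_mul' le_rfl (hFI i)).trans ?_
        rw [mul_add, ← mul_assoc, ← hsmul]
        refine add_le_add ((hlo i).trans ?_) le_rfl
        refine mul_le_mul' le_rfl (add_le_add le_rfl (mul_le_mul' ?_ (hwle i)))
        exact ENNReal.ofReal_le_ofReal (by nlinarith [hmn i])
      _ = c ^ k * (c ^ (k + 1) * (∑ i, ∫⁻ x in shiftDiff {x | ε x ≤ μ} (s • n),
            ENNReal.ofReal (φ i x)) + ENNReal.ofReal s * ∑ _i : Fin N, ENNReal.ofReal (δ / (N + 1)))
          + ENNReal.ofReal s * (ENNReal.ofReal (2 * δ) * ∑ i, I i) := by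
        simp only [← Finset.mul_sum, Finset.sum_add_distrib]
      _ ≤ _ := by
        rw [hV, hIsum]
        gcongr

theorem flux_le_area {k : ℕ} {n : E} (hn : ‖n‖ ≤ 1) : flux k ε μ n ≤ μHE[k] {x | ε x = μ} := by
  have h : flux k ε μ n ≤ ∫⁻ x in {x | ε x = μ}, 1 ∂μHE[k] := by
    refine lintegral_mono fun x => ?_
    rw [← ENNReal.ofReal_one]
    refine ENNReal.ofReal_le_ofReal ((abs_real_inner_le_norm _ _).trans ?_)
    have : ‖unitGradient ε x‖ ≤ 1 := by
      rw [unitGradient, norm_smul, norm_inv, norm_norm]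
      exact inv_mul_le_one
    exact mul_le_one₀ this (norm_nonneg _) hn
  simpa using h

theorem flux_lt_top (hε : ContDiff ℝ ∞ ε) (hc : IsCompact {x | ε x ≤ μ})
    (hreg : ∀ x, ε x = μ → gradient ε x ≠ 0) {k : ℕ} (hk : Module.finrank ℝ E = k + 1)
    {n : E} (hn : ‖n‖ ≤ 1) : flux k ε μ n < ⊤ :=
  (flux_le_area hn).trans_lt (level_area_lt_top hε hc hreg hk)

theorem shiftDiff_volume_lt_top {Γ : Set E} (hΓ : IsCompact Γ) (h : E) :
    volume (shiftDiff Γ h) < ⊤ := by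
  have h1 : IsCompact ((fun x => x + h) ⁻¹' Γ) := by
    have := (Homeomorph.addRight h).isCompact_preimage (s := Γ)
    exact this.2 hΓ
  refine (measure_mono ?_).trans_lt (hΓ.union h1).measure_lt_top
  intro x hx
  by_contra hc
  simp only [mem_union, mem_preimage, not_or] at hc
  exact hx ⟨fun h => absurd h hc.1, fun h => absurd h hc.2⟩

/-- The volume of the symmetric difference of a sublevel set and its shifts. -/
noncomputable def shiftVolume (ε : E → ℝ) (μ : ℝ) (h : E) : ℝ :=
  (volume (shiftDiff {x | ε x ≤ μ} h)).toReal

/-- The upper and lower bounds of `shift_bounds` both tend to the flux as δ → 0. This gives the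
limit for each n without a rate; `exists_shiftVolume_rate` supplies one. -/
theorem tendsto_shiftVolume_div (hε : ContDiff ℝ ∞ ε) (hc : IsCompact {x | ε x ≤ μ})
    (hreg : ∀ x, ε x = μ → gradient ε x ≠ 0) {k : ℕ} (hk : Module.finrank ℝ E = k + 1)
    {n : E} (hn : ‖n‖ ≤ 1) :
    Tendsto (fun s : ℝ => shiftVolume ε μ (s • n) / s) (𝓝[>] 0) (𝓝 (flux k ε μ n).toReal) := by
  have hJ := (flux_lt_top hε hc hreg hk hn).ne
  have hσ := (level_area_lt_top hε hc hreg hk).ne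
  set J := (flux k ε μ n).toReal with hJdef
  set σ := (μHE[k] {x | ε x = μ}).toReal with hσdef
  have hJ0 : 0 ≤ J := ENNReal.toReal_nonneg
  have hσ0 : 0 ≤ σ := ENNReal.toReal_nonneg
  have key : ∀ δ : ℝ, 0 < δ → δ ≤ 1 → ∀ᶠ s : ℝ in 𝓝[>] 0,
      shiftVolume ε μ (s • n) / s ≤
        (1 + δ) ^ (k + 1) * ((1 + δ) ^ k * (J + 3 * δ * σ) + 3 * δ) ∧
      (J - (1 + δ) ^ k * δ - 2 * δ * σ) / ((1 + δ) ^ k * (1 + δ) ^ (k + 1)) ≤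
        shiftVolume ε μ (s • n) / s := by
    intro δ hδ hδ1
    filter_upwards [shift_bounds hε hc hreg hk hn hδ hδ1, self_mem_nhdsWithin] with s hs hs0
    have hs0 : 0 < s := hs0
    have hV := (shiftDiff_volume_lt_top hc (s • n)).ne
    have e : volume (shiftDiff {x | ε x ≤ μ} (s • n)) =
        ENNReal.ofReal (shiftVolume ε μ (s • n)) := (ENNReal.ofReal_toReal hV).symm
    have hv0 : 0 ≤ shiftVolume ε μ (s • n) := ENNReal.toReal_nonneg
    rw [e, ← ENNReal.ofReal_toReal hJ, ← ENNReal.ofReal_toReal hσ, ← hJdef, ← hσdef,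
      show (3 : ENNReal) = ENNReal.ofReal 3 by norm_num] at hs
    constructor
    · rw [div_le_iff₀ hs0]
      have h := hs.1
      rw [← ENNReal.ofReal_pow (by positivity), ← ENNReal.ofReal_pow (by positivity),
        ← ENNReal.ofReal_mul (by positivity), ← ENNReal.ofReal_add (by positivity) (by positivity),
        ← ENNReal.ofReal_mul (by positivity), ← ENNReal.ofReal_mul (by positivity),
        ← ENNReal.ofReal_add (by positivity) (by positivity),
        ← ENNReal.ofReal_mul (by positivity), ← ENNReal.ofReal_mul (by positivity),
        ENNReal.ofReal_le_ofReal_iff (by positivity)] at h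
      linarith
    · rw [div_le_div_iff₀ (by positivity) hs0]
      have h := hs.2
      rw [← ENNReal.ofReal_pow (by positivity), ← ENNReal.ofReal_pow (by positivity),
        ← ENNReal.ofReal_mul (by positivity), ← ENNReal.ofReal_mul (by positivity),
        ← ENNReal.ofReal_mul (by positivity), ← ENNReal.ofReal_mul (by positivity),
        ← ENNReal.ofReal_mul (by positivity),
        ← ENNReal.ofReal_add (by positivity) (by positivity),
        ← ENNReal.ofReal_mul (by positivity),
        ← ENNReal.ofReal_add (by positivity) (by positivity),
        ENNReal.ofReal_le_ofReal_iff (by positivity)] at h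
      linarith
  have hδs : ∀ {P : ℝ → Prop}, (∀ᶠ δ : ℝ in 𝓝[>] 0, P δ) → ∃ δ, 0 < δ ∧ δ ≤ 1 ∧ P δ := by
    intro P hP
    have h1 : ∀ᶠ δ : ℝ in 𝓝[>] 0, δ < 1 :=
      (eventually_lt_nhds one_pos).filter_mono nhdsWithin_le_nhds
    obtain ⟨δ, h1, h2, h3⟩ := (hP.and (h1.and self_mem_nhdsWithin)).exists
    exact ⟨δ, h3, h2.le, h1⟩
  refine tendsto_order.2 ⟨fun a ha => ?_, fun a ha => ?_⟩
  · have ht : Tendsto (fun δ : ℝ => (J - (1 + δ) ^ k * δ - 2 * δ * σ) /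
        ((1 + δ) ^ k * (1 + δ) ^ (k + 1))) (𝓝[>] 0) (𝓝 J) := by
      have : ContinuousAt (fun δ : ℝ => (J - (1 + δ) ^ k * δ - 2 * δ * σ) /
        ((1 + δ) ^ k * (1 + δ) ^ (k + 1))) 0 := by
        apply ContinuousAt.div (by fun_prop) (by fun_prop) (by norm_num)
      have h := this.tendsto
      simp only [add_zero, one_pow, mul_zero, zero_mul, sub_zero, mul_one, div_one] at h
      exact h.mono_left nhdsWithin_le_nhds
    obtain ⟨δ, h0, h1, h2⟩ := hδs (ht.eventually (eventually_gt_nhds ha))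
    filter_upwards [key δ h0 h1] with s hs
    exact h2.trans_le hs.2
  · have ht : Tendsto (fun δ : ℝ => (1 + δ) ^ (k + 1) * ((1 + δ) ^ k * (J + 3 * δ * σ) + 3 * δ))
        (𝓝[>] 0) (𝓝 J) := by
      have : Continuous fun δ : ℝ =>
          (1 + δ) ^ (k + 1) * ((1 + δ) ^ k * (J + 3 * δ * σ) + 3 * δ) := by fun_prop
      have h := this.tendsto 0
      simp only [add_zero, one_pow, mul_zero, zero_mul, one_mul] at h
      exact h.mono_left nhdsWithin_le_nhds
    obtain ⟨δ, h0, h1, h2⟩ := hδs (ht.eventually (eventually_lt_nhds ha))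
    filter_upwards [key δ h0 h1] with s hs
    exact hs.1.trans_lt h2

end Limit

/-! ### Uniform rate of convergence by doubling -/

section Rate

variable {E : Type*} [NormedAddCommGroup E] [InnerProductSpace ℝ E] [FiniteDimensional ℝ E]
  [MeasurableSpace E] [BorelSpace E] {ε : E → ℝ} {μ : ℝ}

/-- The mean value inequality is applied to y ↦ ε(y + h) - ε(y) on the segment from x to x + h. Its
derivative is O(‖h‖), because the derivative of ε is Lipschitz on the ball. -/
theorem exists_second_difference_le (hε : ContDiff ℝ ∞ ε) (R : ℝ) :
    ∃ M : ℝ, 0 ≤ M ∧ ∀ x h : E, ‖x‖ ≤ R → ‖x + h‖ ≤ R → ‖x + h + h‖ ≤ R →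
      |ε x + ε (x + h + h) - 2 * ε (x + h)| ≤ M * ‖h‖ ^ 2 := by
  have h1 : ContDiff ℝ ∞ (fderiv ℝ ε) := hε.fderiv_right (by simp)
  have h2 : Continuous fun x => ‖fderiv ℝ (fderiv ℝ ε) x‖ := (h1.continuous_fderiv (by simp)).norm
  obtain ⟨M, hM⟩ := (isCompact_closedBall (0 : E) R).bddAbove_image h2.continuousOn
  have hconv : Convex ℝ (Metric.closedBall (0 : E) R) := convex_closedBall 0 R
  have hlip : ∀ x ∈ Metric.closedBall (0 : E) R, ∀ y ∈ Metric.closedBall (0 : E) R,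
      ‖fderiv ℝ ε y - fderiv ℝ ε x‖ ≤ max M 0 * ‖y - x‖ := fun x hx y hy =>
    hconv.norm_image_sub_le_of_norm_fderiv_le
      (fun z _ => (h1.differentiable (by simp)).differentiableAt)
      (fun z hz => (hM (mem_image_of_mem _ hz)).trans (le_max_left _ _)) hx hy
  refine ⟨max M 0, le_max_right _ _, fun x h hx hy hz => ?_⟩
  have hd : Differentiable ℝ ε := hε.differentiable (by simp)
  have hx' : x ∈ Metric.closedBall (0 : E) R := by simpa using hx
  have hy' : x + h ∈ Metric.closedBall (0 : E) R := by simpa using hy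
  have hz' : x + h + h ∈ Metric.closedBall (0 : E) R := by simpa using hz
  have hg : ∀ z ∈ segment ℝ x (x + h), HasFDerivWithinAt (fun y => ε (y + h) - ε y)
      (fderiv ℝ ε (z + h) - fderiv ℝ ε z) (segment ℝ x (x + h)) z := fun z _ => by
    have e1 : HasFDerivAt (fun y => ε (y + h)) (fderiv ℝ ε (z + h)) z := by
      have := (hd (z + h)).hasFDerivAt
      exact (hasFDerivAt_comp_add_right h).2 this
    exact (e1.sub (hd z).hasFDerivAt).hasFDerivWithinAt
  have hb : ∀ z ∈ segment ℝ x (x + h), ‖fderiv ℝ ε (z + h) - fderiv ℝ ε z‖ ≤ max M 0 * ‖h‖ := by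
    intro z hzs
    have hz1 := hconv.segment_subset hx' hy' hzs
    have hz2 : z + h ∈ Metric.closedBall (0 : E) R := by
      refine hconv.segment_subset hy' hz' ?_
      have := mem_segment_translate ℝ h (x := z) (b := x) (c := x + h)
      rw [add_comm h, add_comm h, add_comm h] at this
      exact this.2 hzs
    have := hlip z hz1 (z + h) hz2
    rwa [add_sub_cancel_left] at this
  have := (convex_segment x (x + h)).norm_image_sub_le_of_norm_hasFDerivWithin_le hg hb
    (left_mem_segment ℝ x (x + h)) (right_mem_segment ℝ x (x + h))
  rw [add_sub_cancel_left, Real.norm_eq_abs] at this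
  calc |ε x + ε (x + h + h) - 2 * ε (x + h)| = |ε (x + h + h) - ε (x + h) - (ε (x + h) - ε x)| := by
        congr 1; ring
    _ ≤ _ := this
    _ = _ := by ring

theorem volume_preimage_add (s : Set E) (h : E) : volume {x | x + h ∈ s} = volume s :=
  measure_preimage_add_right volume h s

theorem shiftVolume_double_le (hc : IsCompact {x | ε x ≤ μ}) (h : E) :
    shiftVolume ε μ (h + h) ≤ 2 * shiftVolume ε μ h := by
  have hf := (shiftDiff_volume_lt_top hc h).ne
  have : volume (shiftDiff {x | ε x ≤ μ} (h + h)) ≤ volume (shiftDiff {x | ε x ≤ μ} h) +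
      volume (shiftDiff {x | ε x ≤ μ} h) := by
    nth_rw 3 [← volume_preimage_add _ h]
    refine (measure_mono fun x hx => ?_).trans (measure_union_le _ _)
    simp only [shiftDiff, mem_ofPred_eq, mem_union, ← add_assoc] at hx ⊢
    tauto
  have h2 := ENNReal.toReal_mono (by finiteness) this
  rw [ENNReal.toReal_add hf hf] at h2
  unfold shiftVolume; linarith

/-- Let D be the symmetric difference for h and D' its translate. Inclusion–exclusion writes 2V(h)
as the volume of D ∪ D' plus that of D ∩ D'. A point of D ∩ D', or of D ∪ D' outside the symmetric
difference for 2h, has x and x + 2h on one side of the level and x + h on the other. The second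
difference then dominates 2|ε(x+h) - μ|, so x + h lies in the shell. -/
theorem shiftVolume_le_double (hc : IsCompact {x | ε x ≤ μ}) {h : E} {t : ℝ}
    (hsh : volume {x | |ε x - μ| ≤ t} ≠ ⊤)
    (ht : ∀ x, (x ∈ {x | ε x ≤ μ} ∨ x + h ∈ {x | ε x ≤ μ} ∨ x + h + h ∈ {x | ε x ≤ μ}) →
      |ε x + ε (x + h + h) - 2 * ε (x + h)| ≤ 2 * t) :
    2 * shiftVolume ε μ h ≤
      shiftVolume ε μ (h + h) + 2 * (volume {x | |ε x - μ| ≤ t}).toReal := by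
  have hm : MeasurableSet {x | ε x ≤ μ} := hc.measurableSet
  set Γ := {x | ε x ≤ μ} with hΓ
  set D := shiftDiff Γ h
  set D' := {x | x + h ∈ D}
  set X := {x | x + h ∈ {x | |ε x - μ| ≤ t}}
  have hf := (shiftDiff_volume_lt_top hc h).ne
  have hf2 := (shiftDiff_volume_lt_top hc (h + h)).ne
  have hDm : MeasurableSet D := measurableSet_shiftDiff hm h
  have hDm' : MeasurableSet D' := (measurable_add_const h) hDm
  have hD' : volume D' = volume D := volume_preimage_add _ h
  have hX : volume X = volume {x | |ε x - μ| ≤ t} := volume_preimage_add _ h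
  have h1 : D ∪ D' ⊆ shiftDiff Γ (h + h) ∪ X := by
    intro x hx
    by_contra hcon
    simp only [D, D', X, hΓ, shiftDiff, mem_ofPred_eq, mem_union, ← add_assoc, not_or, not_not,
      not_le] at hx hcon ht
    have hx1 : ¬(ε x ≤ μ ↔ ε (x + h) ≤ μ) := by tauto
    have hh : ε x ≤ μ ∨ ε (x + h) ≤ μ ∨ ε (x + h + h) ≤ μ := by tauto
    have h3 := abs_le.1 (ht x hh)
    by_cases hxμ : ε x ≤ μ
    · have hx2 := hcon.1.1 hxμ
      have hx3 : μ < ε (x + h) := by by_contra h4; exact hx1 ⟨fun _ => not_lt.1 h4, fun _ => hxμ⟩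
      have := hcon.2
      rw [abs_of_pos (by linarith)] at this
      linarith [h3.1]
    · have hx2 : μ < ε (x + h + h) := by by_contra h4; exact hxμ (hcon.1.2 (not_lt.1 h4))
      have hx3 : ε (x + h) ≤ μ := by
        by_contra h4; exact hx1 ⟨fun h5 => absurd h5 hxμ, fun h5 => absurd h5 h4⟩
      have := hcon.2
      rw [abs_of_nonpos (by linarith)] at this
      linarith [h3.2]
  have h2 : D ∩ D' ⊆ X := by
    intro x hx
    by_contra hcon
    simp only [D, D', X, hΓ, shiftDiff, mem_ofPred_eq, mem_inter_iff, not_le] at hx hcon ht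
    obtain ⟨hx1, hx2⟩ := hx
    have hh : ε x ≤ μ ∨ ε (x + h) ≤ μ ∨ ε (x + h + h) ≤ μ := by tauto
    have h3 := abs_le.1 (ht x hh)
    by_cases hxμ : ε (x + h) ≤ μ
    · have hx3 : μ < ε (x + h + h) := by
        by_contra h4; exact hx2 ⟨fun _ => not_lt.1 h4, fun _ => hxμ⟩
      have hx4 : μ < ε x := by by_contra h4; exact hx1 ⟨fun _ => hxμ, fun _ => not_lt.1 h4⟩
      rw [abs_of_nonpos (by linarith)] at hcon
      linarith [h3.2]
    · have hx3 : ε (x + h + h) ≤ μ := by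
        by_contra h4; exact hx2 ⟨fun h5 => absurd h5 hxμ, fun h5 => absurd h5 h4⟩
      have hx4 : ε x ≤ μ := by
        by_contra h4; exact hx1 ⟨fun h5 => absurd h5 h4, fun h5 => absurd h5 hxμ⟩
      rw [abs_of_pos (by linarith)] at hcon
      linarith [h3.1]
  have h3 : volume D + volume D ≤ volume (shiftDiff Γ (h + h)) +
      (volume {x | |ε x - μ| ≤ t} + volume {x | |ε x - μ| ≤ t}) := by
    calc volume D + volume D = volume (D ∪ D') + volume (D ∩ D') := by
          rw [measure_union_add_inter D hDm', hD']
      _ ≤ (volume (shiftDiff Γ (h + h)) + volume X) + volume X :=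
        add_le_add ((measure_mono h1).trans (measure_union_le _ _)) (measure_mono h2)
      _ = _ := by rw [hX, add_assoc]
  have h4 := ENNReal.toReal_mono (by finiteness) h3
  rw [ENNReal.toReal_add hf hf, ENNReal.toReal_add hf2 (by finiteness),
    ENNReal.toReal_add hsh hsh] at h4
  unfold shiftVolume; linarith

/-- Telescoping over the scales s/2^m, where the errors form a geometric series with sum Cs. It
turns a doubling estimate and a bare limit into a rate. -/
theorem abs_sub_le_of_dyadic {q : ℝ → ℝ} {J C s₀ : ℝ}
    (hq : ∀ s, 0 < s → s ≤ s₀ → |q (s + s) - q s| ≤ C * s)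
    (hlim : Tendsto q (𝓝[>] 0) (𝓝 J)) {s : ℝ} (hs : 0 < s) (hs₀ : s ≤ s₀) :
    |q s - J| ≤ C * s := by
  have hC : 0 ≤ C := by
    have := (abs_nonneg _).trans (hq s hs hs₀)
    exact nonneg_of_mul_nonneg_left this hs
  have hm : ∀ m : ℕ, |q s - q (s / 2 ^ m)| ≤ C * s * (1 - 1 / 2 ^ m) := by
    intro m
    induction m with
    | zero => simp
    | succ m ih =>
      have hp : (0 : ℝ) < 2 ^ (m + 1) := by positivity
      have h1 := hq (s / 2 ^ (m + 1)) (by positivity)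
        ((div_le_self hs.le (one_le_pow₀ one_le_two)).trans hs₀)
      rw [show s / 2 ^ (m + 1) + s / 2 ^ (m + 1) = s / 2 ^ m by
        rw [pow_succ]; field_simp; norm_num] at h1
      calc |q s - q (s / 2 ^ (m + 1))|
          ≤ |q s - q (s / 2 ^ m)| + |q (s / 2 ^ m) - q (s / 2 ^ (m + 1))| :=
            abs_sub_le _ _ _
        _ ≤ C * s * (1 - 1 / 2 ^ m) + C * (s / 2 ^ (m + 1)) := add_le_add ih h1
        _ = _ := by rw [pow_succ]; field_simp; ring
  have ht : Tendsto (fun m : ℕ => s / 2 ^ m) atTop (𝓝[>] 0) := by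
    refine tendsto_nhdsWithin_iff.2 ⟨?_, Eventually.of_forall fun m => ?_⟩
    · have := (tendsto_pow_atTop_nhds_zero_of_lt_one (r := (1 / 2 : ℝ)) (by norm_num)
        (by norm_num)).const_mul s
      simpa [div_eq_mul_inv] using this
    · have : 0 < s / 2 ^ m := by positivity
      exact this
  have h2 : Tendsto (fun m : ℕ => |q s - q (s / 2 ^ m)|) atTop (𝓝 |q s - J|) :=
    (tendsto_const_nhds.sub (hlim.comp ht)).abs
  refine le_of_tendsto' h2 fun m => (hm m).trans ?_
  have h3 : (0 : ℝ) ≤ 1 / 2 ^ m := by positivity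
  nlinarith [mul_nonneg hC hs.le]

theorem shiftVolume_le (hc : IsCompact {x | ε x ≤ μ}) (h : E) :
    shiftVolume ε μ h ≤ 2 * (volume {x | ε x ≤ μ}).toReal := by
  have h1 : shiftDiff {x | ε x ≤ μ} h ⊆ {x | ε x ≤ μ} ∪ {x | x + h ∈ {x | ε x ≤ μ}} := by
    intro x hx
    by_contra hc
    simp only [mem_union, not_or] at hc
    exact hx ⟨fun h => absurd h hc.1, fun h => absurd h hc.2⟩
  have h2 := (measure_mono h1).trans (measure_union_le (μ := volume) _ _)
  rw [volume_preimage_add] at h2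
  have hf := hc.measure_lt_top.ne (a := volume {x | ε x ≤ μ})
  have h4 := ENNReal.toReal_mono (by finiteness) h2
  rw [ENNReal.toReal_add hf hf] at h4
  unfold shiftVolume; linarith

theorem flux_toReal_le (hε : ContDiff ℝ ∞ ε) (hc : IsCompact {x | ε x ≤ μ})
    (hreg : ∀ x, ε x = μ → gradient ε x ≠ 0) {k : ℕ} (hk : Module.finrank ℝ E = k + 1)
    {n : E} (hn : ‖n‖ ≤ 1) : (flux k ε μ n).toReal ≤ (μHE[k] {x | ε x = μ}).toReal :=
  ENNReal.toReal_mono (level_area_lt_top hε hc hreg hk).ne (flux_le_area hn)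

/-- With q(s) = V(sn)/s, doubling costs at most the volume of the shell of energy width Ms² divided
by s, which is O(s). None of the constants depends on n, although the limit was taken for each n
separately. -/
theorem exists_shiftVolume_rate (hε : ContDiff ℝ ∞ ε) (hc : ∀ c, IsCompact {x | ε x ≤ c})
    (hreg : ∀ x, ε x = μ → gradient ε x ≠ 0) {k : ℕ} (hk : Module.finrank ℝ E = k + 1) :
    ∃ C : ℝ, 0 ≤ C ∧ ∀ n : E, ‖n‖ ≤ 1 → ∀ s : ℝ, 0 < s → s ≤ 1 →
      |shiftVolume ε μ (s • n) - s * (flux k ε μ n).toReal| ≤ C * s ^ 2 := by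
  obtain ⟨C, hC, hsh⟩ := volume_shell_le hε hc hreg hk
  obtain ⟨R, hR⟩ := (hc μ).isBounded.exists_norm_le
  obtain ⟨M, hM, hdiff⟩ := exists_second_difference_le hε (R + 2)
  set v := (volume {x | ε x ≤ μ}).toReal with hv
  set σ := (μHE[k] {x | ε x = μ}).toReal with hσ
  have hv0 : 0 ≤ v := ENNReal.toReal_nonneg
  have hσ0 : 0 ≤ σ := ENNReal.toReal_nonneg
  -- For s ≤ s₀ one has Ms² ≤ 1, the range of the shell bound. For larger s the trivial bounds 2v
  -- and σ are absorbed into a multiple of s².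
  set s₀ : ℝ := 1 / (M + 1) with hs₀
  have hs₀0 : 0 < s₀ := by positivity
  have hs₀1 : s₀ ≤ 1 := by rw [hs₀]; apply div_le_one_of_le₀ <;> linarith
  refine ⟨C * M + (2 * v + σ) / s₀ ^ 2, by positivity, fun n hn s hs hs1 => ?_⟩
  set J := (flux k ε μ n).toReal with hJ
  have hJ0 : 0 ≤ J := ENNReal.toReal_nonneg
  rcases le_or_gt s s₀ with hle | hgt
  · have hq : ∀ s, 0 < s → s ≤ s₀ → |shiftVolume ε μ ((s + s) • n) / (s + s) -
        shiftVolume ε μ (s • n) / s| ≤ (C * M) * s := by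
      intro s hs hss
      have hMs : M * s ^ 2 ≤ 1 := by
        have h1 : (M + 1) * s ≤ 1 := by
          have := mul_le_mul_of_nonneg_left hss (show 0 ≤ M + 1 by linarith)
          rwa [hs₀, mul_one_div_cancel (by positivity)] at this
        nlinarith [mul_nonneg hM hs.le]
      have hsn : ‖s • n‖ ≤ s := by
        rw [norm_smul, Real.norm_of_nonneg hs.le]; nlinarith
      have h1 := hsh (M * s ^ 2) (by positivity) hMs
      have h2 := shiftVolume_le_double (hc μ) (h := s • n) (t := M * s ^ 2)
        (h1.trans_lt ENNReal.ofReal_lt_top).ne (fun x hx => by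
          have hb : ‖x‖ ≤ R + 2 ∧ ‖x + s • n‖ ≤ R + 2 ∧ ‖x + s • n + s • n‖ ≤ R + 2 := by
            have a1 := norm_add_le x (s • n)
            have a2 := norm_add_le (x + s • n) (s • n)
            have a3 := norm_sub_le (x + s • n) (s • n)
            have a4 := norm_sub_le (x + s • n + s • n) (s • n)
            rw [add_sub_cancel_right] at a3 a4
            rcases hx with h | h | h <;> have := hR _ h <;> refine ⟨?_, ?_, ?_⟩ <;> linarith
          refine (hdiff x (s • n) hb.1 hb.2.1 hb.2.2).trans ?_
          have : ‖s • n‖ ^ 2 ≤ s ^ 2 := by gcongr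
          nlinarith [mul_le_mul_of_nonneg_left this hM, mul_nonneg hM (sq_nonneg s)])
      have h3 := shiftVolume_double_le (hc μ) (s • n)
      have h4 := ENNReal.toReal_mono ENNReal.ofReal_ne_top h1
      rw [ENNReal.toReal_ofReal (by positivity)] at h4
      rw [add_smul, show shiftVolume ε μ (s • n + s • n) / (s + s) - shiftVolume ε μ (s • n) / s =
        (shiftVolume ε μ (s • n + s • n) - 2 * shiftVolume ε μ (s • n)) / (2 * s) by
          field_simp; ring,
        abs_div, abs_of_pos (by positivity : 0 < 2 * s), div_le_iff₀ (by positivity), abs_le]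
      constructor
      · nlinarith
      · have : 0 ≤ C * M * s * (2 * s) := by positivity
        linarith
    have h := abs_sub_le_of_dyadic (q := fun s => shiftVolume ε μ (s • n) / s) hq
      (tendsto_shiftVolume_div hε (hc μ) hreg hk hn) hs hle
    have e : shiftVolume ε μ (s • n) - s * J = s * (shiftVolume ε μ (s • n) / s - J) := by
      field_simp
    rw [e, abs_mul, abs_of_pos hs]
    have h5 := mul_le_mul_of_nonneg_left h hs.le
    have h6 : 0 ≤ (2 * v + σ) / s₀ ^ 2 * s ^ 2 := by positivity
    nlinarith
  · have h1 := shiftVolume_le (hc μ) (s • n)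
    have h2 : J ≤ σ := flux_toReal_le hε (hc μ) hreg hk hn
    have h0 : 0 ≤ shiftVolume ε μ (s • n) := ENNReal.toReal_nonneg
    have h3 : 2 * v + σ ≤ (2 * v + σ) / s₀ ^ 2 * s ^ 2 := by
      rw [div_mul_eq_mul_div, le_div_iff₀ (by positivity)]
      gcongr
    have h4 : 0 ≤ C * M * s ^ 2 := by positivity
    rw [abs_le]
    constructor <;> nlinarith [mul_le_mul hs1 h2 hJ0 zero_le_one, mul_nonneg hs.le hJ0]

end Rate

/-! ### Integrals of exponential weights concentrated at the Fermi surface -/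

section Weight

variable {E : Type*} [NormedAddCommGroup E] [InnerProductSpace ℝ E] [FiniteDimensional ℝ E]
  [MeasurableSpace E] [BorelSpace E] {ε : E → ℝ} {μ : ℝ}

/-- Growth of at least power type, and at most polynomial growth of the gradient. -/
structure HasGrowth (ε : E → ℝ) (c γ D : ℝ) (N : ℕ) : Prop where
  nonneg : ∀ x, 0 ≤ ε x
  smooth : ContDiff ℝ ∞ ε
  coeff_pos : 0 < c
  exponent_pos : 0 < γ
  const_nonneg : 0 ≤ D
  lower : ∀ x, c * ‖x‖ ^ γ ≤ ε x + D
  deriv : ∀ x, ‖fderiv ℝ ε x‖ ≤ D * (1 + ‖x‖) ^ N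

theorem IsDispersion.exists_hasGrowth {d : ℕ} {α : ℝ} {ε : EuclideanSpace ℝ (Fin d) → ℝ}
    (h : IsDispersion α ε) : ∃ c γ D N, HasGrowth ε c γ D N := by
  obtain ⟨p₀, c₁, c₂, c₃, γ₁, γ₂, γ₃, hp₀, hc₁, hc₂, hc₃, hγ₁, hγ₂, hγ₃, -, hg⟩ := h.growth
  have hcont := h.smooth.continuous_fderiv (by simp)
  obtain ⟨M, hM⟩ := (isCompact_closedBall (0 : EuclideanSpace ℝ (Fin d)) p₀).bddAbove_image
    hcont.norm.continuousOn
  have hq : 0 ≤ c₁ * p₀ ^ γ₁ := by positivity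
  have hD : 0 ≤ max M 0 + c₃ + c₁ * p₀ ^ γ₁ := by positivity
  refine ⟨c₁, γ₁, max M 0 + c₃ + c₁ * p₀ ^ γ₁, ⌈γ₃⌉₊, h.nonneg, h.smooth, hc₁, hγ₁, hD,
    fun x => ?_, fun x => ?_⟩
  · rcases lt_or_ge p₀ ‖x‖ with hx | hx
    · linarith [(hg x hx).1]
    · have h1 : ‖x‖ ^ γ₁ ≤ p₀ ^ γ₁ := Real.rpow_le_rpow (norm_nonneg _) hx hγ₁.le
      have h2 := mul_le_mul_of_nonneg_left h1 hc₁.le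
      linarith [h.nonneg x, le_max_right M 0]
  · have h1 : 1 ≤ (1 + ‖x‖) ^ ⌈γ₃⌉₊ := one_le_pow₀ (by linarith [norm_nonneg x])
    rcases lt_or_ge p₀ ‖x‖ with hx | hx
    · have h2 := (hg x hx).2.2 1 (Nat.le_add_left 1 _)
      rw [norm_iteratedFDeriv_one] at h2
      have h3 : ‖x‖ ^ γ₃ ≤ (1 + ‖x‖) ^ ⌈γ₃⌉₊ := by
        rw [← Real.rpow_natCast]
        exact (Real.rpow_le_rpow (norm_nonneg _) (by linarith) hγ₃.le).trans
          (Real.rpow_le_rpow_of_exponent_le (by linarith [norm_nonneg x]) (Nat.le_ceil _))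
      refine h2.trans ((mul_le_mul_of_nonneg_left h3 hc₃.le).trans ?_)
      refine mul_le_mul_of_nonneg_right ?_ (by linarith)
      linarith [le_max_right M 0]
    · have h2 : ‖fderiv ℝ ε x‖ ≤ M := hM (mem_image_of_mem _ (by simpa using hx))
      calc ‖fderiv ℝ ε x‖ ≤ max M 0 + c₃ + c₁ * p₀ ^ γ₁ := by linarith [le_max_left M 0]
        _ ≤ _ := le_mul_of_one_le_right hD h1

/-- For y ≥ 1 an integer m ≥ K/γ gives y^K ≤ (y^γ)^m, and u^m/m! ≤ e^u bounds the rest. -/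
theorem one_add_pow_mul_exp_neg_le {b γ : ℝ} (hb : 0 < b) (hγ : 0 < γ) (K : ℕ) :
    ∃ A : ℝ, 0 ≤ A ∧ ∀ y : ℝ, 0 ≤ y → (1 + y) ^ K * Real.exp (-(b * y ^ γ)) ≤ A := by
  obtain ⟨m, hm⟩ := exists_nat_ge ((K : ℝ) / γ)
  refine ⟨2 ^ K + 2 ^ K * (m.factorial / b ^ m), by positivity, fun y hy => ?_⟩
  have hyγ : 0 ≤ y ^ γ := Real.rpow_nonneg hy _
  rcases le_total y 1 with h1 | h1
  · have e1 : (1 + y) ^ K ≤ 2 ^ K := pow_le_pow_left₀ (by linarith) (by linarith) _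
    have e2 : Real.exp (-(b * y ^ γ)) ≤ 1 := Real.exp_le_one_iff.2 (by nlinarith)
    have e3 := mul_le_mul e1 e2 (Real.exp_pos _).le (by positivity)
    have : (0 : ℝ) ≤ 2 ^ K * (m.factorial / b ^ m) := by positivity
    linarith
  · have e1 : (1 + y) ^ K ≤ 2 ^ K * y ^ K := by
      rw [← mul_pow]; exact pow_le_pow_left₀ (by linarith) (by linarith) _
    have e2 : y ^ K ≤ (y ^ γ) ^ m := by
      rw [← Real.rpow_natCast, ← Real.rpow_natCast, ← Real.rpow_mul hy]
      refine Real.rpow_le_rpow_of_exponent_le h1 ?_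
      rw [div_le_iff₀ hγ] at hm
      linarith
    have e3 := Real.pow_div_factorial_le_exp (b * y ^ γ) (by positivity) m
    rw [Real.exp_neg]
    have e4 : (y ^ γ) ^ m * (Real.exp (b * y ^ γ))⁻¹ ≤ m.factorial / b ^ m := by
      rw [← div_eq_mul_inv, div_le_div_iff₀ (Real.exp_pos _) (by positivity)]
      rw [div_le_iff₀ (by positivity), mul_pow] at e3
      linarith
    calc (1 + y) ^ K * (Real.exp (b * y ^ γ))⁻¹
        ≤ (2 ^ K * (y ^ γ) ^ m) * (Real.exp (b * y ^ γ))⁻¹ := by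
          refine mul_le_mul_of_nonneg_right (e1.trans ?_) (by positivity)
          exact mul_le_mul_of_nonneg_left e2 (by positivity)
      _ = 2 ^ K * ((y ^ γ) ^ m * (Real.exp (b * y ^ γ))⁻¹) := by ring
      _ ≤ 2 ^ K * (m.factorial / b ^ m) := mul_le_mul_of_nonneg_left e4 (by positivity)
      _ ≤ _ := le_add_of_nonneg_left (by positivity)

theorem HasGrowth.isCompact_sublevel {c γ D : ℝ} {N : ℕ} (H : HasGrowth ε c γ D N) (a : ℝ) :
    IsCompact {x | ε x ≤ a} := by
  refine Metric.isCompact_of_isClosed_isBounded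
    (isClosed_le H.smooth.continuous continuous_const) ?_
  have hc := H.coeff_pos
  have hγ := H.exponent_pos
  rw [isBounded_iff_forall_norm_le]
  refine ⟨(max ((a + D) / c) 0) ^ γ⁻¹, fun x hx => ?_⟩
  have hx : ε x ≤ a := hx
  have h1 : ‖x‖ ^ γ ≤ max ((a + D) / c) 0 := by
    refine le_trans ?_ (le_max_left _ _)
    rw [le_div_iff₀ hc]
    linarith [H.lower x]
  have h2 := Real.rpow_le_rpow (by positivity) h1 (inv_nonneg.2 hγ.le)
  rwa [Real.rpow_rpow_inv (norm_nonneg _) hγ.ne'] at h2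

/-- The integral of `exp (-β |ε - μ|)` with a polynomial weight. -/
noncomputable def weight (ε : E → ℝ) (μ : ℝ) (N : ℕ) (β : ℝ) : ENNReal :=
  ∫⁻ x, ENNReal.ofReal ((1 + ‖x‖) ^ N * Real.exp (-(β * |ε x - μ|)))

/-- The growth of ε makes the exponential decay faster than any power, so dim E + 1 further powers
of 1 + ‖x‖ can be split off as an integrable factor. -/
theorem HasGrowth.weight_lt_top {c γ D : ℝ} {N₀ : ℕ} (H : HasGrowth ε c γ D N₀) (N : ℕ) {β : ℝ}
    (hβ : 0 < β) : weight ε μ N β < ⊤ := by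
  have hc := H.coeff_pos
  set d := Module.finrank ℝ E
  obtain ⟨A, hA, hle⟩ := one_add_pow_mul_exp_neg_le (mul_pos hβ hc) H.exponent_pos (N + (d + 1))
  have hint : Integrable (fun x : E => (1 + ‖x‖) ^ (-((d + 1 : ℕ) : ℝ))) :=
    integrable_one_add_norm (by push_cast; linarith)
  have hint2 := hint.const_mul (Real.exp (β * (D + |μ|)) * A)
  refine lt_of_le_of_lt (lintegral_mono fun x => ENNReal.ofReal_le_ofReal ?_)
    hint2.lintegral_lt_top
  have h1 : 0 < 1 + ‖x‖ := by positivity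
  rw [Real.rpow_neg h1.le, Real.rpow_natCast, ← div_eq_mul_inv, le_div_iff₀ (by positivity)]
  have h2 : -(β * |ε x - μ|) ≤ β * (D + |μ|) + -(β * c * ‖x‖ ^ γ) := by
    have e1 := H.lower x
    have e2 : ε x ≤ |ε x - μ| + |μ| := by
      linarith [le_abs_self (ε x - μ), le_abs_self μ]
    nlinarith [mul_le_mul_of_nonneg_left (e1.trans (add_le_add_left e2 D)) hβ.le]
  calc (1 + ‖x‖) ^ N * Real.exp (-(β * |ε x - μ|)) * (1 + ‖x‖) ^ (d + 1)
      = (1 + ‖x‖) ^ (N + (d + 1)) * Real.exp (-(β * |ε x - μ|)) := by ring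
    _ ≤ (1 + ‖x‖) ^ (N + (d + 1)) *
        (Real.exp (β * (D + |μ|)) * Real.exp (-(β * c * ‖x‖ ^ γ))) := by
      rw [← Real.exp_add]
      exact mul_le_mul_of_nonneg_left (Real.exp_le_exp.2 h2) (by positivity)
    _ = Real.exp (β * (D + |μ|)) *
        ((1 + ‖x‖) ^ (N + (d + 1)) * Real.exp (-(β * c * ‖x‖ ^ γ))) := by ring
    _ ≤ _ := mul_le_mul_of_nonneg_left (hle _ (norm_nonneg _)) (Real.exp_pos _).le

/-- Exponential smallness of the weight outside the spectrum. -/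
theorem HasGrowth.weight_le_of_neg {c γ D : ℝ} {N₀ : ℕ} (H : HasGrowth ε c γ D N₀) (hμ : μ < 0)
    (N : ℕ) {β β₀ : ℝ} (hβ : β₀ ≤ β) :
    weight ε μ N β ≤ ENNReal.ofReal (Real.exp (-((β - β₀) * |μ|))) * weight ε μ N β₀ := by
  rw [weight, weight, ← lintegral_const_mul' _ _ ENNReal.ofReal_ne_top]
  refine lintegral_mono fun x => ?_
  rw [← ENNReal.ofReal_mul (Real.exp_pos _).le]
  refine ENNReal.ofReal_le_ofReal ?_
  rw [mul_left_comm, ← Real.exp_add]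
  refine mul_le_mul_of_nonneg_left (Real.exp_le_exp.2 ?_) (by positivity)
  have h1 : |μ| ≤ |ε x - μ| := by
    rw [abs_of_neg hμ, abs_of_pos (by linarith [H.nonneg x])]; linarith [H.nonneg x]
  nlinarith

/-- Layer cake: e^(-βa) is the integral of βe^(-βt) over t > a, and Tonelli leaves the integral of
βe^(-βt) Ct over t > 0, which is C/β. -/
theorem lintegral_exp_neg_mul_le {X : Type*} [MeasurableSpace X] {ν : Measure X} [SFinite ν]
    {y : X → ℝ} (hy : Measurable y) (hy0 : ∀ x, 0 ≤ y x) {C : ℝ} (hC : 0 ≤ C)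
    (h : ∀ t, 0 ≤ t → ν {x | y x ≤ t} ≤ ENNReal.ofReal (C * t)) {β : ℝ} (hβ : 0 < β) :
    ∫⁻ x, ENNReal.ofReal (Real.exp (-(β * y x))) ∂ν ≤ ENNReal.ofReal (C / β) := by
  have hrep : ∀ a : ℝ, ENNReal.ofReal (Real.exp (-(β * a))) =
      ∫⁻ t in Ioi a, ENNReal.ofReal (β * Real.exp (-β * t)) := by
    intro a
    have hi := (integrableOn_exp_mul_Ioi (neg_lt_zero.2 hβ) a).const_mul β
    rw [← ofReal_integral_eq_lintegral_ofReal hi (Eventually.of_forall fun t => by positivity),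
      integral_const_mul, integral_exp_mul_Ioi (neg_lt_zero.2 hβ)]
    congr 1
    field_simp
  have hgm : Measurable fun t : ℝ => ENNReal.ofReal (β * Real.exp (-β * t)) := by fun_prop
  calc ∫⁻ x, ENNReal.ofReal (Real.exp (-(β * y x))) ∂ν
      = ∫⁻ x, (∫⁻ t, (Ioi (y x)).indicator
          (fun t => ENNReal.ofReal (β * Real.exp (-β * t))) t) ∂ν := by
        refine lintegral_congr fun x => ?_
        rw [hrep, lintegral_indicator measurableSet_Ioi]
    _ = ∫⁻ t, (∫⁻ x, (Ioi (y x)).indicator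
          (fun t => ENNReal.ofReal (β * Real.exp (-β * t))) t ∂ν) := by
        refine lintegral_lintegral_swap (Measurable.aemeasurable ?_)
        have : MeasurableSet {z : X × ℝ | y z.1 < z.2} :=
          measurableSet_lt (hy.comp measurable_fst) measurable_snd
        exact (hgm.comp measurable_snd).indicator this
    _ ≤ ∫⁻ t in Ioi (0 : ℝ), ENNReal.ofReal (β * Real.exp (-β * t)) * ENNReal.ofReal (C * t) := by
        rw [← lintegral_indicator measurableSet_Ioi]
        refine lintegral_mono fun t => ?_
        by_cases ht : 0 < t
        · rw [indicator_of_mem (mem_Ioi.2 ht)]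
          calc ∫⁻ x, (Ioi (y x)).indicator (fun t => ENNReal.ofReal (β * Real.exp (-β * t))) t ∂ν
              ≤ ∫⁻ x, {x | y x ≤ t}.indicator
                  (fun _ => ENNReal.ofReal (β * Real.exp (-β * t))) x ∂ν := by
                refine lintegral_mono fun x => ?_
                by_cases hx : y x < t
                · rw [indicator_of_mem (mem_Ioi.2 hx),
                    indicator_of_mem (show x ∈ {x | y x ≤ t} from hx.le)]
                · rw [indicator_of_notMem (by simpa using hx)]; exact zero_le
            _ = ENNReal.ofReal (β * Real.exp (-β * t)) * ν {x | y x ≤ t} :=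
                lintegral_indicator_const (measurableSet_le hy measurable_const) _
            _ ≤ _ := mul_le_mul' le_rfl (h t ht.le)
        · rw [indicator_of_notMem (by simpa using ht)]
          refine le_of_eq ?_
          rw [lintegral_eq_zero_of_ae_eq_zero (Eventually.of_forall fun x => ?_)]
          exact indicator_of_notMem (by have := hy0 x; simp; linarith) _
    _ = ∫⁻ t in Ioi (0 : ℝ),
          ENNReal.ofReal (C * β * (t ^ ((2 : ℝ) - 1) * Real.exp (-(β * t)))) := by
        refine setLIntegral_congr_fun measurableSet_Ioi fun t ht => ?_
        have ht : 0 < t := ht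
        rw [← ENNReal.ofReal_mul (by positivity), show (2 : ℝ) - 1 = 1 by norm_num, Real.rpow_one,
          neg_mul]
        congr 1; ring
    _ = ENNReal.ofReal (C / β) := by
        have hv := Real.integral_rpow_mul_exp_neg_mul_Ioi (a := 2) (by norm_num) hβ
        have hi : IntegrableOn (fun t : ℝ => t ^ ((2 : ℝ) - 1) * Real.exp (-(β * t))) (Ioi 0) := by
          -- The Bochner integral of a non-integrable function is 0, whereas the known value is
          -- positive.
          by_contra hn
          have h0 := integral_undef hn
          rw [hv] at h0
          have : 0 < (1 / β) ^ (2 : ℝ) * Real.Gamma 2 := by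
            have := Real.Gamma_pos_of_pos (s := 2) (by norm_num)
            positivity
          linarith
        rw [← ofReal_integral_eq_lintegral_ofReal (hi.const_mul (C * β))
          ((ae_restrict_mem measurableSet_Ioi).mono fun t (ht : 0 < t) => by positivity),
          integral_const_mul, hv, Real.Gamma_two]
        congr 1
        rw [Real.rpow_two]
        field_simp

/-- For a regular Fermi surface the weight is inversely proportional to `β`. -/
theorem HasGrowth.exists_weight_le {c γ D : ℝ} {N₀ : ℕ} (H : HasGrowth ε c γ D N₀)
    (hreg : ∀ x, ε x = μ → gradient ε x ≠ 0) {k : ℕ} (hk : Module.finrank ℝ E = k + 1)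
    (N : ℕ) {β₀ : ℝ} (hβ₀ : 0 < β₀) :
    ∃ C : ℝ, 0 ≤ C ∧ ∀ β, β₀ ≤ β → weight ε μ N β ≤ ENNReal.ofReal (C / β) := by
  obtain ⟨C₁, hC₁, hsh⟩ := volume_shell_le H.smooth H.isCompact_sublevel hreg hk
  obtain ⟨R, hR⟩ := (H.isCompact_sublevel (μ + 1)).isBounded.exists_norm_le
  have hW := (H.weight_lt_top (μ := μ) N (half_pos hβ₀)).ne
  set w := (weight ε μ N (β₀ / 2)).toReal with hw
  have hw0 : 0 ≤ w := ENNReal.toReal_nonneg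
  set K := (1 + max R 0) ^ N with hK
  have hK0 : 0 ≤ K := by positivity
  have hεc := H.smooth.continuous
  have hm : Measurable fun x => |ε x - μ| := by fun_prop
  set A := {x | |ε x - μ| ≤ 1} with hA
  have hAm : MeasurableSet A := measurableSet_le hm measurable_const
  refine ⟨K * C₁ + 2 * w, by positivity, fun β hβ => ?_⟩
  have hβ0 : 0 < β := hβ₀.trans_le hβ
  have hnear : ∫⁻ x in A, ENNReal.ofReal ((1 + ‖x‖) ^ N * Real.exp (-(β * |ε x - μ|))) ≤
      ENNReal.ofReal (K * C₁ / β) := by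
    have h1 := lintegral_exp_neg_mul_le (ν := volume.restrict A) hm (fun x => abs_nonneg _) hC₁
      (fun t ht => by
        rw [Measure.restrict_apply (measurableSet_le hm measurable_const)]
        rcases le_total t 1 with h | h
        · exact (measure_mono inter_subset_left).trans (hsh t ht h)
        · refine (measure_mono inter_subset_right).trans ((hsh 1 zero_le_one le_rfl).trans ?_)
          exact ENNReal.ofReal_le_ofReal (mul_le_mul_of_nonneg_left h hC₁)) hβ0
    calc _ ≤ ∫⁻ x in A, ENNReal.ofReal K * ENNReal.ofReal (Real.exp (-(β * |ε x - μ|))) := by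
          refine setLIntegral_mono' hAm fun x hx => ?_
          rw [← ENNReal.ofReal_mul hK0]
          refine ENNReal.ofReal_le_ofReal (mul_le_mul_of_nonneg_right ?_ (Real.exp_pos _).le)
          have : ‖x‖ ≤ R := hR x (by
            have := (abs_le.1 (show |ε x - μ| ≤ 1 from hx)).2
            change ε x ≤ μ + 1; linarith)
          exact pow_le_pow_left₀ (by positivity) (by linarith [le_max_left R 0]) _
      _ = ENNReal.ofReal K * ∫⁻ x in A, ENNReal.ofReal (Real.exp (-(β * |ε x - μ|))) :=
          lintegral_const_mul' _ _ ENNReal.ofReal_ne_top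
      _ ≤ ENNReal.ofReal K * ENNReal.ofReal (C₁ / β) := mul_le_mul' le_rfl h1
      _ = _ := by rw [← ENNReal.ofReal_mul hK0, mul_div_assoc]
  -- Where |ε - μ| > 1, half of the exponent supplies exp(-β/2) ≤ 2/β and the other half dominates
  -- the fixed weight at β₀/2.
  have hfar : ∫⁻ x in Aᶜ, ENNReal.ofReal ((1 + ‖x‖) ^ N * Real.exp (-(β * |ε x - μ|))) ≤
      ENNReal.ofReal (2 * w / β) := by
    calc _ ≤ ∫⁻ x in Aᶜ, ENNReal.ofReal (2 / β) *
          ENNReal.ofReal ((1 + ‖x‖) ^ N * Real.exp (-(β₀ / 2 * |ε x - μ|))) := by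
          refine setLIntegral_mono' hAm.compl fun x hx => ?_
          rw [← ENNReal.ofReal_mul (by positivity)]
          refine ENNReal.ofReal_le_ofReal ?_
          rw [mul_left_comm]
          refine mul_le_mul_of_nonneg_left ?_ (by positivity)
          have hx : 1 < |ε x - μ| := not_le.1 hx
          have h1 : Real.exp (-(β / 2)) ≤ 2 / β := by
            rw [Real.exp_neg, show 2 / β = (β / 2)⁻¹ by field_simp]
            exact inv_anti₀ (by positivity) (by linarith [Real.add_one_le_exp (β / 2)])
          calc Real.exp (-(β * |ε x - μ|))
              ≤ Real.exp (-(β / 2) + -(β₀ / 2 * |ε x - μ|)) := Real.exp_le_exp.2 (by nlinarith)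
            _ = Real.exp (-(β / 2)) * Real.exp (-(β₀ / 2 * |ε x - μ|)) := Real.exp_add _ _
            _ ≤ _ := mul_le_mul_of_nonneg_right h1 (Real.exp_pos _).le
      _ = ENNReal.ofReal (2 / β) * ∫⁻ x in Aᶜ,
          ENNReal.ofReal ((1 + ‖x‖) ^ N * Real.exp (-(β₀ / 2 * |ε x - μ|))) :=
          lintegral_const_mul' _ _ ENNReal.ofReal_ne_top
      _ ≤ ENNReal.ofReal (2 / β) * ENNReal.ofReal w := by
          rw [hw, ENNReal.ofReal_toReal hW]
          exact mul_le_mul' le_rfl (setLIntegral_le_lintegral _ _)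
      _ = _ := by rw [← ENNReal.ofReal_mul (by positivity), div_mul_eq_mul_div]
  rw [weight, ← lintegral_add_compl _ hAm, add_div,
    ENNReal.ofReal_add (by positivity) (by positivity)]
  exact add_le_add hnear hfar

end Weight

/-! ### Momentum integrals of U_α at a fixed shift -/

section Pair

variable {E : Type*} [NormedAddCommGroup E] [InnerProductSpace ℝ E] [FiniteDimensional ℝ E]
  [MeasurableSpace E] [BorelSpace E] {ε : E → ℝ} {μ : ℝ} {α κ C : ℝ}

/-- The Fermi occupation numbers of the momenta. -/
noncomputable def occ (ε : E → ℝ) (μ T : ℝ) (x : E) : ℝ := fermi T (ε x - μ)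

/-- The function `U_α` at the occupation numbers of two momenta. -/
noncomputable def pairU (α : ℝ) (ε : E → ℝ) (μ T : ℝ) (x h : E) : ℝ :=
  kernelU α (occ ε μ T x) (occ ε μ T (x + h))

theorem occ_mem (T : ℝ) (x : E) : occ ε μ T x ∈ Icc (0 : ℝ) 1 := fermi_mem _ _

theorem occ_eq (T : ℝ) (x : E) : occ ε μ T x = fermi 1 ((ε x - μ) / T) := fermi_eq _ _

theorem continuous_occ (hε : Continuous ε) (T : ℝ) : Continuous (occ ε μ T) := by
  unfold occ fermi
  exact Continuous.inv₀ (by fun_prop) fun x => by positivity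

theorem measurable_pairU (hε : Continuous ε) (Hα : IsEntropyLike (renyi α) κ C) (T : ℝ) :
    Measurable fun z : E × E => pairU α ε μ T z.1 z.2 := by
  have h := (continuous_occ (μ := μ) hε T).measurable
  have h1 : Measurable fun z : E × E => occ ε μ T z.1 := h.comp measurable_fst
  have h2 : Measurable fun z : E × E => occ ε μ T (z.1 + z.2) :=
    h.comp (measurable_fst.add measurable_snd)
  have h3 := (measurable_kernelU Hα.measurable).comp (h1.prodMk h2)
  exact h3

theorem measurable_pairU_left (hε : Continuous ε) (Hα : IsEntropyLike (renyi α) κ C) (T : ℝ)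
    (h : E) : Measurable fun x => pairU α ε μ T x h := by
  have h1 : Measurable fun x : E => (x, h) := measurable_id.prodMk measurable_const
  have h2 := (measurable_pairU (μ := μ) hε Hα T).comp h1
  exact h2

theorem lintegral_comp_add (f : E → ENNReal) (h : E) : ∫⁻ x, f (x + h) = ∫⁻ x, f x :=
  lintegral_add_right_eq_self f h

/-- Let a(θ) be the reduced energy along the segment from x to x + h. In the bound on U_α the
weighted length becomes an integral of exp(-κ|a|)|a'|, and the plain length is a mean value bound.
Each contributes a factor D(‖h‖/T)(1 + ‖·‖)^N. Since ‖h‖ ≤ 1, the second can be evaluated at the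
same θ at the cost of 2^N. -/
theorem HasGrowth.abs_pairU_le {c γ D : ℝ} {N : ℕ} (H : HasGrowth ε c γ D N) {A T : ℝ}
    (hA : 0 ≤ A) (hU : ∀ a b : ℝ, |kernelU α (fermi 1 a) (fermi 1 b)| ≤
      A * |b - a| * |∫ c in a..b, Real.exp (-(κ * |c|))|) (hT : 0 < T) (x : E) {h : E}
    (hh : ‖h‖ ≤ 1) :
    |pairU α ε μ T x h| ≤ ∫ θ in (0 : ℝ)..1, A * D ^ 2 * 2 ^ N * (‖h‖ / T) ^ 2 *
      ((1 + ‖x + θ • h‖) ^ (2 * N) * Real.exp (-(κ / T * |ε (x + θ • h) - μ|))) := by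
  have hD := H.const_nonneg
  have hd : Differentiable ℝ ε := H.smooth.differentiable (by simp)
  have hεc := H.smooth.continuous
  have hfc := H.smooth.continuous_fderiv (by simp)
  set a : ℝ → ℝ := fun θ => (ε (x + θ • h) - μ) / T with ha
  set a' : ℝ → ℝ := fun θ => fderiv ℝ ε (x + θ • h) h / T with ha'
  have hder : ∀ θ, HasDerivAt a (a' θ) θ := fun θ => by
    have h1 : HasDerivAt (fun θ : ℝ => x + θ • h) h θ := by
      simpa using ((hasDerivAt_id θ).smul_const h).const_add x
    have h2 := (hd (x + θ • h)).hasFDerivAt.comp_hasDerivAt θ h1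
    exact (h2.sub_const μ).div_const T
  have hac : Continuous a' := by
    have h1 : Continuous fun θ : ℝ => fderiv ℝ ε (x + θ • h) := hfc.comp (by fun_prop)
    exact (h1.clm_apply continuous_const).div_const T
  have hab : ∀ θ, |a' θ| ≤ D * (‖h‖ / T) * (1 + ‖x + θ • h‖) ^ N := fun θ => by
    rw [ha', abs_div, abs_of_pos hT, div_le_iff₀ hT]
    have h1 := (fderiv ℝ ε (x + θ • h)).le_opNorm h
    rw [Real.norm_eq_abs] at h1
    refine h1.trans ((mul_le_mul_of_nonneg_right (H.deriv _) (norm_nonneg h)).trans_eq ?_)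
    field_simp
  have hsub := intervalIntegral.integral_comp_mul_deriv (a := 0) (b := 1) (f := a) (f' := a')
    (g := fun c => Real.exp (-(κ * |c|))) (fun θ _ => hder θ) hac.continuousOn
    (exp_neg_mul_abs_continuous κ)
  have hacont : Continuous a := by fun_prop
  have hdiff : ∀ θ ∈ Icc (0 : ℝ) 1,
      |a 1 - a 0| ≤ D * (‖h‖ / T) * (2 ^ N * (1 + ‖x + θ • h‖) ^ N) := by
    intro θ hθ
    have := norm_image_sub_le_of_norm_deriv_le_segment_01' (f := a) (f' := a')
      (C := D * (‖h‖ / T) * (2 ^ N * (1 + ‖x + θ • h‖) ^ N))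
      (fun θ' _ => (hder θ').hasDerivWithinAt) (fun θ' hθ' => by
        refine (hab θ').trans (mul_le_mul_of_nonneg_left ?_ (by positivity))
        rw [← mul_pow]
        refine pow_le_pow_left₀ (by positivity) ?_ _
        have h1 : x + θ' • h = (x + θ • h) + (θ' - θ) • h := by rw [sub_smul]; abel
        have h2 : ‖x + θ' • h‖ ≤ ‖x + θ • h‖ + ‖(θ' - θ) • h‖ := by rw [h1]; exact norm_add_le _ _
        have h3 : ‖(θ' - θ) • h‖ ≤ 1 := by
          rw [norm_smul, Real.norm_eq_abs]
          have : |θ' - θ| ≤ 1 := abs_le.2 ⟨by linarith [hθ'.1, hθ.2], by linarith [hθ'.2, hθ.1]⟩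
          exact mul_le_one₀ this (norm_nonneg _) hh
        linarith [norm_nonneg (x + θ • h)])
    exact this
  have h0 : a 0 = (ε x - μ) / T := by simp [ha]
  have h1 : a 1 = (ε (x + h) - μ) / T := by simp [ha]
  rw [pairU, occ_eq, occ_eq, ← h0, ← h1]
  refine (hU _ _).trans ?_
  rw [← hsub]
  have hI : |∫ θ in (0 : ℝ)..1, Real.exp (-(κ * |a θ|)) * a' θ| ≤
      ∫ θ in (0 : ℝ)..1, |Real.exp (-(κ * |a θ|)) * a' θ| :=
    intervalIntegral.abs_integral_le_integral_abs zero_le_one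
  have hcw : Continuous fun θ => Real.exp (-(κ * |a θ|)) := by fun_prop
  calc A * |a 1 - a 0| * |∫ θ in (0 : ℝ)..1, Real.exp (-(κ * |a θ|)) * a' θ|
      ≤ A * |a 1 - a 0| * ∫ θ in (0 : ℝ)..1, |Real.exp (-(κ * |a θ|)) * a' θ| :=
        mul_le_mul_of_nonneg_left hI (by positivity)
    _ = ∫ θ in (0 : ℝ)..1, A * |a 1 - a 0| * |Real.exp (-(κ * |a θ|)) * a' θ| :=
        (intervalIntegral.integral_const_mul _ _).symm
    _ ≤ _ := by
        refine intervalIntegral.integral_mono_on zero_le_one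
          ((by fun_prop : Continuous _).intervalIntegrable _ _)
          ((by fun_prop : Continuous _).intervalIntegrable _ _) fun θ hθ => ?_
        have e : κ * |a θ| = κ / T * |ε (x + θ • h) - μ| := by
          rw [ha, abs_div, abs_of_pos hT]; field_simp
        rw [abs_mul, abs_of_pos (Real.exp_pos _), e]
        calc _ ≤ A * (D * (‖h‖ / T) * (2 ^ N * (1 + ‖x + θ • h‖) ^ N)) *
              (Real.exp (-(κ / T * |ε (x + θ • h) - μ|)) *
                (D * (‖h‖ / T) * (1 + ‖x + θ • h‖) ^ N)) := by
              gcongr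
              · exact hdiff θ hθ
              · exact hab θ
          _ = _ := by ring

/-- The quadratic bound at small distances. -/
theorem HasGrowth.exists_lintegral_pairU_le_sq {c γ D : ℝ} {N : ℕ} (H : HasGrowth ε c γ D N)
    (μ : ℝ) (Hα : IsEntropyLike (renyi α) κ C) :
    ∃ A : ℝ, 0 ≤ A ∧ ∀ T : ℝ, 0 < T → ∀ h : E, ‖h‖ ≤ 1 →
      ∫⁻ x, ‖pairU α ε μ T x h‖ₑ ≤
        ENNReal.ofReal (A * (‖h‖ / T) ^ 2) * weight ε μ (2 * N) (κ / T) := by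
  obtain ⟨A, hA, hU⟩ := abs_kernelU_fermi_le Hα
  have hD := H.const_nonneg
  have hεc := H.smooth.continuous
  refine ⟨A * D ^ 2 * 2 ^ N, by positivity, fun T hT h hh => ?_⟩
  set B := A * D ^ 2 * 2 ^ N * (‖h‖ / T) ^ 2 with hB
  have hB0 : 0 ≤ B := by positivity
  set w : E → ℝ := fun x => (1 + ‖x‖) ^ (2 * N) * Real.exp (-(κ / T * |ε x - μ|)) with hw
  have hwc : Continuous w := by fun_prop
  have hw0 : ∀ x, 0 ≤ w x := fun x => by positivity
  have hpt : ∀ x, ‖pairU α ε μ T x h‖ₑ ≤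
      ∫⁻ θ in Ioc (0 : ℝ) 1, ENNReal.ofReal B * ENNReal.ofReal (w (x + θ • h)) := fun x => by
    have h1 := H.abs_pairU_le (μ := μ) hA hU hT x hh
    have hi : IntegrableOn (fun θ : ℝ => B * w (x + θ • h)) (Ioc 0 1) := by
      have : Continuous fun θ : ℝ => B * w (x + θ • h) := by fun_prop
      exact this.integrableOn_Ioc
    rw [intervalIntegral.integral_of_le zero_le_one] at h1
    rw [Real.enorm_eq_ofReal_abs]
    refine (ENNReal.ofReal_le_ofReal h1).trans_eq ?_
    refine (ofReal_integral_eq_lintegral_ofReal hi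
      (Eventually.of_forall fun θ => mul_nonneg hB0 (hw0 _))).trans ?_
    simp only [ENNReal.ofReal_mul hB0]
  -- After Tonelli, translation invariance removes θ: every point of the segment contributes the
  -- same weight.
  calc ∫⁻ x, ‖pairU α ε μ T x h‖ₑ
      ≤ ∫⁻ x, (∫⁻ θ in Ioc (0 : ℝ) 1, ENNReal.ofReal B * ENNReal.ofReal (w (x + θ • h))) :=
        lintegral_mono hpt
    _ = ∫⁻ θ in Ioc (0 : ℝ) 1, (∫⁻ x, ENNReal.ofReal B * ENNReal.ofReal (w (x + θ • h))) := by
        refine lintegral_lintegral_swap (Measurable.aemeasurable ?_)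
        have : Continuous fun z : E × ℝ => w (z.1 + z.2 • h) := by fun_prop
        exact this.measurable.ennreal_ofReal.const_mul _
    _ = ∫⁻ θ in Ioc (0 : ℝ) 1, ENNReal.ofReal B * weight ε μ (2 * N) (κ / T) := by
        refine lintegral_congr fun θ => ?_
        rw [lintegral_const_mul' _ _ ENNReal.ofReal_ne_top,
          lintegral_comp_add (fun x => ENNReal.ofReal (w x))]
        rfl
    _ = _ := by
        rw [lintegral_const, Measure.restrict_apply_univ, Real.volume_Ioc]
        simp [hB]

theorem rpow_abs_sub_le {r t κ : ℝ} (hr : 0 ≤ r) (ht : 0 ≤ t) (hκ : 0 ≤ κ) :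
    |r - t| ^ κ ≤ r ^ κ + t ^ κ := by
  rcases le_total r t with h | h
  · have : |r - t| ≤ t := by rw [abs_of_nonpos (by linarith)]; linarith
    have := Real.rpow_le_rpow (abs_nonneg _) this hκ
    linarith [Real.rpow_nonneg hr κ]
  · have : |r - t| ≤ r := by rw [abs_of_nonneg (by linarith)]; linarith
    have := Real.rpow_le_rpow (abs_nonneg _) this hκ
    linarith [Real.rpow_nonneg ht κ]

theorem occ_le {T : ℝ} (x : E) (hx : μ < ε x) :
    occ ε μ T x ≤ Real.exp (-(|ε x - μ| / T)) := by
  rw [occ_eq, abs_of_pos (sub_pos.2 hx)]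
  exact fermi_le_exp _

theorem one_sub_occ_le {T : ℝ} (x : E) (hx : ε x ≤ μ) :
    1 - occ ε μ T x ≤ Real.exp (-(|ε x - μ| / T)) := by
  rw [occ_eq, ← fermi_neg, abs_of_nonpos (sub_nonpos.2 hx)]
  refine (fermi_le_exp _).trans_eq ?_
  ring_nf

theorem exp_rpow_div (y T κ : ℝ) :
    Real.exp (-(y / T)) ^ κ = Real.exp (-(κ / T * y)) := by
  rw [← Real.exp_mul]; congr 1; ring

theorem lintegral_exp_eq_weight (β : ℝ) :
    ∫⁻ x, ENNReal.ofReal (Real.exp (-(β * |ε x - μ|))) = weight ε μ 0 β := by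
  simp [weight]

/-- A bound that is uniform in the distance. -/
theorem exists_lintegral_pairU_le (hε : Continuous ε) (μ : ℝ) (Hα : IsEntropyLike (renyi α) κ C) :
    ∃ A : ℝ, 0 ≤ A ∧ ∀ T : ℝ, 0 < T → ∀ h : E,
      ∫⁻ x, ‖pairU α ε μ T x h‖ₑ ≤
        ENNReal.ofReal A * (volume {x | ε x ≤ μ} + weight ε μ 0 (κ / T)) := by
  obtain ⟨A, hA, hU⟩ := abs_kernelU_le Hα
  have hκ := Hα.pos
  refine ⟨A * 2, by positivity, fun T hT h => ?_⟩
  have hm : MeasurableSet {x | ε x ≤ μ} := (isClosed_le hε continuous_const).measurableSet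
  set g : E → ENNReal := fun x => {x | ε x ≤ μ}.indicator 1 x +
    ENNReal.ofReal (Real.exp (-(κ / T * |ε x - μ|))) with hg
  have hgm : Measurable g := by
    have h1 : Measurable fun x => ENNReal.ofReal (Real.exp (-(κ / T * |ε x - μ|))) := by fun_prop
    exact (measurable_one.indicator hm).add h1
  have hocc : ∀ x, ENNReal.ofReal (occ ε μ T x ^ κ) ≤ g x := fun x => by
    by_cases hx : ε x ≤ μ
    · refine le_trans ?_ le_self_add
      rw [indicator_of_mem (show x ∈ {x | ε x ≤ μ} from hx), Pi.one_apply, ← ENNReal.ofReal_one]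
      exact ENNReal.ofReal_le_ofReal (Real.rpow_le_one (occ_mem T x).1 (occ_mem T x).2 hκ.le)
    · refine le_trans (ENNReal.ofReal_le_ofReal ?_) le_add_self
      rw [← exp_rpow_div]
      exact Real.rpow_le_rpow (occ_mem T x).1 (occ_le x (not_le.1 hx)) hκ.le
  have hpt : ∀ x, ‖pairU α ε μ T x h‖ₑ ≤ ENNReal.ofReal A * (g x + g (x + h)) := fun x => by
    rw [Real.enorm_eq_ofReal_abs]
    have hx := occ_mem (ε := ε) (μ := μ) T x
    have hy := occ_mem (ε := ε) (μ := μ) T (x + h)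
    have h1 := (hU _ hx _ hy).trans (mul_le_mul_of_nonneg_left
      (rpow_abs_sub_le hx.1 hy.1 hκ.le) hA)
    refine (ENNReal.ofReal_le_ofReal h1).trans ?_
    rw [ENNReal.ofReal_mul hA]
    exact mul_le_mul' le_rfl (ENNReal.ofReal_add_le.trans (add_le_add (hocc _) (hocc _)))
  refine (lintegral_mono hpt).trans_eq ?_
  rw [lintegral_const_mul' _ _ ENNReal.ofReal_ne_top, lintegral_add_left hgm,
    lintegral_comp_add g h, ← two_mul]
  have : ∫⁻ x, g x = volume {x | ε x ≤ μ} + weight ε μ 0 (κ / T) := by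
    rw [hg, lintegral_add_left (measurable_one.indicator hm), lintegral_indicator_one hm,
      lintegral_exp_eq_weight]
  rw [this, ← mul_assoc, ENNReal.ofReal_mul hA, ENNReal.ofReal_ofNat]

/-- Comparison with the situation at zero temperature. -/
theorem exists_lintegral_pairU_sub_le (hε : Continuous ε) (μ : ℝ)
    (Hα : IsEntropyLike (renyi α) κ C) :
    ∃ A : ℝ, 0 ≤ A ∧ ∀ T : ℝ, 0 < T → ∀ h : E,
      ∫⁻ x, ‖pairU α ε μ T x h - (shiftDiff {x | ε x ≤ μ} h).indicator
          (fun _ => kernelU α 0 1) x‖ₑ ≤ ENNReal.ofReal A * weight ε μ 0 (κ / 2 / T) := by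
  classical
  obtain ⟨A, hA, hU⟩ := abs_kernelU_sub_le Hα
  have hκ := Hα.pos
  refine ⟨A * 2, by positivity, fun T hT h => ?_⟩
  set g : E → ENNReal := fun x => ENNReal.ofReal (Real.exp (-(κ / 2 / T * |ε x - μ|))) with hg
  have hgm : Measurable g := by fun_prop
  -- The occupation at zero temperature. It differs from `occ` by at most exp(-|ε - μ|/T), and the
  -- Hölder exponent κ/2 of U_α turns this into the weight at κ/2/T. For these 0-1 values U_α is
  -- U_α(0,1) exactly on the symmetric difference.
  set χ : E → ℝ := fun x => if ε x ≤ μ then 1 else 0 with hχ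
  have hχm : ∀ x, χ x ∈ Icc (0 : ℝ) 1 := fun x => by
    simp only [hχ]; split_ifs <;> simp
  have hocc : ∀ x, ENNReal.ofReal (|occ ε μ T x - χ x| ^ (κ / 2)) ≤ g x := fun x => by
    refine ENNReal.ofReal_le_ofReal ?_
    rw [← exp_rpow_div]
    refine Real.rpow_le_rpow (abs_nonneg _) ?_ (by positivity)
    have h01 := occ_mem (ε := ε) (μ := μ) T x
    by_cases hx : ε x ≤ μ
    · simp only [hχ, if_pos hx]
      rw [abs_of_nonpos (by linarith [h01.2]), neg_sub]
      exact one_sub_occ_le x hx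
    · simp only [hχ, if_neg hx]
      rw [sub_zero, abs_of_nonneg h01.1]
      exact occ_le x (not_le.1 hx)
  have hUχ : ∀ x, (shiftDiff {x | ε x ≤ μ} h).indicator (fun _ => kernelU α 0 1) x =
      kernelU α (χ x) (χ (x + h)) := fun x => by
    have hiff : x ∈ shiftDiff {x | ε x ≤ μ} h ↔ ¬(ε x ≤ μ ↔ ε (x + h) ≤ μ) := Iff.rfl
    rw [indicator_apply]
    by_cases hx : ε x ≤ μ <;> by_cases hy : ε (x + h) ≤ μ <;>
      simp [hiff, hχ, hx, hy, kernelU_self, kernelU_comm (r := 1) (t := 0)]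
  have hpt : ∀ x, ‖pairU α ε μ T x h - (shiftDiff {x | ε x ≤ μ} h).indicator
      (fun _ => kernelU α 0 1) x‖ₑ ≤ ENNReal.ofReal A * (g x + g (x + h)) := fun x => by
    rw [hUχ, Real.enorm_eq_ofReal_abs]
    have h1 := hU _ (occ_mem (ε := ε) (μ := μ) T x) _ (occ_mem (ε := ε) (μ := μ) T (x + h))
      _ (hχm x) _ (hχm (x + h))
    refine (ENNReal.ofReal_le_ofReal h1).trans ?_
    rw [ENNReal.ofReal_mul hA]
    exact mul_le_mul' le_rfl (ENNReal.ofReal_add_le.trans (add_le_add (hocc _) (hocc _)))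
  refine (lintegral_mono hpt).trans_eq ?_
  rw [lintegral_const_mul' _ _ ENNReal.ofReal_ne_top, lintegral_add_left hgm,
    lintegral_comp_add g h, ← two_mul, hg, lintegral_exp_eq_weight, ← mul_assoc,
    ENNReal.ofReal_mul hA, ENNReal.ofReal_ofNat]

end Pair

/-! ### The integral over the distance and its logarithm -/

section Line

variable {E : Type*} [NormedAddCommGroup E] [InnerProductSpace ℝ E] [FiniteDimensional ℝ E]
  [MeasurableSpace E] [BorelSpace E] {ε : E → ℝ} {μ : ℝ} {α κ C : ℝ}

/-- The integrand of the coefficient `η_α` after the substitution of the distance `s = v - u`. -/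
noncomputable def shiftIntegrand (α : ℝ) (ε : E → ℝ) (μ T : ℝ) (n : E) (z : E × ℝ) : ℝ :=
  pairU α ε μ T z.1 (z.2 • n) / z.2 ^ 2

/-- The constant in the bound on the integral of `shiftIntegrand`. -/
noncomputable def shiftBound (ε : E → ℝ) (μ κ : ℝ) (N : ℕ) (T : ℝ) : ℝ :=
  (weight ε μ (2 * N) (κ / T)).toReal / T ^ 2 + (volume {x | ε x ≤ μ}).toReal +
    (weight ε μ 0 (κ / T)).toReal

theorem shiftBound_nonneg (N : ℕ) (T : ℝ) : 0 ≤ shiftBound ε μ κ N T := by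
  unfold shiftBound; positivity

theorem measurable_shiftIntegrand (hε : Continuous ε) (Hα : IsEntropyLike (renyi α) κ C) (T : ℝ) :
    Measurable fun z : E × (E × ℝ) => shiftIntegrand α ε μ T z.1 z.2 := by
  have h1 : Measurable fun z : E × (E × ℝ) => (z.2.1, z.2.2 • z.1) := by fun_prop
  have h2 := (measurable_pairU (μ := μ) hε Hα T).comp h1
  have h3 : Measurable fun z : E × (E × ℝ) => z.2.2 ^ 2 := by fun_prop
  exact h2.div h3

theorem measurable_shiftIntegrand_right (hε : Continuous ε) (Hα : IsEntropyLike (renyi α) κ C)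
    (T : ℝ) (n : E) : Measurable (shiftIntegrand α ε μ T n) := by
  have h1 : Measurable fun z : E × ℝ => (n, z) := measurable_const.prodMk measurable_id
  have h2 := (measurable_shiftIntegrand (μ := μ) hε Hα T).comp h1
  exact h2

/-- For |s| ≤ 1 the quadratic bound cancels s⁻²; for |s| ≥ 1 the uniform bound leaves s⁻². Both are
dominated by a multiple of 1/(1 + s²), whose integral is the π in the constant. No regularity of the
Fermi surface enters. -/
theorem HasGrowth.exists_lintegral_shiftIntegrand_le {c γ D : ℝ} {N : ℕ}
    (H : HasGrowth ε c γ D N) (μ : ℝ) (Hα : IsEntropyLike (renyi α) κ C) :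
    ∃ A : ℝ, 0 ≤ A ∧ ∀ T : ℝ, 0 < T → ∀ n : E, ‖n‖ ≤ 1 →
      ∫⁻ z, ‖shiftIntegrand α ε μ T n z‖ₑ ≤ ENNReal.ofReal (A * shiftBound ε μ κ N T) := by
  obtain ⟨A₁, hA₁, h1⟩ := H.exists_lintegral_pairU_le_sq μ Hα
  obtain ⟨A₂, hA₂, h2⟩ := exists_lintegral_pairU_le H.smooth.continuous μ Hα
  refine ⟨2 * (A₁ + A₂) * Real.pi, by positivity, fun T hT n hn => ?_⟩
  have hκT : 0 < κ / T := div_pos Hα.pos hT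
  have hw2 := (H.weight_lt_top (μ := μ) (2 * N) hκT).ne
  have hw0 := (H.weight_lt_top (μ := μ) 0 hκT).ne
  have hv := (H.isCompact_sublevel μ).measure_lt_top.ne (a := volume {x | ε x ≤ μ})
  set K := shiftBound ε μ κ N T with hK
  have hK0 : 0 ≤ K := shiftBound_nonneg N T
  have hKdef : K = (weight ε μ (2 * N) (κ / T)).toReal / T ^ 2 +
    (volume {x | ε x ≤ μ}).toReal + (weight ε μ 0 (κ / T)).toReal := hK
  set w2 := (weight ε μ (2 * N) (κ / T)).toReal with hw2'
  set w0 := (weight ε μ 0 (κ / T)).toReal with hw0'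
  set v := (volume {x | ε x ≤ μ}).toReal with hv'
  have p2 : 0 ≤ w2 := ENNReal.toReal_nonneg
  have p0 : 0 ≤ w0 := ENNReal.toReal_nonneg
  have pv : 0 ≤ v := ENNReal.toReal_nonneg
  have p2' : 0 ≤ w2 / T ^ 2 := by positivity
  have hs : ∀ s : ℝ, ∫⁻ x, ‖shiftIntegrand α ε μ T n (x, s)‖ₑ ≤
      ENNReal.ofReal (2 * (A₁ + A₂) * K * (1 + s ^ 2)⁻¹) := fun s => by
    have e : ∀ x, ‖shiftIntegrand α ε μ T n (x, s)‖ₑ =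
        ENNReal.ofReal (s ^ 2)⁻¹ * ‖pairU α ε μ T x (s • n)‖ₑ := fun x => by
      rw [shiftIntegrand, div_eq_inv_mul, enorm_mul, Real.enorm_of_nonneg (by positivity)]
    simp only [e]
    rw [lintegral_const_mul' _ _ ENNReal.ofReal_ne_top]
    rcases eq_or_ne s 0 with rfl | hs0
    · simp
    have hs2 : 0 < s ^ 2 := by positivity
    rcases le_total |s| 1 with hle | hge
    · have hsn : ‖s • n‖ ≤ |s| := by
        rw [norm_smul, Real.norm_eq_abs]; nlinarith [abs_nonneg s]
      have hss : s ^ 2 ≤ 1 := by rw [← sq_abs]; nlinarith [abs_nonneg s]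
      refine (mul_le_mul' le_rfl (h1 T hT (s • n) (hsn.trans hle))).trans ?_
      rw [← ENNReal.ofReal_toReal hw2, ← ENNReal.ofReal_mul (by positivity),
        ← ENNReal.ofReal_mul (by positivity)]
      refine ENNReal.ofReal_le_ofReal ?_
      have h3 : ‖s • n‖ ^ 2 ≤ s ^ 2 := by rw [← sq_abs s]; gcongr
      calc (s ^ 2)⁻¹ * (A₁ * (‖s • n‖ / T) ^ 2 * w2)
          ≤ (s ^ 2)⁻¹ * (A₁ * (s ^ 2 / T ^ 2) * w2) := by rw [div_pow]; gcongr
        _ = A₁ * (w2 / T ^ 2) := by field_simp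
        _ ≤ (A₁ + A₂) * K := by
          refine mul_le_mul (by linarith) (by rw [hKdef]; linarith) p2' (by positivity)
        _ ≤ (A₁ + A₂) * K * (2 * (1 + s ^ 2)⁻¹) := by
          refine le_mul_of_one_le_right (by positivity) ?_
          rw [← div_eq_mul_inv, one_le_div (by positivity)]; linarith
        _ = _ := by ring
    · have hss : 1 ≤ s ^ 2 := by rw [← sq_abs]; nlinarith
      refine (mul_le_mul' le_rfl (h2 T hT (s • n))).trans ?_
      rw [← ENNReal.ofReal_toReal hw0, ← ENNReal.ofReal_toReal hv,
        ← ENNReal.ofReal_add (by positivity) (by positivity), ← ENNReal.ofReal_mul (by positivity),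
        ← ENNReal.ofReal_mul (by positivity)]
      refine ENNReal.ofReal_le_ofReal ?_
      calc (s ^ 2)⁻¹ * (A₂ * (v + w0)) ≤ (2 * (1 + s ^ 2)⁻¹) * ((A₁ + A₂) * K) := by
            refine mul_le_mul ?_ ?_ (by positivity) (by positivity)
            · rw [← div_eq_mul_inv, inv_eq_one_div, div_le_div_iff₀ (by positivity) (by positivity)]
              linarith
            · refine mul_le_mul (by linarith) (by rw [hKdef]; linarith) (by positivity)
                (by positivity)
        _ = _ := by ring
  have hm : Measurable fun z => ‖shiftIntegrand α ε μ T n z‖ₑ :=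
    (measurable_shiftIntegrand_right H.smooth.continuous Hα T n).enorm
  calc ∫⁻ z, ‖shiftIntegrand α ε μ T n z‖ₑ
      = ∫⁻ s, (∫⁻ x, ‖shiftIntegrand α ε μ T n (x, s)‖ₑ) := by
        rw [Measure.volume_eq_prod, lintegral_prod_symm _ hm.aemeasurable]
    _ ≤ ∫⁻ s : ℝ, ENNReal.ofReal (2 * (A₁ + A₂) * K * (1 + s ^ 2)⁻¹) := lintegral_mono hs
    _ = _ := by
        rw [← ofReal_integral_eq_lintegral_ofReal (integrable_inv_one_add_sq.const_mul _)
          (Eventually.of_forall fun s => by positivity), integral_const_mul,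
          integral_univ_inv_one_add_sq]
        congr 1; ring

theorem HasGrowth.integrable_shiftIntegrand {c γ D : ℝ} {N : ℕ}
    (H : HasGrowth ε c γ D N) (Hα : IsEntropyLike (renyi α) κ C) {T : ℝ} (hT : 0 < T)
    {n : E} (hn : ‖n‖ ≤ 1) : Integrable (shiftIntegrand α ε μ T n) := by
  obtain ⟨A, -, h⟩ := H.exists_lintegral_shiftIntegrand_le μ Hα
  exact ⟨(measurable_shiftIntegrand_right H.smooth.continuous Hα T n).aestronglyMeasurable,
    (h T hT n hn).trans_lt ENNReal.ofReal_lt_top⟩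

/-- The contribution of the positive distances. -/
noncomputable def halfIntegral (α : ℝ) (ε : E → ℝ) (μ T : ℝ) (n : E) : ℝ :=
  ∫ s in Ioi (0 : ℝ), (∫ x, pairU α ε μ T x (s • n)) / s ^ 2

theorem HasGrowth.integrable_div_sq {c γ D : ℝ} {N : ℕ}
    (H : HasGrowth ε c γ D N) (Hα : IsEntropyLike (renyi α) κ C) {T : ℝ} (hT : 0 < T)
    {n : E} (hn : ‖n‖ ≤ 1) :
    Integrable fun s : ℝ => (∫ x, pairU α ε μ T x (s • n)) / s ^ 2 := by
  have h := (H.integrable_shiftIntegrand (μ := μ) Hα hT hn).integral_prod_right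
  simpa only [shiftIntegrand, integral_div] using h

/-- Negative distances in the direction n are positive distances in the direction -n. -/
theorem HasGrowth.integral_shiftIntegrand {c γ D : ℝ} {N : ℕ}
    (H : HasGrowth ε c γ D N) (Hα : IsEntropyLike (renyi α) κ C) {T : ℝ} (hT : 0 < T)
    {n : E} (hn : ‖n‖ ≤ 1) :
    ∫ z, shiftIntegrand α ε μ T n z = halfIntegral α ε μ T n + halfIntegral α ε μ T (-n) := by
  have hi := H.integrable_div_sq (μ := μ) Hα hT hn
  rw [Measure.volume_eq_prod, integral_prod_symm _ (H.integrable_shiftIntegrand Hα hT hn)]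
  simp only [shiftIntegrand, integral_div]
  rw [← intervalIntegral.integral_Iic_add_Ioi (b := 0) hi.integrableOn hi.integrableOn, add_comm]
  congr 1
  rw [halfIntegral, ← neg_zero, ← integral_comp_neg_Ioi, neg_zero]
  simp only [smul_neg, neg_smul, neg_sq]

/-- The ranges (0,T] and (1,∞) contribute at most C each. On (T,1] the term a/s integrates to the
logarithm and the remainder C(T/s² + 1) to at most 2C. -/
theorem abs_setIntegral_sub_log_le {g : ℝ → ℝ} {T C a : ℝ} (hT : 0 < T) (hT1 : T ≤ 1)
    (hg : IntegrableOn (fun s => g s / s ^ 2) (Ioi 0))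
    (h1 : ∀ s, 0 < s → s ≤ T → |g s| ≤ C * s ^ 2 / T)
    (h2 : ∀ s, T < s → s ≤ 1 → |g s - a * s| ≤ C * (T + s ^ 2))
    (h3 : ∀ s, 1 < s → |g s| ≤ C) :
    |(∫ s in Ioi (0 : ℝ), g s / s ^ 2) - a * Real.log (1 / T)| ≤ 4 * C := by
  have hC : 0 ≤ C := (abs_nonneg _).trans (h3 2 (by norm_num))
  have hsplit : ∫ s in Ioi (0 : ℝ), g s / s ^ 2 = (∫ s in Ioc 0 T, g s / s ^ 2) +
      ((∫ s in Ioc T 1, g s / s ^ 2) + ∫ s in Ioi (1 : ℝ), g s / s ^ 2) := by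
    rw [← setIntegral_union (Ioc_disjoint_Ioi le_rfl) measurableSet_Ioi
      (hg.mono_set fun s hs => hT.trans hs.1)
      (hg.mono_set fun s (hs : 1 < s) => zero_lt_one.trans hs),
      Ioc_union_Ioi_eq_Ioi hT1,
      ← setIntegral_union (Ioc_disjoint_Ioi le_rfl) measurableSet_Ioi
      (hg.mono_set fun s hs => hs.1) (hg.mono_set fun s (hs : T < s) => hT.trans hs),
      Ioc_union_Ioi_eq_Ioi hT.le]
  have b1 : |∫ s in Ioc 0 T, g s / s ^ 2| ≤ C := by
    have := norm_setIntegral_le_of_norm_le_const (μ := volume) (s := Ioc 0 T) (C := C / T)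
      (f := fun s => g s / s ^ 2) (by simp) fun s hs => by
        have hs0 : 0 < s ^ 2 := pow_pos hs.1 2
        rw [norm_div, Real.norm_eq_abs, Real.norm_of_nonneg hs0.le, div_le_iff₀ hs0]
        exact (h1 s hs.1 hs.2).trans_eq (by ring)
    rw [Real.volume_real_Ioc_of_le hT.le, sub_zero, div_mul_cancel₀ _ hT.ne',
      Real.norm_eq_abs] at this
    exact this
  have b3 : |∫ s in Ioi (1 : ℝ), g s / s ^ 2| ≤ C := by
    have hi : IntegrableOn (fun s : ℝ => C * s ^ (-2 : ℝ)) (Ioi 1) :=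
      (integrableOn_Ioi_rpow_of_lt (by norm_num) one_pos).const_mul C
    have := norm_integral_le_of_norm_le hi (f := fun s => g s / s ^ 2)
      ((ae_restrict_mem measurableSet_Ioi).mono fun s (hs : 1 < s) => by
        have hs0 : 0 < s ^ 2 := by positivity
        rw [norm_div, Real.norm_eq_abs, Real.norm_of_nonneg hs0.le, div_eq_mul_inv,
          Real.rpow_neg (by positivity), Real.rpow_two]
        exact mul_le_mul_of_nonneg_right (h3 s hs) (by positivity))
    rw [integral_const_mul, integral_Ioi_rpow_of_lt (by norm_num) one_pos, Real.norm_eq_abs] at this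
    refine this.trans_eq ?_
    norm_num
  have b2 : |(∫ s in Ioc T 1, g s / s ^ 2) - a * Real.log (1 / T)| ≤ 2 * C := by
    have hne : ∀ s ∈ uIcc T 1, s ≠ 0 := fun s hs => by
      rw [uIcc_of_le hT1] at hs; exact (hT.trans_le hs.1).ne'
    have hinv : IntervalIntegrable (fun s : ℝ => a * s⁻¹) volume T 1 :=
      (intervalIntegral.intervalIntegrable_inv hne continuousOn_id).const_mul a
    have hlog : a * Real.log (1 / T) = ∫ s in Ioc T 1, a * s⁻¹ := by
      rw [← intervalIntegral.integral_of_le hT1, intervalIntegral.integral_const_mul,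
        integral_inv_of_pos hT one_pos]
    have hgi : IntegrableOn (fun s => g s / s ^ 2) (Ioc T 1) :=
      hg.mono_set fun s hs => hT.trans hs.1
    rw [hlog, ← integral_sub hgi ((intervalIntegrable_iff_integrableOn_Ioc_of_le hT1).1 hinv)]
    have hb : IntervalIntegrable (fun s : ℝ => C * (T * s ^ (-2 : ℤ) + 1)) volume T 1 := by
      refine ((IntervalIntegrable.const_mul ?_ T).add intervalIntegrable_const).const_mul C
      exact intervalIntegral.intervalIntegrable_zpow (Or.inr fun h => hne 0 h rfl)
    have := norm_integral_le_of_norm_le ((intervalIntegrable_iff_integrableOn_Ioc_of_le hT1).1 hb)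
      (f := fun s => g s / s ^ 2 - a * s⁻¹)
      ((ae_restrict_mem measurableSet_Ioc).mono fun s hs => by
        have hs0 : 0 < s := hT.trans hs.1
        have e : g s / s ^ 2 - a * s⁻¹ = (g s - a * s) / s ^ 2 := by field_simp
        rw [e, norm_div, Real.norm_eq_abs, Real.norm_of_nonneg (by positivity),
          div_le_iff₀ (by positivity)]
        refine (h2 s hs.1 hs.2).trans_eq ?_
        rw [zpow_neg, zpow_ofNat]
        field_simp)
    rw [Real.norm_eq_abs] at this
    refine this.trans ?_
    rw [← intervalIntegral.integral_of_le hT1, intervalIntegral.integral_const_mul,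
      intervalIntegral.integral_add, intervalIntegral.integral_const_mul,
      integral_zpow (Or.inr ⟨by norm_num, fun h => hne 0 h rfl⟩)]
    · have hTT : T * T⁻¹ = 1 := mul_inv_cancel₀ hT.ne'
      norm_num
      nlinarith
    · exact IntervalIntegrable.const_mul
        (intervalIntegral.intervalIntegrable_zpow (Or.inr fun h => hne 0 h rfl)) T
    · exact intervalIntegrable_const
  rw [hsplit]
  rw [abs_le] at *
  constructor <;> linarith [b1.1, b1.2, b2.1, b2.2, b3.1, b3.2]

end Line

/-! ### Logarithmic asymptotics for a fixed normal direction -/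

section LogBound

variable {E : Type*} [NormedAddCommGroup E] [InnerProductSpace ℝ E] [FiniteDimensional ℝ E]
  [MeasurableSpace E] [BorelSpace E] {ε : E → ℝ} {μ : ℝ} {α κ C : ℝ}

theorem abs_integral_le_of_lintegral_le {X : Type*} [MeasurableSpace X] {ν : Measure X}
    {f : X → ℝ} {B : ℝ} (hB : 0 ≤ B) (h : ∫⁻ x, ‖f x‖ₑ ∂ν ≤ ENNReal.ofReal B) :
    |∫ x, f x ∂ν| ≤ B := by
  have h1 := (enorm_integral_le_lintegral_enorm f).trans h
  rwa [Real.enorm_eq_ofReal_abs, ENNReal.ofReal_le_ofReal_iff hB] at h1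

/-- The logarithmic behaviour at low temperature, uniformly in the direction. -/
theorem HasGrowth.exists_halfIntegral_sub_log_le {c γ D : ℝ} {N : ℕ} (H : HasGrowth ε c γ D N)
    (Hα : IsEntropyLike (renyi α) κ C) (hreg : ∀ x, ε x = μ → gradient ε x ≠ 0) {k : ℕ}
    (hk : Module.finrank ℝ E = k + 1) :
    ∃ K : ℝ, 0 ≤ K ∧ ∀ T : ℝ, 0 < T → T ≤ 1 → ∀ n : E, ‖n‖ ≤ 1 →
      |halfIntegral α ε μ T n - kernelU α 0 1 * (flux k ε μ n).toReal * Real.log (1 / T)| ≤ K := by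
  have hκ := Hα.pos
  have hεc := H.smooth.continuous
  obtain ⟨A₁, hA₁, h1⟩ := H.exists_lintegral_pairU_le_sq μ Hα
  obtain ⟨A₂, hA₂, h2⟩ := exists_lintegral_pairU_le hεc μ Hα
  obtain ⟨A₃, hA₃, h3⟩ := exists_lintegral_pairU_sub_le hεc μ Hα
  obtain ⟨B₁, hB₁, w1⟩ := H.exists_weight_le hreg hk (2 * N) hκ
  obtain ⟨B₂, hB₂, w2⟩ := H.exists_weight_le hreg hk 0 (half_pos hκ)
  obtain ⟨R, hR, hrate⟩ := exists_shiftVolume_rate H.smooth H.isCompact_sublevel hreg hk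
  have hvf := (H.isCompact_sublevel μ).measure_lt_top.ne (a := volume {x | ε x ≤ μ})
  set v := (volume {x | ε x ≤ μ}).toReal with hv
  have pv : 0 ≤ v := ENNReal.toReal_nonneg
  set u := kernelU α 0 1 with hu
  set K₁ := A₁ * B₁ / κ with hK₁
  set K₂ := A₂ * (v + B₂ / κ) with hK₂
  set K₃ := A₃ * (2 * B₂ / κ) + |u| * R with hK₃
  have hK₁0 : 0 ≤ K₁ := by positivity
  have hK₂0 : 0 ≤ K₂ := by positivity
  have hK₃0 : 0 ≤ K₃ := by positivity
  refine ⟨4 * (K₁ + K₂ + K₃), by positivity, fun T hT hT1 n hn => ?_⟩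
  have hTκ : κ ≤ κ / T := by rw [le_div_iff₀ hT]; nlinarith
  have hTκ2 : κ / 2 ≤ κ / 2 / T := by rw [le_div_iff₀ hT]; nlinarith
  -- The weights at κ/T and κ/2/T are O(T). Short distances: (s/T)² times O(T) is O(s²/T).
  -- Intermediate ones: U_α(0,1) V(sn) up to O(T), with the expansion of V up to O(s²). Long ones:
  -- the bound by the volume of the Fermi sea and a weight.
  refine abs_setIntegral_sub_log_le hT hT1
    (H.integrable_div_sq Hα hT hn).integrableOn (fun s hs hsT => ?_) (fun s hsT hs1 => ?_)
    (fun s hs => ?_)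
  · have hsn : ‖s • n‖ ≤ s := by
      rw [norm_smul, Real.norm_of_nonneg hs.le]; nlinarith
    have hb : ∫⁻ x, ‖pairU α ε μ T x (s • n)‖ₑ ≤ ENNReal.ofReal (K₁ * s ^ 2 / T) := by
      refine (h1 T hT _ (hsn.trans (hsT.trans hT1))).trans
        ((mul_le_mul' le_rfl (w1 _ hTκ)).trans ?_)
      rw [← ENNReal.ofReal_mul (by positivity)]
      refine ENNReal.ofReal_le_ofReal ?_
      calc A₁ * (‖s • n‖ / T) ^ 2 * (B₁ / (κ / T)) ≤ A₁ * (s / T) ^ 2 * (B₁ / (κ / T)) := by gcongr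
        _ = _ := by rw [hK₁]; field_simp
    refine (abs_integral_le_of_lintegral_le (by positivity) hb).trans ?_
    gcongr
    linarith
  · have hs : 0 < s := hT.trans hsT
    set V := shiftVolume ε μ (s • n) with hV
    set D := shiftDiff {x | ε x ≤ μ} (s • n) with hDdef
    have hDm : MeasurableSet D :=
      measurableSet_shiftDiff (H.isCompact_sublevel μ).measurableSet _
    have hb : ∫⁻ x, ‖pairU α ε μ T x (s • n) - D.indicator (fun _ => u) x‖ₑ ≤
        ENNReal.ofReal (A₃ * (2 * B₂ / κ) * T) := by
      refine (h3 T hT (s • n)).trans ((mul_le_mul' le_rfl (w2 _ hTκ2)).trans ?_)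
      rw [← ENNReal.ofReal_mul hA₃]
      refine ENNReal.ofReal_le_ofReal (le_of_eq ?_)
      field_simp
    have hi1 : Integrable fun x => pairU α ε μ T x (s • n) := by
      refine ⟨(measurable_pairU_left hεc Hα T _).aestronglyMeasurable, (h2 T hT _).trans_lt ?_⟩
      have := H.weight_lt_top (μ := μ) 0 (div_pos hκ hT)
      exact ENNReal.mul_lt_top ENNReal.ofReal_lt_top (ENNReal.add_lt_top.2 ⟨hvf.lt_top, this⟩)
    have hi2 : Integrable (D.indicator fun _ => u) := by
      rw [integrable_indicator_iff hDm]
      exact integrableOn_const (shiftDiff_volume_lt_top (H.isCompact_sublevel μ) _).ne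
    have hb2 := abs_integral_le_of_lintegral_le (by positivity) hb
    rw [integral_sub hi1 hi2, integral_indicator hDm, setIntegral_const, smul_eq_mul] at hb2
    have hVr : volume.real D = V := rfl
    rw [hVr] at hb2
    have hb3 := mul_le_mul_of_nonneg_left (hrate n hn s hs hs1) (abs_nonneg u)
    rw [← abs_mul] at hb3
    have e : (∫ x, pairU α ε μ T x (s • n)) - u * (flux k ε μ n).toReal * s =
        ((∫ x, pairU α ε μ T x (s • n)) - V * u) + u * (V - s * (flux k ε μ n).toReal) := by ring
    rw [e]
    refine (abs_add_le _ _).trans ((add_le_add hb2 hb3).trans ?_)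
    have e1 : 0 ≤ A₃ * (2 * B₂ / κ) := by positivity
    have e2 : 0 ≤ |u| * R := by positivity
    have e3 : 0 ≤ s ^ 2 := by positivity
    calc A₃ * (2 * B₂ / κ) * T + |u| * (R * s ^ 2)
        ≤ K₃ * T + K₃ * s ^ 2 := by
          refine add_le_add (mul_le_mul_of_nonneg_right (by linarith) hT.le) ?_
          rw [← mul_assoc]
          exact mul_le_mul_of_nonneg_right (by linarith) e3
      _ = K₃ * (T + s ^ 2) := by ring
      _ ≤ _ := mul_le_mul_of_nonneg_right (by linarith) (by linarith)
  · have hb : ∫⁻ x, ‖pairU α ε μ T x (s • n)‖ₑ ≤ ENNReal.ofReal K₂ := by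
      refine (h2 T hT _).trans ?_
      rw [hK₂, ENNReal.ofReal_mul hA₂, ENNReal.ofReal_add pv (by positivity),
        ENNReal.ofReal_toReal hvf]
      refine mul_le_mul' le_rfl (add_le_add le_rfl ((w2 _ (by linarith)).trans ?_))
      refine ENNReal.ofReal_le_ofReal ?_
      gcongr
    refine (abs_integral_le_of_lintegral_le hK₂0 hb).trans ?_
    linarith

end LogBound

/-! ### Assembly of the coefficient over the boundary -/

section Coefficient

variable {d : ℕ} {ε : EuclideanSpace ℝ (Fin d) → ℝ} {μ α κ C : ℝ}

/-- The change of variables `(p, u, v) ↦ (p + u n, v - u)`. -/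
def shearCoord (n : EuclideanSpace ℝ (Fin d)) (y : (ℝ ∙ n)ᗮ × (ℝ × ℝ)) :
    EuclideanSpace ℝ (Fin d) × ℝ := ((y.1 : EuclideanSpace ℝ (Fin d)) + y.2.1 • n, y.2.2 - y.2.1)

theorem measurePreserving_shearCoord {n : EuclideanSpace ℝ (Fin d)} (hn : ‖n‖ = 1) :
    MeasurePreserving (shearCoord n) volume volume := by
  have h1 : MeasurePreserving (Prod.map id fun z : ℝ × ℝ => (z.1, z.2 - z.1))
      (volume : Measure ((ℝ ∙ n)ᗮ × (ℝ × ℝ))) volume :=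
    (MeasurePreserving.id volume).prod (measurePreserving_prod_sub volume volume)
  have h2 : MeasurePreserving (MeasurableEquiv.prodAssoc (α := (ℝ ∙ n)ᗮ) (β := ℝ) (γ := ℝ)).symm
      volume volume := volume_preserving_prodAssoc.symm
  have h3 : MeasurePreserving (Prod.map (orthCoord n hn) (id : ℝ → ℝ)) volume volume :=
    (measurePreserving_orthCoord n hn).prod (MeasurePreserving.id volume)
  have h := h3.comp (h2.comp h1)
  convert! h using 1
  funext y
  simp [shearCoord, MeasurableEquiv.prodAssoc, orthCoord_apply]

theorem pairIntegrand_lineProfile (T : ℝ) (n : EuclideanSpace ℝ (Fin d))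
    (y : (ℝ ∙ n)ᗮ × (ℝ × ℝ)) :
    pairIntegrand α (lineProfile ε μ T n y.1) y.2 = shiftIntegrand α ε μ T n (shearCoord n y) := by
  have e : (y.1 : EuclideanSpace ℝ (Fin d)) + y.2.1 • n + (y.2.2 - y.2.1) • n =
      y.1 + y.2.2 • n := by rw [sub_smul]; abel
  simp only [pairIntegrand, shiftIntegrand, shearCoord, pairU, occ, lineProfile, e]
  congr 1; ring

/-- The vector 0 is admitted because it is the default value of `exteriorNormal`. The line profile
is then constant and U_α vanishes on the diagonal, so exceptional points contribute nothing. -/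
theorem HasGrowth.integrable_pairIntegrand {c γ D : ℝ} {N : ℕ} (H : HasGrowth ε c γ D N)
    (Hα : IsEntropyLike (renyi α) κ C) {T : ℝ} (hT : 0 < T) {n : EuclideanSpace ℝ (Fin d)}
    (hn : n = 0 ∨ ‖n‖ = 1) :
    Integrable (fun y : (ℝ ∙ n)ᗮ × (ℝ × ℝ) => pairIntegrand α (lineProfile ε μ T n y.1) y.2) := by
  simp only [pairIntegrand_lineProfile]
  rcases hn with rfl | hn
  · simp [shiftIntegrand, pairU, kernelU_self]
  · have hi := H.integrable_shiftIntegrand (μ := μ) Hα hT hn.le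
    exact (measurePreserving_shearCoord hn).integrable_comp_of_integrable hi

theorem HasGrowth.tangentIntegral_eq {c γ D : ℝ} {N : ℕ} (H : HasGrowth ε c γ D N)
    (Hα : IsEntropyLike (renyi α) κ C) {T : ℝ} (hT : 0 < T) {n : EuclideanSpace ℝ (Fin d)}
    (hn : n = 0 ∨ ‖n‖ = 1) :
    tangentIntegral α ε μ T n = 1 / (8 * Real.pi ^ 2) * ∫ z, shiftIntegrand α ε μ T n z := by
  have hp := H.integrable_pairIntegrand (μ := μ) Hα hT hn
  unfold tangentIntegral functionalU
  rw [integral_const_mul]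
  congr 1
  rw [← integral_prod _ hp]
  simp only [pairIntegrand_lineProfile]
  rcases hn with rfl | hn
  · simp [shiftIntegrand, pairU, kernelU_self]
  · have hi := H.integrable_shiftIntegrand (μ := μ) Hα hT hn.le
    have hmp := measurePreserving_shearCoord hn
    rw [← Measure.volume_eq_prod, ← hmp.map_eq, integral_map hmp.measurable.aemeasurable]
    rw [hmp.map_eq]; exact hi.aestronglyMeasurable

theorem HasGrowth.exists_abs_tangentIntegral_le {c γ D : ℝ} {N : ℕ} (H : HasGrowth ε c γ D N)
    (μ : ℝ) (Hα : IsEntropyLike (renyi α) κ C) :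
    ∃ A : ℝ, 0 ≤ A ∧ ∀ T : ℝ, 0 < T → ∀ n : EuclideanSpace ℝ (Fin d), n = 0 ∨ ‖n‖ = 1 →
      |tangentIntegral α ε μ T n| ≤ A * shiftBound ε μ κ N T := by
  obtain ⟨A, hA, h⟩ := H.exists_lintegral_shiftIntegrand_le μ Hα
  refine ⟨1 / (8 * Real.pi ^ 2) * A, by positivity, fun T hT n hn => ?_⟩
  have hn1 : ‖n‖ ≤ 1 := by rcases hn with rfl | hn <;> simp [*]
  rw [H.tangentIntegral_eq Hα hT hn, abs_mul, abs_of_pos (by positivity), mul_assoc]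
  exact mul_le_mul_of_nonneg_left (abs_integral_le_of_lintegral_le
    (mul_nonneg hA (shiftBound_nonneg N T)) (h T hT n hn1)) (by positivity)

/-- The domain of integration n^⊥ varies with q, which obstructs a direct argument. In the sheared
form the domain is fixed and the normal enters only as a parameter. -/
theorem HasGrowth.stronglyMeasurable_tangentIntegral {c γ D : ℝ} {N : ℕ}
    (H : HasGrowth ε c γ D N) (Hα : IsEntropyLike (renyi α) κ C) {T : ℝ} (hT : 0 < T)
    (S : Set (EuclideanSpace ℝ (Fin d))) :
    StronglyMeasurable fun q => tangentIntegral α ε μ T (exteriorNormal S q) := by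
  have e : (fun q => tangentIntegral α ε μ T (exteriorNormal S q)) = fun q =>
      1 / (8 * Real.pi ^ 2) * ∫ z, shiftIntegrand α ε μ T (exteriorNormal S q) z := by
    funext q
    exact H.tangentIntegral_eq Hα hT (exteriorNormal_eq_zero_or S q)
  rw [e]
  have h1 := (measurable_shiftIntegrand (μ := μ) H.smooth.continuous Hα T).stronglyMeasurable
  have h2 := h1.integral_prod_right' (ν := volume)
  exact (h2.comp_measurable (measurable_exteriorNormal S)).const_mul _

theorem isFiniteMeasure_areaMeasure {S : Set (EuclideanSpace ℝ (Fin d))}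
    (h : (μHE[d - 1] : Measure (EuclideanSpace ℝ (Fin d))) S < ⊤) :
    IsFiniteMeasure (areaMeasure S) :=
  ⟨by rw [areaMeasure, Measure.restrict_apply_univ]; exact h⟩

/-- At fixed T the bound on the tangent integral is uniform in the normal, and a bounded measurable
function is integrable over a boundary of finite area. -/
theorem HasGrowth.etaConverges {c γ D : ℝ} {N : ℕ} (H : HasGrowth ε c γ D N)
    (Hα : IsEntropyLike (renyi α) κ C) {T : ℝ} (hT : 0 < T)
    {Ω : Set (EuclideanSpace ℝ (Fin d))} [IsFiniteMeasure (areaMeasure (frontier Ω))] :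
    EtaConverges α ε μ Ω T := by
  obtain ⟨A, hA, hle⟩ := H.exists_abs_tangentIntegral_le μ Hα
  refine ⟨Eventually.of_forall fun q =>
    H.integrable_pairIntegrand Hα hT (exteriorNormal_eq_zero_or Ω q), ?_⟩
  exact (integrable_const (A * shiftBound ε μ κ N T)).mono'
    (H.stronglyMeasurable_tangentIntegral Hα hT Ω).aestronglyMeasurable
    (Eventually.of_forall fun q => hle T hT _ (exteriorNormal_eq_zero_or Ω q))

/-- The Fermi sea is empty since ε ≥ 0, and the gap |μ| makes both weights O(exp(-κ|μ|/T)), which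
outweighs T⁻². -/
theorem HasGrowth.tendsto_shiftBound {c γ D : ℝ} {N : ℕ} (H : HasGrowth ε c γ D N)
    (hμ : μ < 0) (hκ : 0 < κ) (M : ℕ) :
    Tendsto (shiftBound ε μ κ M) (𝓝[>] 0) (𝓝 0) := by
  set w2 := (weight ε μ (2 * M) κ).toReal with hw2
  set w0 := (weight ε μ 0 κ).toReal with hw0
  have hb : 0 < κ * |μ| := mul_pos hκ (abs_pos.2 hμ.ne)
  set e : ℝ → ℝ := fun T => Real.exp (-((κ / T - κ) * |μ|)) with he
  have hv : volume {x | ε x ≤ μ} = 0 := by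
    have : {x | ε x ≤ μ} = ∅ := by
      ext x; simp only [mem_ofPred_eq, mem_empty_iff_false, iff_false, not_le]
      linarith [H.nonneg x]
    rw [this, measure_empty]
  have hle : ∀ᶠ T : ℝ in 𝓝[>] 0, shiftBound ε μ κ M T ≤
      Real.exp (κ * |μ|) * (w2 * (T⁻¹ ^ (2 : ℝ) * Real.exp (-(κ * |μ|) * T⁻¹)) +
        w0 * (T⁻¹ ^ (0 : ℝ) * Real.exp (-(κ * |μ|) * T⁻¹))) := by
    filter_upwards [self_mem_nhdsWithin,
      (eventually_lt_nhds one_pos).filter_mono nhdsWithin_le_nhds] with T hT hT1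
    have hT : 0 < T := hT
    have hTκ : κ ≤ κ / T := by rw [le_div_iff₀ hT]; nlinarith
    have key : ∀ m : ℕ, (weight ε μ m (κ / T)).toReal ≤ Real.exp (-((κ / T - κ) * |μ|)) *
        (weight ε μ m κ).toReal := fun m => by
      have := ENNReal.toReal_mono (ENNReal.mul_ne_top ENNReal.ofReal_ne_top
        (H.weight_lt_top (μ := μ) m hκ).ne) (H.weight_le_of_neg hμ m hTκ)
      rwa [ENNReal.toReal_mul, ENNReal.toReal_ofReal (Real.exp_pos _).le] at this
    have hexp : Real.exp (-((κ / T - κ) * |μ|)) =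
        Real.exp (κ * |μ|) * Real.exp (-(κ * |μ|) * T⁻¹) := by
      rw [← Real.exp_add]; congr 1; field_simp; ring
    rw [shiftBound, hv, ENNReal.toReal_zero, add_zero, Real.rpow_zero, Real.rpow_two]
    have k2 := key (2 * M)
    have k0 := key 0
    rw [hexp] at k2 k0
    calc _ ≤ (Real.exp (κ * |μ|) * Real.exp (-(κ * |μ|) * T⁻¹) * w2) / T ^ 2 +
          Real.exp (κ * |μ|) * Real.exp (-(κ * |μ|) * T⁻¹) * w0 := by gcongr
      _ = _ := by field_simp
  have hlim : Tendsto (fun T : ℝ => Real.exp (κ * |μ|) *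
      (w2 * (T⁻¹ ^ (2 : ℝ) * Real.exp (-(κ * |μ|) * T⁻¹)) +
        w0 * (T⁻¹ ^ (0 : ℝ) * Real.exp (-(κ * |μ|) * T⁻¹)))) (𝓝[>] 0) (𝓝 0) := by
    have h2 := (tendsto_rpow_mul_exp_neg_mul_atTop_nhds_zero 2 _ hb).comp
      (tendsto_inv_nhdsGT_zero (𝕜 := ℝ))
    have h0 := (tendsto_rpow_mul_exp_neg_mul_atTop_nhds_zero 0 _ hb).comp
      (tendsto_inv_nhdsGT_zero (𝕜 := ℝ))
    have := ((h2.const_mul w2).add (h0.const_mul w0)).const_mul (Real.exp (κ * |μ|))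
    simpa using this
  exact tendsto_of_tendsto_of_tendsto_of_le_of_le' tendsto_const_nhds hlim
    (Eventually.of_forall fun T => shiftBound_nonneg M T) hle

theorem HasGrowth.tendsto_eta_of_neg {c γ D : ℝ} {N : ℕ} (H : HasGrowth ε c γ D N)
    (Hα : IsEntropyLike (renyi α) κ C) (hμ : μ < 0) (hbar : ℝ)
    {Ω : Set (EuclideanSpace ℝ (Fin d))} [IsFiniteMeasure (areaMeasure (frontier Ω))] :
    Tendsto (eta hbar α ε μ Ω) (𝓝[>] 0) (𝓝 0) := by
  obtain ⟨A, hA, hle⟩ := H.exists_abs_tangentIntegral_le μ Hα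
  have hlim : Tendsto (fun T => |(2 * Real.pi * hbar) ^ (1 - (d : ℤ))| *
      (A * shiftBound ε μ κ N T * (areaMeasure (frontier Ω)).real univ)) (𝓝[>] 0) (𝓝 0) := by
    have := (((H.tendsto_shiftBound hμ Hα.pos N).const_mul A).mul_const
      ((areaMeasure (frontier Ω)).real univ)).const_mul |(2 * Real.pi * hbar) ^ (1 - (d : ℤ))|
    simpa using this
  refine squeeze_zero_norm' ?_ hlim
  filter_upwards [self_mem_nhdsWithin] with T hT
  rw [eta, norm_mul, Real.norm_eq_abs]
  refine mul_le_mul_of_nonneg_left ?_ (abs_nonneg _)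
  exact norm_integral_le_of_norm_le_const (Eventually.of_forall fun q =>
    hle T hT _ (exteriorNormal_eq_zero_or Ω q))

theorem measurable_normalProduct (Ω : Set (EuclideanSpace ℝ (Fin d))) :
    Measurable (normalProduct ε μ Ω) := by
  have h1 : Measurable fun x : EuclideanSpace ℝ (Fin d) × EuclideanSpace ℝ (Fin d) =>
    exteriorNormal (fermiSea ε μ) x.1 := (measurable_exteriorNormal _).comp measurable_fst
  have h2 : Measurable fun x : EuclideanSpace ℝ (Fin d) × EuclideanSpace ℝ (Fin d) =>
    exteriorNormal Ω x.2 := (measurable_exteriorNormal _).comp measurable_snd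
  have h3 : Measurable fun x : EuclideanSpace ℝ (Fin d) × EuclideanSpace ℝ (Fin d) =>
    ⟪exteriorNormal (fermiSea ε μ) x.1, exteriorNormal Ω x.2⟫_ℝ := h1.inner h2
  exact continuous_abs.measurable.comp h3

theorem integrable_normalProduct (Ω : Set (EuclideanSpace ℝ (Fin d)))
    [IsFiniteMeasure (areaMeasure (fermiSurface ε μ))]
    [IsFiniteMeasure (areaMeasure (frontier Ω))] :
    Integrable (normalProduct ε μ Ω) (doubleSurfaceMeasure ε μ Ω) := by
  have : IsFiniteMeasure (doubleSurfaceMeasure ε μ Ω) := by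
    unfold doubleSurfaceMeasure; infer_instance
  refine (integrable_const (1 : ℝ)).mono' (measurable_normalProduct Ω).aestronglyMeasurable
    (Eventually.of_forall fun x => ?_)
  rw [normalProduct, Real.norm_eq_abs, abs_abs]
  exact (abs_real_inner_le_norm _ _).trans
    (mul_le_one₀ (norm_exteriorNormal_le _ _) (norm_nonneg _) (norm_exteriorNormal_le _ _))

/-- On a regular level set the exterior normal of the Fermi sea is the normalized gradient used in
`flux`, so the inner integral of J at q is the flux in the direction of the normal of Ω. -/
theorem integral_normalProduct (hε : ContDiff ℝ ∞ ε)
    (hreg : ∀ x, ε x = μ → gradient ε x ≠ 0) (Ω : Set (EuclideanSpace ℝ (Fin d)))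
    (q : EuclideanSpace ℝ (Fin d)) :
    ∫ p, normalProduct ε μ Ω (p, q) ∂(areaMeasure (fermiSurface ε μ)) =
      (flux (d - 1) ε μ (exteriorNormal Ω q)).toReal := by
  have hm : MeasurableSet {x | ε x = μ} :=
    (isClosed_eq hε.continuous continuous_const).measurableSet
  have h1 : Measurable fun p => normalProduct ε μ Ω (p, q) :=
    (measurable_normalProduct Ω).comp (measurable_id.prodMk measurable_const)
  have h0 : ∀ p, 0 ≤ normalProduct ε μ Ω (p, q) := fun p => abs_nonneg _
  rw [integral_eq_lintegral_of_nonneg_ae (Eventually.of_forall h0) h1.aestronglyMeasurable,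
    flux]
  congr 1
  refine setLIntegral_congr_fun hm fun x hx => ?_
  have hn := (isExteriorUnitNormal_fermiSea hx
    (hε.differentiable (by simp)).differentiableAt (hreg x hx)).exteriorNormal_eq
  simp only [normalProduct, hn]
  rfl

theorem flux_neg {k : ℕ} (n : EuclideanSpace ℝ (Fin d)) : flux k ε μ (-n) = flux k ε μ n := by
  simp [flux]

theorem HasGrowth.eta_isBigO {c γ D : ℝ} {N : ℕ} (H : HasGrowth ε c γ D N) (hα : 0 < α)
    (Hα : IsEntropyLike (renyi α) κ C) (hd : 1 ≤ d) (hμ : 0 < μ)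
    (hreg : ∀ x, ε x = μ → gradient ε x ≠ 0) (hbar : ℝ) {Ω : Set (EuclideanSpace ℝ (Fin d))}
    [IsFiniteMeasure (areaMeasure (fermiSurface ε μ))]
    [IsFiniteMeasure (areaMeasure (frontier Ω))] :
    (fun T : ℝ => eta hbar α ε μ Ω T - (1 + α) / (2 * α) *
      (1 / 12 * doubleSurfaceIntegral hbar ε μ Ω * Real.log (μ / T)))
        =O[𝓝[>] 0] (fun _ => (1 : ℝ)) := by
  have hk : Module.finrank ℝ (EuclideanSpace ℝ (Fin d)) = (d - 1) + 1 := by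
    rw [finrank_euclideanSpace_fin]; omega
  obtain ⟨K, hK, hlog⟩ := H.exists_halfIntegral_sub_log_le Hα hreg hk
  set τ := areaMeasure (frontier Ω) with hτ
  set P := (2 * Real.pi * hbar) ^ (1 - (d : ℤ)) with hP
  set j : EuclideanSpace ℝ (Fin d) → ℝ :=
    fun q => (flux (d - 1) ε μ (exteriorNormal Ω q)).toReal with hj
  -- The value 2 U_α(0,1)/(8π²): two half-lines of distances, and the prefactor of the functional.
  set b := (1 + α) / (24 * α) with hb
  have hJint := integrable_normalProduct (ε := ε) (μ := μ) Ω
  have hji : Integrable j τ := by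
    have := hJint.integral_prod_right
    simpa only [integral_normalProduct H.smooth hreg] using this
  have hJ : doubleSurfaceIntegral hbar ε μ Ω = P * ∫ q, j q ∂τ := by
    rw [doubleSurfaceIntegral, doubleSurfaceMeasure, integral_prod_symm _ hJint]
    simp only [integral_normalProduct H.smooth hreg, hj, hτ, hP]
  have hpi : (0 : ℝ) < 8 * Real.pi ^ 2 := by positivity
  have htan : ∀ T : ℝ, 0 < T → T ≤ 1 → ∀ q,
      |tangentIntegral α ε μ T (exteriorNormal Ω q) - b * Real.log (1 / T) * j q| ≤
        1 / (8 * Real.pi ^ 2) * (2 * K) := fun T hT hT1 q => by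
    have hn := exteriorNormal_eq_zero_or Ω q
    have hn1 := norm_exteriorNormal_le Ω q
    set n := exteriorNormal Ω q
    have h1 := hlog T hT hT1 n hn1
    have h2 := hlog T hT hT1 (-n) (by rwa [norm_neg])
    rw [flux_neg] at h2
    rw [H.tangentIntegral_eq Hα hT hn, H.integral_shiftIntegrand Hα hT hn1]
    have hjq : j q = (flux (d - 1) ε μ n).toReal := rfl
    rw [← hjq] at h1 h2
    have e : 1 / (8 * Real.pi ^ 2) * (halfIntegral α ε μ T n + halfIntegral α ε μ T (-n)) -
        b * Real.log (1 / T) * j q = 1 / (8 * Real.pi ^ 2) *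
        ((halfIntegral α ε μ T n - kernelU α 0 1 * j q * Real.log (1 / T)) +
          (halfIntegral α ε μ T (-n) - kernelU α 0 1 * j q * Real.log (1 / T))) := by
      rw [kernelU_zero_one hα, hb]
      field_simp
      ring
    rw [e, abs_mul, abs_of_pos (by positivity)]
    refine mul_le_mul_of_nonneg_left ((abs_add_le _ _).trans ?_) (by positivity)
    linarith
  refine IsBigO.of_bound (|P| * (1 / (8 * Real.pi ^ 2) * (2 * K) * τ.real univ) +
    |b * (P * ∫ q, j q ∂τ) * Real.log μ|) ?_
  filter_upwards [self_mem_nhdsWithin, (eventually_lt_nhds one_pos).filter_mono nhdsWithin_le_nhds]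
    with T hT hT1
  have hT : 0 < T := hT
  have hti : Integrable (fun q => tangentIntegral α ε μ T (exteriorNormal Ω q)) τ :=
    (H.etaConverges Hα hT).2
  -- The bound was proved with ln(1/T); the difference ln μ times the constant coefficient is
  -- absorbed into O(1).
  have e : eta hbar α ε μ Ω T - (1 + α) / (2 * α) *
      (1 / 12 * doubleSurfaceIntegral hbar ε μ Ω * Real.log (μ / T)) =
      P * (∫ q, (tangentIntegral α ε μ T (exteriorNormal Ω q) - b * Real.log (1 / T) * j q) ∂τ) -
        b * (P * ∫ q, j q ∂τ) * Real.log μ := by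
    rw [integral_sub hti (hji.const_mul _), integral_const_mul, hJ, eta,
      Real.log_div hμ.ne' hT.ne', one_div T, Real.log_inv, hb]
    field_simp
    ring
  rw [e, norm_one, mul_one, Real.norm_eq_abs]
  refine (abs_sub _ _).trans (add_le_add ?_ le_rfl)
  rw [abs_mul]
  refine mul_le_mul_of_nonneg_left ?_ (abs_nonneg _)
  rw [← Real.norm_eq_abs]
  exact norm_integral_le_of_norm_le_const (Eventually.of_forall fun q => htan T hT hT1.le q)

end Coefficient

end FermiGas

theorem mainTheorem4 (d : ℕ) (hd : 1 ≤ d) (hbar : ℝ) (hhbar : 0 < hbar) (α : ℝ) (hα : 0 < α)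
    (ε : EuclideanSpace ℝ (Fin d) → ℝ) (hε : FermiGas.IsDispersion α ε)
    (Ω : Set (EuclideanSpace ℝ (Fin d))) (hΩ : FermiGas.IsLipschitzDomain Ω)
    (hΩb : Bornology.IsBounded Ω) (μ : ℝ) :
    (∀ T : ℝ, 0 < T → FermiGas.EtaConverges α ε μ Ω T) ∧
    (0 < μ → (∀ p ∈ FermiGas.fermiSurface ε μ, fderiv ℝ ε p ≠ 0) →
      Integrable (FermiGas.normalProduct ε μ Ω) (FermiGas.doubleSurfaceMeasure ε μ Ω) ∧
      (fun T : ℝ => FermiGas.eta hbar α ε μ Ω T -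
          (1 + α) / (2 * α) *
            (1 / 12 * FermiGas.doubleSurfaceIntegral hbar ε μ Ω * Real.log (μ / T)))
        =O[𝓝[>] 0] (fun _ => (1 : ℝ))) ∧
    (μ < 0 → Tendsto (FermiGas.eta hbar α ε μ Ω) (𝓝[>] 0) (𝓝 0)) := by
  obtain ⟨κ, C, Hα⟩ := FermiGas.exists_isEntropyLike_renyi hα
  obtain ⟨c, γ, D, N, H⟩ := hε.exists_hasGrowth
  have hfin := FermiGas.isFiniteMeasure_areaMeasure
    (FermiGas.areaMeasure_frontier_lt_top hd hΩ hΩb)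
  refine ⟨fun T hT => H.etaConverges Hα hT, fun hμ hreg => ?_,
    fun hμ => H.tendsto_eta_of_neg Hα hμ hbar⟩
  have hgrad : ∀ x, ε x = μ → gradient ε x ≠ 0 := fun x hx h0 =>
    hreg x hx ((InnerProductSpace.toDual ℝ _).symm.map_eq_zero_iff.1 h0)
  have hS := FermiGas.isFiniteMeasure_areaMeasure (S := FermiGas.fermiSurface ε μ)
    (FermiGas.level_area_lt_top H.smooth (H.isCompact_sublevel μ) hgrad
      (by rw [finrank_euclideanSpace_fin]; omega))
  exact ⟨FermiGas.integrable_normalProduct Ω, H.eta_isBigO hα Hα hd hμ hgrad hbar⟩
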